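/- **Lemma 4.2.** Let $c>0$ and, for $a\in(0,\tfrac{27}{256}c^4)$, let $U(p)=-p^2+\dfrac{a}{(c-p)^2}$. On $(0,c)$ the equation $p(c-p)^3=a$ has exactly two roots $\phi_1\in(0,\tfrac c4)$ and $\phi_2\in(\tfrac c4,c)$, which are respectively a local maximum and a local minimum of $U$. Let $(a,b)$ belong to the existence region $$0<a<\tfrac{27}{256}c^4,\qquad U(\phi_2)<b<U(\phi_1),$$ and let $\phi_-\in(\phi_1,\phi_2)$ and $\phi_+\in(\phi_2,c)$ be the turning points, the unique solutions of $U(p)=b$ in these intervals. The period function is $$\mathfrak L(a,b):=2\int_{\phi_-}^{\phi_+}\frac{dp}{\sqrt{b-U(p)}} ,$$ and it is differentiable in $a$ (part of the claim). Let $\phi:\mathbb R\to\mathbb R$ be a $C^\infty$ periodic function with fundamental (least positive) period $L>0$, such that $c-\phi>0$ and $$(c-\phi)^2\bigl(\phi'^2-\phi^2-b\bigr)+a=0 .$$ Consider on the Hilbert space $L^2_{\rm per}$ of $L$-periodic square-integrable functions the bounded self-adjoint operator $$\mathcal L:=c-\phi-3c\,(4-\partial_x^2)^{-1}.$$ Then,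 counting eigenvalues with multiplicity, $\mathcal L$ admits * exactly two negative eigenvalues and a simple zero eigenvalue if $\partial_a\mathfrak L(a,b)>0$; * exactly one (simple) negative eigenvalue and a double zero eigenvalue if $\partial_a\mathfrak L(a,b)=0$; * exactly one (simple) negative eigenvalue and a simple zero eigenvalue if $\partial_a\mathfrak L(a,b)<0$. In all three cases the rest of the spectrum of $\mathcal L$ is strictly positive: there is $\delta>0$ such that every point of the spectrum other than $0$ and the negative eigenvalues lies in $[\delta,\infty)$. -/

import Mathlib

open MeasureTheory AddCircle
open scoped ENNReal ContDiff

noncomputable section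

namespace DPWave

/-! ### The existence region and the period function -/

/-- The potential `U(p) = -p² + a / (c - p)²`, so that the first-order invariant
`(c - φ)² (φ'² - φ² - b) + a = 0` reads `φ'² + U(φ) = b` wherever `φ < c`. -/
def potential (c a p : ℝ) : ℝ := -p ^ 2 + a / (c - p) ^ 2

/-- The local maximum `φ₁` of the potential: for `0 < a < 27 c⁴ / 256` the set below has exactly
one element, the root of `p (c - p)³ = a` in `(0, c/4)`. -/
def saddle (c a : ℝ) : ℝ := sInf {p | p ∈ Set.Ioo 0 (c / 4) ∧ p * (c - p) ^ 3 = a}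

/-- The local minimum `φ₂` of the potential: for `0 < a < 27 c⁴ / 256` the set below has exactly
one element, the root of `p (c - p)³ = a` in `(c/4, c)`. -/
def center (c a : ℝ) : ℝ := sInf {p | p ∈ Set.Ioo (c / 4) c ∧ p * (c - p) ^ 3 = a}

/-- The open region of parameters `(a, b)` for which smooth periodic waves exist:
`0 < a < 27 c⁴ / 256` and `U(φ₂) < b < U(φ₁)`. -/
def existenceRegion (c : ℝ) : Set (ℝ × ℝ) :=
  {q | 0 < q.1 ∧ q.1 < 27 / 256 * c ^ 4 ∧
    potential c q.1 (center c q.1) < q.2 ∧ q.2 < potential c q.1 (saddle c q.1)}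

/-- The lower turning point `φ₋`, the only solution of `U(p) = b` in `(φ₁, φ₂)` when `(a, b)`
lies in the existence region. -/
def turnLower (c a b : ℝ) : ℝ :=
  sInf {p | p ∈ Set.Ioo (saddle c a) (center c a) ∧ potential c a p = b}

/-- The upper turning point `φ₊`, the only solution of `U(p) = b` in `(φ₂, c)` when `(a, b)`
lies in the existence region. -/
def turnUpper (c a b : ℝ) : ℝ :=
  sInf {p | p ∈ Set.Ioo (center c a) c ∧ potential c a p = b}

/-- The period function `𝔏(a, b) = 2 ∫_{φ₋}^{φ₊} dp / √(b - U(p))`. -/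
def periodFn (c a b : ℝ) : ℝ :=
  2 * ∫ p in (turnLower c a b)..(turnUpper c a b), 1 / √(b - potential c a p)

/-- `φ` is a smooth periodic solution, of fundamental period `L`, of the first-order invariant
`(c - φ)² (φ'² - φ² - b) + a = 0` with `c - φ > 0`. Constant functions have no least positive
period, hence are not waves in this sense. -/
structure IsSmoothPeriodicWave (c a b L : ℝ) (φ : ℝ → ℝ) : Prop where
  smooth : ContDiff ℝ ∞ φ
  period : IsLeast {T : ℝ | 0 < T ∧ Function.Periodic φ T} L
  lt_speed : ∀ x, 0 < c - φ x
  invariant : ∀ x, (c - φ x) ^ 2 * ((deriv φ x) ^ 2 - (φ x) ^ 2 - b) + a = 0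

theorem IsSmoothPeriodicWave.periodic {c a b L : ℝ} {φ : ℝ → ℝ}
    (h : IsSmoothPeriodicWave c a b L φ) : Function.Periodic φ L := h.period.1.2

/-! ### The Hessian operator on `L²_per` -/

/-- The complex Hilbert space `L²_per` of square integrable `L`-periodic functions. -/
abbrev L2per (L : ℝ) [Fact (0 < L)] : Type := Lp ℂ 2 (@haarAddCircle L _)

/-- The continuous function on the circle `ℝ / Lℤ` induced by `c - φ`, for a continuous
`L`-periodic `φ`. -/
def speedMinus (c : ℝ) {L : ℝ} {φ : ℝ → ℝ} (hφ : Continuous φ) (hL : Function.Periodic φ L) :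
    C(AddCircle L, ℂ) where
  toFun x := ((c - hL.lift x : ℝ) : ℂ)
  continuous_toFun := by
    have h : Continuous (hL.lift : AddCircle L → ℝ) := hφ.quotient_liftOn' _
    exact Complex.continuous_ofReal.comp (continuous_const.sub h)

/-- The bounded operator `w ↦ V w` of multiplication by a continuous function on `L²_per`. -/
def mulOp {L : ℝ} [Fact (0 < L)] (V : C(AddCircle L, ℂ)) : L2per L →L[ℂ] L2per L :=
  (ContinuousLinearMap.mul ℂ ℂ).holderL haarAddCircle ∞ 2 2
    (ContinuousMap.toLp ∞ haarAddCircle ℂ V)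

theorem mulOp_coeFn {L : ℝ} [Fact (0 < L)] (V : C(AddCircle L, ℂ)) (w : L2per L) :
    mulOp V w =ᵐ[haarAddCircle] fun x => V x * w x := by
  have h1 : mulOp V w =ᵐ[haarAddCircle]
      fun x => (ContinuousMap.toLp ∞ haarAddCircle ℂ V : AddCircle L → ℂ) x * w x :=
    (ContinuousLinearMap.mul ℂ ℂ).coeFn_holder (r := 2) _ w
  filter_upwards [h1, ContinuousMap.coeFn_toLp (p := ∞) (𝕜 := ℂ) haarAddCircle V] with x h h'
  rw [h, h']

/-- The operator `(4 - ∂ₓ²)⁻¹` on `L²_per`, as a Fourier multiplier: on the orthonormal basis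
`eₙ(x) = exp (2 π i n x / L)` one has `(4 - ∂ₓ²) eₙ = (4 + (2 π n / L)²) eₙ`. The series of rank-one
operators converges absolutely in operator norm. -/
def resolventFour (L : ℝ) [Fact (0 < L)] : L2per L →L[ℂ] L2per L :=
  ∑' n : ℤ, ((1 / (4 + (2 * Real.pi * n / L) ^ 2) : ℝ) : ℂ) •
    InnerProductSpace.rankOne ℂ (fourierBasis (T := L) n) (fourierBasis (T := L) n)

/-- The series defining `(4 - ∂ₓ²)⁻¹` converges in operator norm. -/
theorem summable_resolventFour (L : ℝ) [Fact (0 < L)] :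
    Summable fun n : ℤ => ((1 / (4 + (2 * Real.pi * n / L) ^ 2) : ℝ) : ℂ) •
      InnerProductSpace.rankOne ℂ (fourierBasis (T := L) n) (fourierBasis (T := L) n) := by
  have hL : (0 : ℝ) < L := Fact.out
  have h2 : Summable fun n : ℤ => (L / (2 * Real.pi)) ^ 2 * (1 / (n : ℝ) ^ 2) :=
    (Real.summable_one_div_int_pow.mpr one_lt_two).mul_left _
  refine Summable.of_norm_bounded_eventually h2 ?_
  have hfin : ({0} : Set ℤ).Finite := Set.finite_singleton 0
  filter_upwards [hfin.compl_mem_cofinite] with n hn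
  have hn0 : (n : ℝ) ≠ 0 := by exact_mod_cast hn
  have hpos : 0 < (2 * Real.pi * n / L) ^ 2 := by
    have := Real.pi_pos
    positivity
  rw [norm_smul, InnerProductSpace.norm_rankOne, Complex.norm_real, Real.norm_eq_abs,
    (fourierBasis (T := L)).orthonormal.1 n, mul_one, mul_one, abs_of_pos (by positivity)]
  calc 1 / (4 + (2 * Real.pi * n / L) ^ 2) ≤ 1 / (2 * Real.pi * n / L) ^ 2 :=
        one_div_le_one_div_of_le hpos (by linarith)
    _ = (L / (2 * Real.pi)) ^ 2 * (1 / (n : ℝ) ^ 2) := by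
        have := Real.pi_pos.ne'
        field_simp

/-- On Fourier modes the operator `(4 - ∂ₓ²)⁻¹` acts by the factor `1 / (4 + (2 π n / L)²)`. -/
theorem resolventFour_fourierBasis (L : ℝ) [Fact (0 < L)] (m : ℤ) :
    resolventFour L (fourierBasis (T := L) m) =
      ((1 / (4 + (2 * Real.pi * m / L) ^ 2) : ℝ) : ℂ) • fourierBasis (T := L) m := by
  have h := (ContinuousLinearMap.apply ℂ (L2per L) (fourierBasis (T := L) m)).map_tsum
    (summable_resolventFour L)
  change resolventFour L (fourierBasis (T := L) m) = _ at h
  have ho := orthonormal_iff_ite.mp (fourierBasis (T := L)).orthonormal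
  rw [h, tsum_eq_single m]
  · rw [ContinuousLinearMap.apply_apply, smul_apply,
      InnerProductSpace.rankOne_apply, ho m m, if_pos rfl, one_smul]
  · intro n hn
    rw [ContinuousLinearMap.apply_apply, smul_apply,
      InnerProductSpace.rankOne_apply, ho n m, if_neg hn, zero_smul, smul_zero]

/-- The Hessian operator `𝓛 = c - φ - 3 c (4 - ∂ₓ²)⁻¹` on `L²_per`. -/
def hessian (c : ℝ) {L : ℝ} [Fact (0 < L)] {φ : ℝ → ℝ} (hφ : Continuous φ)
    (hL : Function.Periodic φ L) : L2per L →L[ℂ] L2per L :=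
  mulOp (speedMinus c hφ hL) - ((3 * c : ℝ) : ℂ) • resolventFour L

/-! ### Counting eigenvalues -/

/-- The multiplicity of `z` as an eigenvalue of `T`: the dimension of the eigenspace. -/
def eigMult {E : Type*} [NormedAddCommGroup E] [NormedSpace ℂ E] (T : E →L[ℂ] E) (z : ℂ) :
    Cardinal :=
  Module.rank ℂ (Module.End.eigenspace (T : E →ₗ[ℂ] E) z)

/-- The number of negative eigenvalues of `T` with their multiplicities: the dimension of the
(internal direct) sum of the eigenspaces for all real `μ < 0`. -/
def negEigCount {E : Type*} [NormedAddCommGroup E] [NormedSpace ℂ E] (T : E →L[ℂ] E) :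
    Cardinal :=
  Module.rank ℂ
    (⨆ μ : Set.Iio (0 : ℝ), Module.End.eigenspace (T : E →ₗ[ℂ] E) ((μ : ℝ) : ℂ) : Submodule ℂ E)

end DPWave

end

/-! Write `w = c - φ`, `A` for multiplication by `w`, `B` for its inverse and `K = (4 - ∂²)⁻¹`; the
operator is `A - 3cK`. A duality of Birman–Schwinger type trades it for the Hill operator `-∂² + q`
with `q = 4 - 3c/w`, whose form `E` is `energyForm`. For `u = Kv`, completing the square gives `⟨v,
(A - 3cK)v⟩ = ⟨v - 3cBu, A(v - 3cBu)⟩ + 3c E(u,u)` (`inner_sub_resolventFour`), while for `v = 3cBη`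
the left side is at most `3c E(η,η)` (`re_inner_le_energyForm`). As `A ≥ 0`, both bounds on the
number of negative eigenvalues can be read off `E`, and null vectors correspond through `u = Kv`.

The Hill equation `u'' = qu` has two explicit solutions. The quantity `w²/2` satisfies `(w²/2)'' =
force c b w`, and `q` is the derivative of the right side with respect to `w²/2`. Hence the
`x`-derivative `ψ = ww'` and the `a`-derivative `y` of `w²/2` both solve it. Differentiating `(ww')²
= quartic c b w - a` in `a` fixes their Wronskian. Over a period `ψ` repeats, while `y` returns to
its value with a jump `-(N x₀) τ` of its derivative, where `N = ψ'` and `τ = ∂ₐ𝔏`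
(`exists_profile`). The integrand of the period is singular at the turning points, which move with
`a`; the angle `θ` with `w` affine in `sin θ` turns the period into the integral of a smooth density
over a fixed interval (`exists_period_variation`).

For the count, let `x₀` be a minimum of `w` and `x₁` the next maximum. By `jacobi_inequality` the
form is nonnegative on functions vanishing at `x₀`, `x₁` and `x₀ + L`. Orthogonality to the half
wave `χ = ψ` on `[x₀, x₁]`, zero elsewhere, says that `N u` agrees at `x₀` and `x₁`; since `N y =
1/2` at both points, some `u - αy` vanishes there, and `E(u,u) = E(u - αy, u - αy) - τα²/(2L)`
(`Profile.form_ge`). So one condition suffices for nonnegativity if `τ ≤ 0`, and orthogonality to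
`y` as a second one suffices always. Conversely `χ` has zero energy and a small perturbation of it,
still orthogonal to `y`, has negative energy (`Profile.exists_neg_direction`), while `E(y,y) =
-τ/(2L)`. The equality case of Jacobi's inequality shows that the kernel comes from `ψ`, and from
`y` too exactly when `τ = 0`. Finally `A` is bounded below by a positive constant and `K` is
compact, so the Fredholm alternative isolates the nonpositive spectrum (`spectrum_gap`). -/

namespace DPWave

/-! ### Negative eigenspaces of compact perturbations: variational counting and the spectral gap. -/

section Spectral

variable {H : Type*} [NormedAddCommGroup H] [InnerProductSpace ℂ H]

/-- The sum of the eigenspaces for negative eigenvalues. -/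
def negSpace (T : H →L[ℂ] H) : Submodule ℂ H :=
  ⨆ μ : Set.Iio (0 : ℝ), Module.End.eigenspace (T : H →ₗ[ℂ] H) ((μ : ℝ) : ℂ)

theorem map_mem_negSpace (T : H →L[ℂ] H) {v : H} (hv : v ∈ negSpace T) : T v ∈ negSpace T := by
  unfold negSpace at hv
  induction hv using Submodule.iSup_induction' with
  | mem i x hx =>
    have := Module.End.mem_eigenspace_iff.mp hx
    simp only [ContinuousLinearMap.coe_coe] at this
    rw [this]
    exact Submodule.smul_mem _ _ (Submodule.mem_iSup_of_mem i hx)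
  | zero => simp
  | add x y _ _ hx hy => rw [map_add]; exact Submodule.add_mem _ hx hy

theorem isCompactOperator_starProjection (E : Submodule ℂ H) [FiniteDimensional ℂ E] :
    IsCompactOperator E.starProjection := by
  have : ProperSpace E := FiniteDimensional.proper ℂ E
  have h : IsCompactOperator (E.orthogonalProjectionOnto : H →L[ℂ] E) :=
    isCompactOperator_of_locallyCompactSpace_dom _
  exact h.clm_comp E.subtypeL

variable [CompleteSpace H]

/-- Fredholm alternative for a compact perturbation of an operator without `z` in its spectrum. -/
theorem hasEigenvalue_of_mem_spectrum_sub {A K : H →L[ℂ] H} {z : ℂ}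
    (hA : IsUnit (A - algebraMap ℂ (H →L[ℂ] H) z)) (hK : IsCompactOperator K)
    (hz : z ∈ spectrum ℂ (A - K)) :
    Module.End.HasEigenvalue ((A - K : H →L[ℂ] H) : H →ₗ[ℂ] H) z := by
  obtain ⟨u, hu⟩ := hA
  -- Everything rests on `A - K - z = (A - z)(1 - (A - z)⁻¹K)`: either `1` is an eigenvalue of the
  -- compact operator `(A - z)⁻¹K`, or the second factor is invertible too.
  have hS : IsCompactOperator ((↑u⁻¹ : H →L[ℂ] H) * K) := hK.clm_comp _
  rcases hS.hasEigenvalue_or_mem_resolventSet (one_ne_zero (α := ℂ)) with h | h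
  · obtain ⟨v, hv⟩ := h.exists_hasEigenvector
    have h1 : (↑u⁻¹ : H →L[ℂ] H) (K v) = v := by simpa using hv.apply_eq_smul
    have h2 : K v = (u : H →L[ℂ] H) v := by
      conv_rhs => rw [← h1]
      rw [← mul_apply_eq_comp (u : H →L[ℂ] H), u.mul_inv, one_apply_eq_self]
    refine Module.End.hasEigenvalue_of_hasEigenvector (x := v) ⟨?_, hv.2⟩
    rw [Module.End.mem_eigenspace_iff]
    rw [hu] at h2
    simp only [ContinuousLinearMap.coe_coe, sub_apply, h2,
      Algebra.algebraMap_eq_smul_one, smul_apply,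
      one_apply_eq_self]
    abel
  · exfalso
    rw [spectrum.mem_resolventSet_iff] at h
    apply hz
    rw [spectrum.mem_resolventSet_iff]
    have h3 : (u : H →L[ℂ] H) * (algebraMap ℂ (H →L[ℂ] H) 1 - (↑u⁻¹ : H →L[ℂ] H) * K)
        = -(algebraMap ℂ (H →L[ℂ] H) z - (A - K)) := by
      rw [mul_sub, ← mul_assoc, u.mul_inv, hu, map_one]
      simp only [mul_one, one_mul]
      abel
    rw [← IsUnit.neg_iff, ← h3]
    exact u.isUnit.mul h

theorem isPositive_of_spectrum {T : H →L[ℂ] H} (hT : IsSelfAdjoint T)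
    (h : ∀ r : ℝ, r < 0 → (r : ℂ) ∉ spectrum ℂ T) : T.IsPositive := by
  rw [← ContinuousLinearMap.nonneg_iff_isPositive,
    nonneg_iff_isSelfAdjoint_and_quasispectrumRestricts]
  refine ⟨hT, ?_⟩
  rw [quasispectrumRestricts_iff_spectrumRestricts, SpectrumRestricts.nnreal_iff]
  intro x hx
  by_contra! hx0
  exact h x hx0 ((hT.coe_mem_spectrum_complex).mpr hx)

/-- Eigenspaces of a symmetric operator are mutually orthogonal, so on their sum the form is
diagonal, `Σ μᵢ ‖vᵢ‖²`, with every `μᵢ < 0`. -/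
theorem re_inner_neg_of_mem_negSpace {T : H →L[ℂ] H} (hT : IsSelfAdjoint T) {v : H}
    (hv : v ∈ negSpace T) (hv0 : v ≠ 0) : (inner ℂ v (T v)).re < 0 := by
  classical
  have hsym : (T : H →ₗ[ℂ] H).IsSymmetric := hT.isSymmetric
  have horth := hsym.orthogonalFamily_eigenspaces.comp
    (f := fun μ : Set.Iio (0 : ℝ) => ((μ : ℝ) : ℂ))
    (fun x y h => Subtype.ext (Complex.ofReal_injective h))
  obtain ⟨l, rfl⟩ := (Submodule.mem_iSup_iff_exists_dfinsupp' _ _).mp hv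
  have hT1 : T (l.sum fun _ xi => (xi : H)) =
      ∑ i ∈ l.support, (((i : ℝ) : ℂ) • (l i : H)) := by
    rw [DFinsupp.sum, map_sum]
    refine Finset.sum_congr rfl fun i _ => ?_
    exact Module.End.mem_eigenspace_iff.mp (l i).2
  have hin : inner ℂ (l.sum fun _ xi => (xi : H)) (T (l.sum fun _ xi => (xi : H)))
      = ∑ i ∈ l.support, ((((i : ℝ) * ‖(l i : H)‖ ^ 2 : ℝ)) : ℂ) := by
    rw [hT1]
    have := horth.inner_sum l (fun i => ((i : ℝ) : ℂ) • l i) l.support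
    simp only [Submodule.coe_subtypeₗᵢ, Submodule.coe_subtype,
      Submodule.coe_smul] at this
    rw [DFinsupp.sum, this]
    refine Finset.sum_congr rfl fun i _ => ?_
    rw [inner_smul_right, inner_self_eq_norm_sq_to_K]
    push_cast
    rfl
  rw [hin, Complex.re_sum]
  simp only [Complex.ofReal_re]
  have hne : l.support.Nonempty := by
    rw [Finset.nonempty_iff_ne_empty]
    intro h
    apply hv0
    rw [DFinsupp.sum, h, Finset.sum_empty]
  apply Finset.sum_neg _ hne
  intro i hi
  have : (l i : H) ≠ 0 := fun h => (DFinsupp.mem_support_iff.mp hi) (Subtype.ext h)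
  have h1 : (i : ℝ) < 0 := i.2
  have h2 : 0 < ‖(l i : H)‖ ^ 2 := by positivity
  exact mul_neg_of_neg_of_pos h1 h2

/-- If the part of the spectrum below `0` consists of eigenvalues whose eigenspaces span a finite
dimensional space, then the operator is nonnegative on the orthogonal complement. -/
theorem re_inner_nonneg_of_mem_negSpace_orthogonal {A K : H →L[ℂ] H}
    (hT : IsSelfAdjoint (A - K)) (hK : IsCompactOperator K)
    (hA : ∀ r : ℝ, r < 0 → IsUnit (A - algebraMap ℂ (H →L[ℂ] H) (r : ℂ)))
    [FiniteDimensional ℂ (negSpace (A - K))] {v : H} (hv : v ∈ (negSpace (A - K))ᗮ) :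
    0 ≤ (inner ℂ v ((A - K) v)).re := by
  set T := A - K with hTdef
  set E := negSpace T with hE
  have hsym : (T : H →ₗ[ℂ] H).IsSymmetric := hT.isSymmetric
  set P := E.starProjection
  -- The finite-rank term `‖T‖ P` lifts the negative eigenspaces to nonnegative values and leaves
  -- the form unchanged on `Eᗮ`. It is compact, so the Fredholm alternative still applies and
  -- positivity reduces to excluding negative eigenvalues.
  set C : ℂ := ((‖T‖ : ℝ) : ℂ)
  have hP : IsSelfAdjoint (C • P) := by
    have h1 : IsSelfAdjoint P := isSelfAdjoint_starProjection E
    have h2 : IsSelfAdjoint C := by simp [C, IsSelfAdjoint]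
    exact h2.smul h1
  have hPc : IsCompactOperator (C • P) := (isCompactOperator_starProjection E).smul C
  have hT'sa : IsSelfAdjoint (T + C • P) := hT.add hP
  have hT' : T + C • P = A - (K - C • P) := by rw [hTdef]; abel
  have hpos : (T + C • P).IsPositive := by
    refine isPositive_of_spectrum hT'sa fun r hr hmem => ?_
    rw [hT'] at hmem
    have hev := hasEigenvalue_of_mem_spectrum_sub (hA r hr) (hK.sub hPc) hmem
    rw [← hT'] at hev
    obtain ⟨x, hx⟩ := hev.exists_hasEigenvector
    have hx1 : T x + C • P x = (r : ℂ) • x := by simpa using hx.apply_eq_smul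
    set p := P x with hp
    have hpE : p ∈ E := Submodule.starProjection_apply_mem E x
    set y := x - p with hy
    have hyE : y ∈ Eᗮ := Submodule.sub_starProjection_mem_orthogonal x
    have hxy : x = p + y := by rw [hy]; abel
    have hTy : T y ∈ Eᗮ := by
      intro w hw
      rw [← ContinuousLinearMap.coe_coe T, ← hsym w y]
      exact hyE _ (map_mem_negSpace T hw)
    have hsplit : (T p + C • p - (r : ℂ) • p) = -(T y - (r : ℂ) • y) := by
      have : T p + T y + C • p = (r : ℂ) • p + (r : ℂ) • y := by
        rw [← map_add, ← smul_add, ← hxy]; exact hx1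
      rw [← sub_eq_zero] at this ⊢
      rw [← this]; abel
    have hl : T p + C • p - (r : ℂ) • p ∈ E :=
      E.sub_mem (E.add_mem (map_mem_negSpace T hpE) (E.smul_mem _ hpE)) (E.smul_mem _ hpE)
    have hr' : T p + C • p - (r : ℂ) • p ∈ Eᗮ := by
      rw [hsplit]
      exact Submodule.neg_mem _ (Submodule.sub_mem _ hTy (Submodule.smul_mem _ _ hyE))
    have h0 : T p + C • p - (r : ℂ) • p = 0 := by
      have := hr' _ hl
      exact inner_self_eq_zero.mp this
    have hy0 : T y = (r : ℂ) • y := by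
      rw [h0, eq_comm, neg_eq_zero, sub_eq_zero] at hsplit
      exact hsplit
    have hyE' : y ∈ E :=
      Submodule.mem_iSup_of_mem (⟨r, hr⟩ : Set.Iio (0 : ℝ)) (Module.End.mem_eigenspace_iff.mpr hy0)
    have hyz : y = 0 := inner_self_eq_zero.mp (hyE _ hyE')
    -- The component in `E` would be an eigenvector of `T` for `r - ‖T‖`, whose modulus exceeds
    -- `‖T‖` because `r < 0`.
    have hTp : T p = ((r - ‖T‖ : ℝ) : ℂ) • p := by
      have h1 : T p = (r : ℂ) • p - C • p := by
        rw [← sub_eq_zero, ← h0]; abel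
      rw [h1, ← sub_smul]; simp [C]
    have hp0 : p = 0 := by
      by_contra hp0
      have h1 : ‖T p‖ ≤ ‖T‖ * ‖p‖ := T.le_opNorm p
      rw [hTp, norm_smul, Complex.norm_real, Real.norm_eq_abs] at h1
      have h2 : 0 < ‖p‖ := norm_pos_iff.mpr hp0
      have h3 := le_of_mul_le_mul_right h1 h2
      have h4 : -(r - ‖T‖) ≤ |r - ‖T‖| := neg_le_abs _
      linarith
    exact hx.2 (by rw [hxy, hp0, hyz, add_zero])
  have h1 := hpos.re_inner_nonneg_right v
  have h2 : P v = 0 := (Submodule.starProjection_apply_eq_zero_iff E).mpr hv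
  simpa [h2] using h1

/-- A subspace on which the form is negative has dimension at most that of the sum of the
eigenspaces with negative eigenvalues. -/
theorem rank_le_rank_negSpace {A K : H →L[ℂ] H}
    (hT : IsSelfAdjoint (A - K)) (hK : IsCompactOperator K)
    (hA : ∀ r : ℝ, r < 0 → IsUnit (A - algebraMap ℂ (H →L[ℂ] H) (r : ℂ)))
    (W : Submodule ℂ H) [FiniteDimensional ℂ W]
    (hW : ∀ v ∈ W, v ≠ 0 → (inner ℂ v ((A - K) v)).re < 0) :
    Module.rank ℂ W ≤ Module.rank ℂ (negSpace (A - K)) := by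
  by_contra! hlt
  have hfin : FiniteDimensional ℂ (negSpace (A - K)) := by
    exact Module.rank_lt_aleph0_iff.mp (hlt.trans (Module.rank_lt_aleph0 ℂ W))
  -- If `W` were larger, the orthogonal projection of `W` to the negative space would kill some
  -- nonzero vector, on which the form is both negative and nonnegative.
  set f : W →ₗ[ℂ] negSpace (A - K) :=
    ((negSpace (A - K)).orthogonalProjectionOnto : H →ₗ[ℂ] negSpace (A - K)) ∘ₗ W.subtype
  have hker : ¬ Function.Injective f := fun hf =>
    hlt.not_ge (LinearMap.rank_le_of_injective f hf)
  rw [← LinearMap.ker_eq_bot, Submodule.eq_bot_iff] at hker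
  push Not at hker
  obtain ⟨x, hx, hx0⟩ := hker
  have hx1 : (x : H) ∈ (negSpace (A - K))ᗮ := by
    rw [LinearMap.mem_ker] at hx
    exact Submodule.orthogonalProjectionOnto_eq_zero_iff.mp hx
  have h1 := re_inner_nonneg_of_mem_negSpace_orthogonal hT hK hA hx1
  have h2 := hW x x.2 (fun h => hx0 (Subtype.ext h))
  linarith

/-- Negativity of the form makes `F` injective on the negative space: `n` linear conditions that
force nonnegativity bound the dimension by `n`. -/
theorem rank_negSpace_le_of_functional {T : H →L[ℂ] H} (hT : IsSelfAdjoint T) {n : ℕ}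
    (F : H →ₗ[ℂ] (Fin n → ℂ)) (hF : ∀ v, F v = 0 → 0 ≤ (inner ℂ v (T v)).re) :
    Module.rank ℂ (negSpace T) ≤ n := by
  have hinj : Function.Injective (F ∘ₗ (negSpace T).subtype) := by
    rw [← LinearMap.ker_eq_bot, Submodule.eq_bot_iff]
    intro x hx
    by_contra hx0
    have h1 := hF x (LinearMap.mem_ker.mp hx)
    have h2 := re_inner_neg_of_mem_negSpace hT x.2 (fun h => hx0 (Subtype.ext h))
    linarith
  have := LinearMap.lift_rank_le_of_injective _ hinj
  simpa using this

/-- Zero is not an accumulation point of the spectrum, and negative spectral points are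
eigenvalues. -/
theorem spectrum_gap {A K : H →L[ℂ] H} (hT : IsSelfAdjoint (A - K)) (hK : IsCompactOperator K)
    {w₀ : ℝ} (hw₀ : 0 < w₀)
    (hA : ∀ r : ℝ, r < w₀ → IsUnit (A - algebraMap ℂ (H →L[ℂ] H) (r : ℂ)))
    [FiniteDimensional ℂ (Module.End.eigenspace ((A - K : H →L[ℂ] H) : H →ₗ[ℂ] H) 0)] :
    ∃ δ : ℝ, 0 < δ ∧ ∀ z ∈ spectrum ℂ (A - K), z = 0 ∨
      (∃ r : ℝ, r < 0 ∧ z = (r : ℂ) ∧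
        Module.End.HasEigenvalue ((A - K : H →L[ℂ] H) : H →ₗ[ℂ] H) z) ∨
      ∃ r : ℝ, δ ≤ r ∧ z = (r : ℂ) := by
  set T := A - K with hTdef
  have hsym : (T : H →ₗ[ℂ] H).IsSymmetric := hT.isSymmetric
  set E := Module.End.eigenspace (T : H →ₗ[ℂ] H) 0 with hE
  set P := E.starProjection
  have hPsa : IsSelfAdjoint P := isSelfAdjoint_starProjection E
  have hPc : IsCompactOperator P := isCompactOperator_starProjection E
  have hT' : T + P = A - (K - P) := by rw [hTdef]; abel
  have hET : ∀ x ∈ E, T x = 0 := fun x hx => by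
    have := Module.End.mem_eigenspace_iff.mp hx
    simpa using this
  have hTE : ∀ x, T x ∈ Eᗮ := fun x w hw => by
    rw [← ContinuousLinearMap.coe_coe T, ← hsym w x, ContinuousLinearMap.coe_coe, hET w hw,
      inner_zero_left]
  -- Adding the projection onto the kernel makes `T` invertible. The spectrum of `T + P` then misses
  -- a ball around `0`, and `T` and `T + P` share their eigenvectors for nonzero eigenvalues of `T`.
  have h0 : (0 : ℂ) ∉ spectrum ℂ (T + P) := by
    intro hmem
    rw [hT'] at hmem
    have hA0 := hA 0 hw₀
    rw [Complex.ofReal_zero] at hA0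
    have hev := hasEigenvalue_of_mem_spectrum_sub hA0 (hK.sub hPc) hmem
    rw [← hT'] at hev
    obtain ⟨x, hx⟩ := hev.exists_hasEigenvector
    have hx1 : T x + P x = 0 := by simpa using hx.apply_eq_smul
    have hPx : P x ∈ E := Submodule.starProjection_apply_mem E x
    have hPx' : P x ∈ Eᗮ := by
      have : P x = -T x := by rw [eq_neg_iff_add_eq_zero, add_comm]; exact hx1
      rw [this]
      exact Submodule.neg_mem _ (hTE x)
    have hP0 : P x = 0 := inner_self_eq_zero.mp (hPx' _ hPx)
    have hTx : T x = 0 := by rw [hP0, add_zero] at hx1; exact hx1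
    have hxE : x ∈ E := by
      rw [hE, Module.End.mem_eigenspace_iff]; simpa using hTx
    have : P x = x := Submodule.starProjection_eq_self_iff.mpr hxE
    exact hx.2 (by rw [← this, hP0])
  have hopen : IsOpen (spectrum ℂ (T + P))ᶜ := (spectrum.isClosed _).isOpen_compl
  obtain ⟨ε, hε, hball⟩ := Metric.isOpen_iff.mp hopen 0 h0
  -- Below `w₀` spectral points are eigenvalues by the Fredholm alternative; below `ε` a positive
  -- one would fall into the ball free of spectrum of `T + P`.
  refine ⟨min ε w₀, lt_min hε hw₀, fun z hz => ?_⟩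
  have hzr : z = (z.re : ℂ) := hT.mem_spectrum_eq_re hz
  rcases lt_trichotomy z.re 0 with h | h | h
  · refine Or.inr (Or.inl ⟨z.re, h, hzr, ?_⟩)
    rw [hzr] at hz ⊢
    exact hasEigenvalue_of_mem_spectrum_sub (hA _ (h.trans hw₀)) hK hz
  · left; rw [hzr, h, Complex.ofReal_zero]
  · refine Or.inr (Or.inr ⟨z.re, ?_, hzr⟩)
    by_contra! hlt
    rw [hzr] at hz
    have hev := hasEigenvalue_of_mem_spectrum_sub (hA _ (hlt.trans_le (min_le_right _ _))) hK hz
    obtain ⟨x, hx⟩ := hev.exists_hasEigenvector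
    have hx1 : T x = (z.re : ℂ) • x := hx.apply_eq_smul
    have hzne : (z.re : ℂ) ≠ 0 := Complex.ofReal_ne_zero.mpr h.ne'
    have hxE : x ∈ Eᗮ := by
      have : x = (z.re : ℂ)⁻¹ • T x := by rw [hx1, smul_smul, inv_mul_cancel₀ hzne, one_smul]
      rw [this]
      exact Submodule.smul_mem _ _ (hTE x)
    have hPx : P x = 0 := (Submodule.starProjection_apply_eq_zero_iff E).mpr hxE
    have hev' : Module.End.HasEigenvalue ((T + P : H →L[ℂ] H) : H →ₗ[ℂ] H) (z.re : ℂ) := by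
      refine Module.End.hasEigenvalue_of_hasEigenvector (x := x) ⟨?_, hx.2⟩
      rw [Module.End.mem_eigenspace_iff]
      simp [hx1, hPx]
    have hmem : (z.re : ℂ) ∈ spectrum ℂ (T + P) := by
      rw [ContinuousLinearMap.spectrum_eq]; exact hev'.mem_spectrum
    refine hball ?_ hmem
    rw [Metric.mem_ball, dist_zero_right, Complex.norm_real, Real.norm_eq_abs, abs_of_pos h]
    exact hlt.trans_le (min_le_left _ _)

end Spectral

/-! ### Fourier analysis on the circle: the resolvent, weak derivatives and representatives. -/

section Circle

variable {L : ℝ} [hLf : Fact (0 < L)]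

/-- The wave number `2 π n / L`. -/
noncomputable def waveNumber (L : ℝ) (n : ℤ) : ℝ := 2 * Real.pi * n / L

theorem hasSum_resolventFour (v : L2per L) :
    HasSum (fun n : ℤ => ((1 / (4 + waveNumber L n ^ 2) : ℝ) : ℂ) •
      (inner ℂ (fourierBasis (T := L) n) v • fourierBasis (T := L) n)) (resolventFour L v) := by
  have h := (summable_resolventFour L).hasSum.map (ContinuousLinearMap.apply ℂ (L2per L) v)
    (ContinuousLinearMap.apply ℂ (L2per L) v).continuous
  exact h

theorem inner_resolventFour_right (v : L2per L) (m : ℤ) :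
    inner ℂ (fourierBasis (T := L) m) (resolventFour L v) =
      ((1 / (4 + waveNumber L m ^ 2) : ℝ) : ℂ) * inner ℂ (fourierBasis (T := L) m) v := by
  have h := (innerSL ℂ (fourierBasis (T := L) m)).hasSum (hasSum_resolventFour v)
  have ho := orthonormal_iff_ite.mp (fourierBasis (T := L)).orthonormal
  refine h.unique ?_
  refine (hasSum_ite_eq m (((1 / (4 + waveNumber L m ^ 2) : ℝ) : ℂ) *
    inner ℂ (fourierBasis (T := L) m) v)).congr_fun fun n => ?_
  rw [innerSL_apply_apply, inner_smul_right, inner_smul_right, ho]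
  by_cases hn : n = m
  · subst hn; simp
  · simp [hn, Ne.symm hn]

theorem isSelfAdjoint_resolventFour : IsSelfAdjoint (resolventFour L) := by
  have h := (summable_resolventFour L).hasSum
  have h1 := (ContinuousLinearMap.adjoint (𝕜 := ℂ) (E := L2per L) (F := L2per L)).continuous
  have h2 := h.map (ContinuousLinearMap.adjoint (𝕜 := ℂ) (E := L2per L) (F := L2per L)) h1
  rw [ContinuousLinearMap.isSelfAdjoint_iff']
  refine h2.unique ?_
  refine h.congr_fun fun n => ?_
  simp only [Function.comp_apply, LinearIsometryEquiv.map_smulₛₗ,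
    InnerProductSpace.adjoint_rankOne, Complex.conj_ofReal]

/-- The defining series converges in operator norm, so the operator is a norm limit of finite-rank
ones. -/
theorem isCompactOperator_resolventFour : IsCompactOperator (resolventFour L) := by
  have h := (summable_resolventFour L).hasSum
  refine isCompactOperator_of_tendsto h (Filter.Eventually.of_forall fun s => ?_)
  induction s using Finset.induction_on with
  | empty => simpa using isCompactOperator_zero
  | insert a s ha ih =>
    rw [Finset.sum_insert ha]
    refine IsCompactOperator.add (IsCompactOperator.smul ?_ _) ih
    have h1 : IsCompactOperator (innerSL ℂ (fourierBasis (T := L) a)) :=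
      isCompactOperator_of_locallyCompactSpace_dom _
    exact h1.clm_comp (ContinuousLinearMap.toSpanSingleton ℂ (fourierBasis (T := L) a))

theorem ext_inner_fourierBasis {u v : L2per L}
    (h : ∀ n, inner ℂ (fourierBasis (T := L) n) u = inner ℂ (fourierBasis (T := L) n) v) :
    u = v := by
  apply (fourierBasis (T := L)).repr.injective
  ext n
  rw [HilbertBasis.repr_apply_apply, HilbertBasis.repr_apply_apply, h n]

/-- `η'` is the weak derivative of `η` on the circle. -/
def IsWeakDeriv (η η' : L2per L) : Prop :=
  ∀ n : ℤ, inner ℂ (fourierBasis (T := L) n) η' =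
    (Complex.I * (waveNumber L n : ℂ)) * inner ℂ (fourierBasis (T := L) n) η

theorem IsWeakDeriv.add {η η' ζ ζ' : L2per L} (h : IsWeakDeriv η η') (k : IsWeakDeriv ζ ζ') :
    IsWeakDeriv (η + ζ) (η' + ζ') := fun n => by
  rw [inner_add_right, inner_add_right, h n, k n]; ring

theorem IsWeakDeriv.smul {η η' : L2per L} (h : IsWeakDeriv η η') (r : ℂ) :
    IsWeakDeriv (r • η) (r • η') := fun n => by
  rw [inner_smul_right, inner_smul_right, h n]; ring

theorem four_add_sq_ne_zero (r : ℝ) : (4 + (r : ℂ) ^ 2) ≠ 0 := by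
  have : (0 : ℝ) < 4 + r ^ 2 := by positivity
  exact_mod_cast this.ne'

/-- The weak form of `(4 - ∂²) u = v`. -/
theorem inner_eq_of_isWeakDeriv {η η' u' v : L2per L} (hη : IsWeakDeriv η η')
    (hu : IsWeakDeriv (resolventFour L v) u') :
    inner ℂ η v = inner ℂ η' u' + 4 * inner ℂ η (resolventFour L v) := by
  -- Parseval on each of the three products; mode by mode the claim is `1 = k²/(4 + k²) + 4/(4 +
  -- k²)`.
  have h1 := (fourierBasis (T := L)).hasSum_inner_mul_inner η v
  have h2 := (fourierBasis (T := L)).hasSum_inner_mul_inner η' u'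
  have h3 := ((fourierBasis (T := L)).hasSum_inner_mul_inner η (resolventFour L v)).mul_left 4
  refine h1.unique ?_
  convert h2.add h3 using 2 with n
  have e1 : inner ℂ η' (fourierBasis (T := L) n) =
      -(Complex.I * (waveNumber L n : ℂ)) * inner ℂ η (fourierBasis (T := L) n) := by
    rw [← inner_conj_symm, hη n, map_mul, inner_conj_symm]
    simp
  rw [e1, hu n, inner_resolventFour_right]
  have hne := four_add_sq_ne_zero (waveNumber L n)
  push_cast
  field_simp
  linear_combination (inner ℂ η (fourierBasis (T := L) n) *
    inner ℂ (fourierBasis (T := L) n) v * (waveNumber L n : ℂ) ^ 2) * Complex.I_sq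

/-- A weak solution of `(4 - ∂²) u = v` is given by the resolvent. -/
theorem resolventFour_eq_of_weak {u u' v : L2per L} (hu : IsWeakDeriv u u')
    (h : ∀ n : ℤ, inner ℂ (fourierBasis (T := L) n) v =
      inner ℂ ((Complex.I * (waveNumber L n : ℂ)) • fourierBasis (T := L) n) u' +
        4 * inner ℂ (fourierBasis (T := L) n) u) :
    resolventFour L v = u := by
  refine ext_inner_fourierBasis fun n => ?_
  rw [inner_resolventFour_right, h n, inner_smul_left, hu n]
  have hne := four_add_sq_ne_zero (waveNumber L n)
  simp only [map_mul, Complex.conj_I, Complex.conj_ofReal]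
  push_cast
  field_simp
  linear_combination (-(waveNumber L n : ℂ) ^ 2) * inner ℂ (fourierBasis (T := L) n) u *
    Complex.I_sq

/-- Functions in the range of `(4 - ∂²)⁻¹` are continuously differentiable. -/
theorem exists_hasDerivAt_resolventFour (v : L2per L) :
    ∃ U U' : C(AddCircle L, ℂ), ContinuousMap.toLp 2 haarAddCircle ℂ U = resolventFour L v ∧
      IsWeakDeriv (resolventFour L v) (ContinuousMap.toLp 2 haarAddCircle ℂ U') ∧
      ∀ x : ℝ, HasDerivAt (fun y : ℝ => U (y : AddCircle L)) (U' (x : AddCircle L)) x := by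
  have hL : (0 : ℝ) < L := Fact.out
  set c : ℤ → ℂ := fun n => ((1 / (4 + waveNumber L n ^ 2) : ℝ) : ℂ) *
    inner ℂ (fourierBasis (T := L) n) v with hc
  set d : ℤ → ℂ := fun n => (Complex.I * (waveNumber L n : ℂ)) * c n with hd
  have hbess : Summable fun n : ℤ => ‖inner ℂ (fourierBasis (T := L) n) v‖ ^ 2 :=
    (fourierBasis (T := L)).orthonormal.inner_products_summable v
  have hm : Summable fun n : ℤ => 1 / (4 + waveNumber L n ^ 2) := by
    have := (summable_resolventFour L).hasSum
    have h2 : Summable fun n : ℤ => (L / (2 * Real.pi)) ^ 2 * (1 / (n : ℝ) ^ 2) :=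
      (Real.summable_one_div_int_pow.mpr one_lt_two).mul_left _
    refine Summable.of_norm_bounded_eventually h2 ?_
    filter_upwards [(Set.finite_singleton (0 : ℤ)).compl_mem_cofinite] with n hn
    have hn0 : (n : ℝ) ≠ 0 := by exact_mod_cast hn
    have hpi := Real.pi_pos
    have hpos : 0 < waveNumber L n ^ 2 := by unfold waveNumber; positivity
    rw [Real.norm_eq_abs, abs_of_pos (by positivity)]
    calc 1 / (4 + waveNumber L n ^ 2) ≤ 1 / waveNumber L n ^ 2 :=
          one_div_le_one_div_of_le hpos (by linarith)
      _ = _ := by unfold waveNumber; field_simp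
  -- One summable majorant serves the coefficients of both the function and its derivative: by the
  -- inequality between arithmetic and geometric means, `rt` and `krt` are at most `r + t²` when `r
  -- = 1/(4 + k²)` and `t` is the modulus of the Fourier coefficient of `v`.
  set B : ℤ → ℝ := fun n => 1 / (4 + waveNumber L n ^ 2) +
    ‖inner ℂ (fourierBasis (T := L) n) v‖ ^ 2 with hB
  have hBs : Summable B := hm.add hbess
  have hboth : ∀ n, ‖c n‖ ≤ B n ∧ ‖d n‖ ≤ B n := by
    intro n
    have hk : 0 < 4 + waveNumber L n ^ 2 := by positivity
    set k := |waveNumber L n| with hkdef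
    set t := ‖inner ℂ (fourierBasis (T := L) n) v‖
    have hk2 : waveNumber L n ^ 2 = k ^ 2 := (sq_abs _).symm
    have hcn : ‖c n‖ = 1 / (4 + k ^ 2) * t := by
      rw [hc, norm_mul, Complex.norm_real, Real.norm_eq_abs, abs_of_pos (by positivity), hk2]
    have hdn : ‖d n‖ = k * (1 / (4 + k ^ 2) * t) := by
      rw [hd, norm_mul, norm_mul, Complex.norm_I, Complex.norm_real, Real.norm_eq_abs, hcn, one_mul]
    have ht : 0 ≤ t := norm_nonneg _
    have hk0 : 0 ≤ k := abs_nonneg _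
    have hBn : B n = 1 / (4 + k ^ 2) + t ^ 2 := by rw [hB, ← hk2]
    have hr : 0 < 1 / (4 + k ^ 2) := by positivity
    set r := 1 / (4 + k ^ 2) with hrdef
    have hrk : r * k ^ 2 ≤ 1 := by
      rw [hrdef, one_div, inv_mul_le_iff₀ (by positivity)]; linarith
    have hr1 : r ≤ 1 := by
      rw [hrdef, div_le_one (by positivity)]; nlinarith
    rw [hcn, hdn, hBn]
    constructor
    · nlinarith [mul_nonneg hr.le ht, sq_nonneg (t - r), sq_nonneg t, sq_nonneg r]
    · nlinarith [sq_nonneg (r * k - t), mul_nonneg hr.le (sq_nonneg k),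
        mul_nonneg hr.le (sub_nonneg.mpr hrk), sq_nonneg t]
  have hcs : Summable fun n => c n • (fourier n : C(AddCircle L, ℂ)) :=
    Summable.of_norm_bounded hBs fun n => by
      rw [norm_smul, fourier_norm, mul_one]; exact (hboth n).1
  have hds : Summable fun n => d n • (fourier n : C(AddCircle L, ℂ)) :=
    Summable.of_norm_bounded hBs fun n => by
      rw [norm_smul, fourier_norm, mul_one]; exact (hboth n).2
  have ho := orthonormal_iff_ite.mp (fourierBasis (T := L)).orthonormal
  have hcoef : ∀ e : ℤ → ℂ, Summable (fun n => e n • (fourier n : C(AddCircle L, ℂ))) → ∀ m,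
      inner ℂ (fourierBasis (T := L) m) (ContinuousMap.toLp 2 haarAddCircle ℂ
        (∑' n, e n • (fourier n : C(AddCircle L, ℂ)))) = e m := by
    intro e he m
    have h1 := ((innerSL ℂ (fourierBasis (T := L) m)).comp
      (ContinuousMap.toLp (E := ℂ) 2 haarAddCircle ℂ)).hasSum he.hasSum
    refine h1.unique ?_
    refine (hasSum_ite_eq m (e m)).congr_fun fun n => ?_
    have h2 : ContinuousMap.toLp (E := ℂ) 2 (haarAddCircle (T := L)) ℂ (fourier n)
        = fourierBasis (T := L) n := by rw [coe_fourierBasis]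
    rw [ContinuousLinearMap.comp_apply, map_smul, h2, innerSL_apply_apply, inner_smul_right, ho]
    by_cases hn : n = m
    · subst hn; simp
    · simp [hn, Ne.symm hn]
  have hU : ContinuousMap.toLp 2 haarAddCircle ℂ (∑' n, c n • (fourier n : C(AddCircle L, ℂ)))
      = resolventFour L v :=
    ext_inner_fourierBasis fun n => by rw [hcoef c hcs, inner_resolventFour_right]
  refine ⟨∑' n, c n • fourier n, ∑' n, d n • fourier n, hU, fun n => ?_, fun x => ?_⟩
  · rw [hcoef d hds, inner_resolventFour_right]
  · have hev : ∀ (e : ℤ → ℂ), Summable (fun n => e n • (fourier n : C(AddCircle L, ℂ))) →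
        ∀ y : AddCircle L, (∑' n, e n • (fourier n : C(AddCircle L, ℂ))) y
          = ∑' n, e n * fourier n y := by
      intro e he y
      have := (ContinuousMap.evalCLM ℂ y).map_tsum he
      simpa using this
    simp_rw [hev c hcs, hev d hds]
    refine hasDerivAt_tsum (y₀ := (0 : ℝ)) (u := B)
      (g := fun n (y : ℝ) => c n * fourier n (y : AddCircle L))
      (g' := fun n (y : ℝ) => d n * fourier n (y : AddCircle L)) hBs
      (fun n y => ?_) (fun n y => ?_) ?_ x
    · have := (hasDerivAt_fourier L n y).const_mul (c n)
      refine this.congr_deriv ?_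
      rw [hd]; simp only [waveNumber]; push_cast; ring
    · rw [norm_mul]
      have : ‖(fourier n (y : AddCircle L) : ℂ)‖ = 1 := by
        rw [fourier_apply]; exact Circle.norm_coe _
      rw [this, mul_one]; exact (hboth n).2
    · refine Summable.of_norm_bounded hBs fun n => ?_
      rw [norm_mul]
      have : ‖(fourier n ((0 : ℝ) : AddCircle L) : ℂ)‖ = 1 := by
        rw [fourier_apply]; exact Circle.norm_coe _
      rw [this, mul_one]; exact (hboth n).1

/-! ### Representatives on a period interval -/

/-- The function `g` on `(x₀, x₀ + L]` represents the element `v` of `L²_per`. -/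
def Represents (x₀ : ℝ) (v : L2per L) (g : ℝ → ℂ) : Prop :=
  ∀ᵐ x : ℝ ∂(volume.restrict (Set.Ioc x₀ (x₀ + L))), v (x : AddCircle L) = g x

theorem ae_restrict_of_ae_haar {x₀ : ℝ} {p : AddCircle L → Prop}
    (h : ∀ᵐ t ∂haarAddCircle, p t) :
    ∀ᵐ x : ℝ ∂(volume.restrict (Set.Ioc x₀ (x₀ + L))), p (x : AddCircle L) := by
  have h1 : ∀ᵐ t ∂(volume : Measure (AddCircle L)), p t := by
    rw [volume_eq_smul_haarAddCircle]
    exact Measure.ae_smul_measure h _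
  exact (AddCircle.measurePreserving_mk L x₀).quasiMeasurePreserving.ae h1

theorem exists_represents (x₀ : ℝ) {g : ℝ → ℂ}
    (hg : MemLp g 2 (volume.restrict (Set.Ioc x₀ (x₀ + L)))) :
    ∃ v : L2per L, Represents x₀ v g := by
  have h := hg.memLp_liftIoc.haarAddCircle
  refine ⟨h.toLp, ?_⟩
  have h1 := ae_restrict_of_ae_haar (x₀ := x₀) h.coeFn_toLp
  have h2 : ∀ᵐ x : ℝ ∂(volume.restrict (Set.Ioc x₀ (x₀ + L))), x ∈ Set.Ioc x₀ (x₀ + L) :=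
    ae_restrict_mem measurableSet_Ioc
  filter_upwards [h1, h2] with x hx hx2
  rw [hx, liftIoc_coe_apply hx2]

theorem Represents.add {x₀ : ℝ} {v w : L2per L} {g h : ℝ → ℂ} (hv : Represents x₀ v g)
    (hw : Represents x₀ w h) : Represents x₀ (v + w) (fun x => g x + h x) := by
  filter_upwards [hv, hw, ae_restrict_of_ae_haar (Lp.coeFn_add v w)] with x h1 h2 h3
  rw [h3, Pi.add_apply, h1, h2]

theorem Represents.smul {x₀ : ℝ} {v : L2per L} {g : ℝ → ℂ} (hv : Represents x₀ v g) (r : ℂ) :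
    Represents x₀ (r • v) (fun x => r * g x) := by
  filter_upwards [hv, ae_restrict_of_ae_haar (Lp.coeFn_smul r v)] with x h1 h3
  rw [h3, Pi.smul_apply, h1, smul_eq_mul]

theorem Represents.mulOp {x₀ : ℝ} {v : L2per L} {g : ℝ → ℂ} (hv : Represents x₀ v g)
    (V : C(AddCircle L, ℂ)) : Represents x₀ (mulOp V v) (fun x => V (x : AddCircle L) * g x) := by
  filter_upwards [hv, ae_restrict_of_ae_haar (mulOp_coeFn V v)] with x h1 h3
  rw [h3, h1]

theorem represents_toLp (x₀ : ℝ) (U : C(AddCircle L, ℂ)) :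
    Represents x₀ (ContinuousMap.toLp 2 haarAddCircle ℂ U) (fun x => U (x : AddCircle L)) :=
  ae_restrict_of_ae_haar (ContinuousMap.coeFn_toLp haarAddCircle U)

theorem Represents.congr {x₀ : ℝ} {v : L2per L} {g h : ℝ → ℂ} (hv : Represents x₀ v g)
    (hgh : ∀ x ∈ Set.Ioc x₀ (x₀ + L), g x = h x) : Represents x₀ v h := by
  filter_upwards [hv, ae_restrict_mem measurableSet_Ioc] with x h1 h2
  rw [h1, hgh x h2]

theorem Represents.inner {x₀ : ℝ} {v w : L2per L} {g h : ℝ → ℂ} (hv : Represents x₀ v g)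
    (hw : Represents x₀ w h) :
    inner ℂ v w = (L : ℂ)⁻¹ * ∫ x in x₀..x₀ + L, (starRingEnd ℂ) (g x) * h x := by
  have hL : (0 : ℝ) < L := Fact.out
  rw [L2.inner_def, integral_haarAddCircle, ← AddCircle.intervalIntegral_preimage L x₀,
    Complex.real_smul, Complex.ofReal_inv]
  congr 1
  refine intervalIntegral.integral_congr_ae_restrict ?_
  rw [Set.uIoc_of_le (by linarith)]
  filter_upwards [hv, hw] with x h1 h2
  rw [RCLike.inner_apply, h1, h2, mul_comm]

theorem represents_fourierBasis (x₀ : ℝ) (n : ℤ) :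
    Represents x₀ (fourierBasis (T := L) n) (fun x => fourier n (x : AddCircle L)) := by
  rw [coe_fourierBasis]
  exact represents_toLp x₀ (fourier n)

/-- Continuous periodic functions with an integrable right derivative have a weak derivative. -/
theorem isWeakDeriv_of_represents {x₀ : ℝ} {η η' : L2per L} {g g' : ℝ → ℂ}
    (hη : Represents x₀ η g) (hη' : Represents x₀ η' g')
    (hg : ContinuousOn g (Set.Icc x₀ (x₀ + L))) (hper : g (x₀ + L) = g x₀)
    (hd : ∀ x ∈ Set.Ioo x₀ (x₀ + L), HasDerivWithinAt g (g' x) (Set.Ioi x) x)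
    (hi : IntervalIntegrable g' volume x₀ (x₀ + L)) : IsWeakDeriv η η' := by
  intro n
  have hL : (0 : ℝ) < L := Fact.out
  have hle : x₀ ≤ x₀ + L := by linarith
  have hf : ∀ x : ℝ, (starRingEnd ℂ) (fourier n (x : AddCircle L)) =
      fourier (-n) (x : AddCircle L) := fun x => by rw [fourier_neg]
  rw [(represents_fourierBasis x₀ n).inner hη', (represents_fourierBasis x₀ n).inner hη]
  simp_rw [hf]
  have hcont : Continuous fun x : ℝ => (fourier (-n) (x : AddCircle L) : ℂ) :=
    (map_continuous (fourier (-n))).comp (AddCircle.continuous_mk' _)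
  have hparts := intervalIntegral.integral_mul_deriv_eq_deriv_mul_of_hasDeriv_right
    (u := fun x : ℝ => (fourier (-n) (x : AddCircle L) : ℂ))
    (u' := fun x => -2 * Real.pi * Complex.I * n / L * fourier (-n) (x : AddCircle L))
    (v := g) (v' := g') (a := x₀) (b := x₀ + L)
    hcont.continuousOn (by rwa [Set.uIcc_of_le hle])
    (fun x _ => (hasDerivAt_fourier_neg L n x).hasDerivWithinAt)
    (fun x hx => hd x (by simpa [hle] using hx))
    ((continuous_const.mul hcont).intervalIntegrable _ _) hi
  rw [hparts]
  -- Both the Fourier mode and `g` take equal values at the two ends, so the boundary terms cancel.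
  have hp : ((x₀ + L : ℝ) : AddCircle L) = (x₀ : AddCircle L) := by simp
  rw [hp, hper, sub_self, zero_sub]
  have : ∀ x : ℝ, -2 * Real.pi * Complex.I * n / L * fourier (-n) (x : AddCircle L) * g x
      = (-2 * Real.pi * Complex.I * n / L) * (fourier (-n) (x : AddCircle L) * g x) :=
    fun x => by ring
  simp_rw [this]
  rw [intervalIntegral.integral_const_mul]
  unfold waveNumber
  push_cast
  ring

end Circle

/-! ### Duality between the operator `A - 3cK` and the energy form of the Hill operator. -/

section Energy

variable {L : ℝ} [hLf : Fact (0 < L)]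

theorem mulOp_mul (V W : C(AddCircle L, ℂ)) : mulOp (V * W) = mulOp V * mulOp W := by
  ext1 v
  apply Lp.ext
  rw [mul_apply_eq_comp]
  filter_upwards [mulOp_coeFn (V * W) v, mulOp_coeFn V (mulOp W v), mulOp_coeFn W v]
    with t h1 h2 h3
  rw [h1, h2, h3, ContinuousMap.mul_apply, mul_assoc]

theorem mulOp_const (z : ℂ) :
    mulOp (ContinuousMap.const (AddCircle L) z) = algebraMap ℂ (L2per L →L[ℂ] L2per L) z := by
  ext1 v
  apply Lp.ext
  rw [Algebra.algebraMap_eq_smul_one, smul_apply, one_apply_eq_self]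
  filter_upwards [mulOp_coeFn (ContinuousMap.const (AddCircle L) z) v, Lp.coeFn_smul z v]
    with t h1 h2
  rw [h1, h2, ContinuousMap.const_apply, Pi.smul_apply, smul_eq_mul]

theorem mulOp_sub (V W : C(AddCircle L, ℂ)) : mulOp (V - W) = mulOp V - mulOp W := by
  ext1 v
  apply Lp.ext
  rw [sub_apply]
  filter_upwards [mulOp_coeFn (V - W) v, mulOp_coeFn V v, mulOp_coeFn W v,
    Lp.coeFn_sub (mulOp V v) (mulOp W v)] with t h1 h2 h3 h4
  rw [h1, h4, Pi.sub_apply, h2, h3, ContinuousMap.sub_apply, sub_mul]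

theorem inner_mulOp_left {V : C(AddCircle L, ℂ)} (hV : ∀ t, (starRingEnd ℂ) (V t) = V t)
    (v w : L2per L) : inner ℂ (mulOp V v) w = inner ℂ v (mulOp V w) := by
  rw [L2.inner_def, L2.inner_def]
  refine integral_congr_ae ?_
  filter_upwards [mulOp_coeFn V v, mulOp_coeFn V w] with t h1 h2
  rw [h1, h2, RCLike.inner_apply, RCLike.inner_apply, map_mul, hV t]
  ring

theorem isSelfAdjoint_mulOp {V : C(AddCircle L, ℂ)} (hV : ∀ t, (starRingEnd ℂ) (V t) = V t) :
    IsSelfAdjoint (mulOp V) := by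
  rw [ContinuousLinearMap.isSelfAdjoint_iff_isSymmetric]
  exact fun v w => inner_mulOp_left hV v w

theorem isUnit_mulOp_sub {V : C(AddCircle L, ℂ)} {z : ℂ} (h : ∀ t, V t ≠ z) :
    IsUnit (mulOp V - algebraMap ℂ (L2per L →L[ℂ] L2per L) z) := by
  rw [← mulOp_const, ← mulOp_sub]
  set W : C(AddCircle L, ℂ) := V - ContinuousMap.const _ z
  have hW : ∀ t, W t ≠ 0 := fun t => sub_ne_zero.mpr (h t)
  set W' : C(AddCircle L, ℂ) := ⟨fun t => (W t)⁻¹, W.continuous.inv₀ hW⟩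
  have h1 : W * W' = ContinuousMap.const _ 1 := by
    ext t; exact mul_inv_cancel₀ (hW t)
  have h2 : W' * W = ContinuousMap.const _ 1 := by
    ext t; exact inv_mul_cancel₀ (hW t)
  refine ⟨⟨mulOp W, mulOp W', ?_, ?_⟩, rfl⟩
  · rw [← mulOp_mul, h1, mulOp_const, map_one]
  · rw [← mulOp_mul, h2, mulOp_const, map_one]

theorem re_inner_mulOp_nonneg {V : C(AddCircle L, ℂ)} {w : AddCircle L → ℝ}
    (hV : ∀ t, V t = (w t : ℂ)) (hw : ∀ t, 0 ≤ w t) (v : L2per L) :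
    0 ≤ (inner ℂ v (mulOp V v)).re := by
  rw [L2.inner_def]
  have h1 : ∫ t, inner ℂ (v t) (mulOp V v t) ∂haarAddCircle =
      ((∫ t, w t * ‖v t‖ ^ 2 ∂haarAddCircle : ℝ) : ℂ) := by
    rw [← integral_complex_ofReal]
    refine integral_congr_ae ?_
    filter_upwards [mulOp_coeFn V v] with t h1
    rw [h1, RCLike.inner_apply, hV t, mul_assoc, RCLike.mul_conj]
    push_cast
    rfl
  rw [h1, Complex.ofReal_re]
  exact integral_nonneg fun t => mul_nonneg (hw t) (sq_nonneg _)

/-- The sesquilinear form of `-∂² + 4 - 3 c B` on pairs of a function and its weak derivative. -/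
noncomputable def energyForm (c : ℝ) (B : L2per L →L[ℂ] L2per L) (η η' ζ ζ' : L2per L) : ℂ :=
  inner ℂ η' ζ' + 4 * inner ℂ η ζ - 3 * c * inner ℂ η (B ζ)

variable {c : ℝ} {A B : L2per L →L[ℂ] L2per L}

/-- The weak equation `(4 - ∂²)u = v` absorbs the gradient term and the constant `4` into `⟨η, v⟩`,
so no second derivative is needed. -/
theorem energyForm_resolventFour {η η' u' v : L2per L} (hη : IsWeakDeriv η η')
    (hu : IsWeakDeriv (resolventFour L v) u') :
    energyForm c B η η' (resolventFour L v) u' =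
      inner ℂ η v - 3 * c * inner ℂ η (B (resolventFour L v)) := by
  rw [energyForm, inner_eq_of_isWeakDeriv hη hu]

/-- Completion of the square in `v` around `3cBu`, `u = Kv`. With `A ≥ 0`, nonnegative energy of `u`
gives a nonnegative form at `v`: this yields the upper bounds on the negative count. -/
theorem inner_sub_resolventFour (hA : IsSelfAdjoint A) (hAB : A * B = 1)
    {v u' : L2per L} (hu : IsWeakDeriv (resolventFour L v) u') :
    inner ℂ v ((A - ((3 * c : ℝ) : ℂ) • resolventFour L) v) =
      inner ℂ (v - ((3 * c : ℝ) : ℂ) • B (resolventFour L v))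
        (A (v - ((3 * c : ℝ) : ℂ) • B (resolventFour L v))) +
      3 * c * energyForm c B (resolventFour L v) u' (resolventFour L v) u' := by
  rw [energyForm_resolventFour hu hu]
  set u := resolventFour L v
  have hABu : A (B u) = u := by rw [← mul_apply_eq_comp A, hAB, one_apply_eq_self]
  have hsym : ∀ x y, inner ℂ (A x) y = inner ℂ x (A y) := fun x y => hA.isSymmetric x y
  have h1 : inner ℂ (B u) (A v) = inner ℂ u v := by rw [← hsym, hABu]
  have h2 : inner ℂ (B u) u = inner ℂ u (B u) := by
    have := hsym (B u) (B u)
    rw [hABu] at this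
    exact this.symm
  simp only [sub_apply, smul_apply, map_sub, map_smul, inner_sub_left, inner_sub_right,
    inner_smul_left, inner_smul_right, hABu, h1, h2, Complex.conj_ofReal]
  push_cast
  ring

/-- The converse comparison, which yields the lower bounds. With `v = 3cBη` and `u = Kv` the gap
between the two sides is exactly `3c(‖η' - u'‖² + 4‖η - u‖²)`. -/
theorem re_inner_le_energyForm (hAB : A * B = 1) (hc : 0 < c)
    {η η' : L2per L} (hη : IsWeakDeriv η η') :
    (inner ℂ (((3 * c : ℝ) : ℂ) • B η)
      ((A - ((3 * c : ℝ) : ℂ) • resolventFour L) (((3 * c : ℝ) : ℂ) • B η))).re ≤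
      3 * c * (energyForm c B η η' η η').re := by
  set v := ((3 * c : ℝ) : ℂ) • B η with hv
  obtain ⟨-, U', -, hu, -⟩ := exists_hasDerivAt_resolventFour v
  set u' : L2per L := ContinuousMap.toLp 2 haarAddCircle ℂ U'
  have hABη : A (B η) = η := by rw [← mul_apply_eq_comp A, hAB, one_apply_eq_self]
  have hAv : A v = ((3 * c : ℝ) : ℂ) • η := by rw [hv, map_smul, hABη]
  have h1 := inner_eq_of_isWeakDeriv hη hu
  have h2 := inner_eq_of_isWeakDeriv hu hu
  set u := resolventFour L v with hudef
  have h3 : inner ℂ η v = 3 * c * inner ℂ η (B η) := by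
    rw [hv, inner_smul_right]; push_cast; ring
  have h4 : inner ℂ v η = inner ℂ u' η' + 4 * inner ℂ u η := by
    rw [← inner_conj_symm, h1, map_add, map_mul, inner_conj_symm, inner_conj_symm, map_ofNat]
  have h5 : inner ℂ v u = inner ℂ u' u' + 4 * inner ℂ u u := by
    rw [← inner_conj_symm, h2, map_add, map_mul, inner_conj_symm, inner_conj_symm, map_ofNat]
  have key : 3 * c * energyForm c B η η' η η' =
      inner ℂ v ((A - ((3 * c : ℝ) : ℂ) • resolventFour L) v) +
        3 * c * (inner ℂ (η' - u') (η' - u') + 4 * inner ℂ (η - u) (η - u)) := by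
    rw [energyForm, sub_apply, smul_apply, hAv, ← hudef]
    simp only [inner_sub_left, inner_sub_right, inner_smul_right]
    push_cast
    linear_combination (-3 * (c : ℂ)) * h1 - 3 * (c : ℂ) * h4 + 3 * (c : ℂ) * h5
      + 3 * (c : ℂ) * h3
  have hre := congrArg Complex.re key
  rw [Complex.add_re] at hre
  have e1 : ∀ z : ℂ, (3 * (c : ℂ) * z).re = 3 * c * z.re := fun z => by
    have : (3 * (c : ℂ) * z) = ((3 * c : ℝ) : ℂ) * z := by push_cast; ring
    rw [this, Complex.re_ofReal_mul]
  rw [e1, e1, Complex.add_re] at hre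
  have p1 : 0 ≤ (inner ℂ (η' - u') (η' - u')).re := inner_self_nonneg (𝕜 := ℂ)
  have p2 : 0 ≤ (4 * inner ℂ (η - u) (η - u) : ℂ).re := by
    have := inner_self_nonneg (𝕜 := ℂ) (x := η - u)
    have e : (4 * inner ℂ (η - u) (η - u) : ℂ) = ((4 : ℝ) : ℂ) * inner ℂ (η - u) (η - u) := by
      norm_num
    rw [e, Complex.re_ofReal_mul]
    exact mul_nonneg (by norm_num) this
  have : 0 ≤ 3 * c * ((inner ℂ (η' - u') (η' - u')).re + (4 * inner ℂ (η - u) (η - u) : ℂ).re) :=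
    mul_nonneg (by linarith) (add_nonneg p1 p2)
  linarith

theorem eq_of_apply_eq_zero (hBA : B * A = 1) {v : L2per L}
    (hv : (A - ((3 * c : ℝ) : ℂ) • resolventFour L) v = 0) :
    v = ((3 * c : ℝ) : ℂ) • B (resolventFour L v) := by
  rw [sub_apply, smul_apply, sub_eq_zero] at hv
  rw [← map_smul, ← hv, ← mul_apply_eq_comp B, hBA, one_apply_eq_self]

theorem energyForm_eq_zero_of_apply_eq_zero (hBA : B * A = 1) {η η' u' v : L2per L}
    (hη : IsWeakDeriv η η') (hu : IsWeakDeriv (resolventFour L v) u')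
    (hv : (A - ((3 * c : ℝ) : ℂ) • resolventFour L) v = 0) :
    energyForm c B η η' (resolventFour L v) u' = 0 := by
  rw [energyForm_resolventFour hη hu]
  nth_rw 1 [eq_of_apply_eq_zero hBA hv]
  rw [inner_smul_right]
  push_cast
  ring

/-- Testing against Fourier modes says that `u` solves `(4 - ∂²)u = 3cBu` weakly, hence `u =
K(3cBu)`; since `AB = 1`, the vector `3cBu` is null. -/
theorem apply_eq_zero_of_energyForm (hAB : A * B = 1) {u u' : L2per L}
    (hu : IsWeakDeriv u u')
    (h : ∀ n : ℤ, energyForm c B (fourierBasis (T := L) n)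
      ((Complex.I * (waveNumber L n : ℂ)) • fourierBasis (T := L) n) u u' = 0) :
    resolventFour L (((3 * c : ℝ) : ℂ) • B u) = u ∧
      (A - ((3 * c : ℝ) : ℂ) • resolventFour L) (((3 * c : ℝ) : ℂ) • B u) = 0 := by
  have h1 : resolventFour L (((3 * c : ℝ) : ℂ) • B u) = u := by
    refine resolventFour_eq_of_weak hu fun n => ?_
    have := h n
    rw [energyForm] at this
    rw [inner_smul_right]
    push_cast
    linear_combination -this
  refine ⟨h1, ?_⟩
  rw [sub_apply, smul_apply, h1, map_smul, ← mul_apply_eq_comp A, hAB, one_apply_eq_self, sub_self]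

theorem energyForm_eq_integral {x₀ : ℝ} {W : C(AddCircle L, ℂ)} {w : ℝ → ℝ}
    (hW : ∀ x : ℝ, W (x : AddCircle L) = ((w x)⁻¹ : ℝ)) {η η' ζ ζ' : L2per L}
    {g g' h h' : ℝ → ℂ} (hη : Represents x₀ η g) (hη' : Represents x₀ η' g')
    (hζ : Represents x₀ ζ h) (hζ' : Represents x₀ ζ' h')
    (hg : ContinuousOn g (Set.Icc x₀ (x₀ + L))) (hh : ContinuousOn h (Set.Icc x₀ (x₀ + L)))
    (hi : IntervalIntegrable (fun x => (starRingEnd ℂ) (g' x) * h' x) volume x₀ (x₀ + L)) :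
    energyForm c (mulOp W) η η' ζ ζ' = (L : ℂ)⁻¹ * ∫ x in x₀..x₀ + L,
      ((starRingEnd ℂ) (g' x) * h' x +
        ((4 - 3 * c / w x : ℝ) : ℂ) * ((starRingEnd ℂ) (g x) * h x)) := by
  have hL : (0 : ℝ) < L := Fact.out
  have hle : x₀ ≤ x₀ + L := by linarith
  have hWc : Continuous fun x : ℝ => W (x : AddCircle L) :=
    W.continuous.comp (AddCircle.continuous_mk' _)
  have hgh : ContinuousOn (fun x => (starRingEnd ℂ) (g x) * h x) (Set.uIcc x₀ (x₀ + L)) := by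
    rw [Set.uIcc_of_le hle]
    exact (Complex.continuous_conj.comp_continuousOn hg).mul hh
  have hgWh : ContinuousOn (fun x => (starRingEnd ℂ) (g x) * (W (x : AddCircle L) * h x))
      (Set.uIcc x₀ (x₀ + L)) := by
    rw [Set.uIcc_of_le hle]
    exact (Complex.continuous_conj.comp_continuousOn hg).mul (hWc.continuousOn.mul hh)
  rw [energyForm, hη'.inner hζ', hη.inner hζ, hη.inner (hζ.mulOp W)]
  have e : ∀ x, (starRingEnd ℂ) (g' x) * h' x +
        ((4 - 3 * c / w x : ℝ) : ℂ) * ((starRingEnd ℂ) (g x) * h x) =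
      (starRingEnd ℂ) (g' x) * h' x + 4 * ((starRingEnd ℂ) (g x) * h x) -
        3 * c * ((starRingEnd ℂ) (g x) * (W (x : AddCircle L) * h x)) := by
    intro x
    rw [hW x]
    push_cast
    ring
  simp_rw [e]
  rw [intervalIntegral.integral_sub (hi.add (hgh.intervalIntegrable.const_mul 4))
    (hgWh.intervalIntegrable.const_mul _),
    intervalIntegral.integral_add hi (hgh.intervalIntegrable.const_mul 4),
    intervalIntegral.integral_const_mul, intervalIntegral.integral_const_mul]
  ring

end Energy

/-! ### Roots of the cubic, monotonicity of the potential and the turning points. -/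

section TurningPoints

/-- The polynomial `w² ((c - w)² + b)`: in the variable `w = c - φ` the first order invariant reads
`(w w')² = quartic c b w - a`. -/
def quartic (c b w : ℝ) : ℝ := w ^ 2 * ((c - w) ^ 2 + b)

/-- The derivative of `quartic c b` divided by `2 w`. -/
def force (c b w : ℝ) : ℝ := c ^ 2 + b - 3 * c * w + 2 * w ^ 2

theorem hasDerivAt_quartic (c b w : ℝ) :
    HasDerivAt (quartic c b) (2 * w * force c b w) w := by
  have h1 : HasDerivAt (fun w : ℝ => w ^ 2) (2 * w) w := by simpa using hasDerivAt_pow 2 w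
  have h2 : HasDerivAt (fun w : ℝ => (c - w) ^ 2 + b) (2 * (c - w) * (-1)) w := by
    have := (((hasDerivAt_id w).const_sub c).pow 2).add_const b
    simpa using this
  refine (h1.mul h2).congr_deriv ?_
  unfold force
  ring

variable {c a b : ℝ}

theorem hasDerivAt_cubic (c p : ℝ) :
    HasDerivAt (fun p : ℝ => p * (c - p) ^ 3) ((c - p) ^ 2 * (c - 4 * p)) p := by
  have h2 : HasDerivAt (fun w : ℝ => (c - w) ^ 3) (3 * (c - p) ^ 2 * (-1)) p := by
    have := ((hasDerivAt_id p).const_sub c).fun_pow 3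
    simpa using this
  refine ((hasDerivAt_id p).mul h2).congr_deriv ?_
  simp only [id]
  ring

theorem strictMonoOn_cubic (c : ℝ) : StrictMonoOn (fun p : ℝ => p * (c - p) ^ 3)
    (Set.Icc 0 (c / 4)) := by
  refine strictMonoOn_of_deriv_pos (convex_Icc _ _) (by fun_prop) fun p hp => ?_
  rw [interior_Icc] at hp
  rw [(hasDerivAt_cubic c p).deriv]
  have h1 : 0 < c - p := by linarith [hp.1, hp.2]
  exact mul_pos (by positivity) (by linarith [hp.2])

theorem strictAntiOn_cubic (c : ℝ) : StrictAntiOn (fun p : ℝ => p * (c - p) ^ 3)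
    (Set.Icc (c / 4) c) := by
  refine strictAntiOn_of_deriv_neg (convex_Icc _ _) (by fun_prop) fun p hp => ?_
  rw [interior_Icc] at hp
  rw [(hasDerivAt_cubic c p).deriv]
  have h1 : 0 < c - p := by linarith [hp.2]
  exact mul_neg_of_pos_of_neg (by positivity) (by linarith [hp.1])

theorem sInf_eq_of_unique {S : Set ℝ} {p : ℝ} (hp : p ∈ S) (h : ∀ q ∈ S, q = p) : sInf S = p := by
  have : S = {p} := Set.eq_singleton_iff_unique_mem.mpr ⟨hp, h⟩
  rw [this, csInf_singleton]

theorem saddle_spec (hc : 0 < c) (ha : 0 < a) (ha' : a < 27 / 256 * c ^ 4) :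
    saddle c a ∈ Set.Ioo 0 (c / 4) ∧ saddle c a * (c - saddle c a) ^ 3 = a := by
  have hcont : ContinuousOn (fun p : ℝ => p * (c - p) ^ 3) (Set.Icc 0 (c / 4)) := by fun_prop
  have hivt := intermediate_value_Ioo (by linarith : (0 : ℝ) ≤ c / 4) hcont
  obtain ⟨p, hp, hpa⟩ := hivt (show a ∈ _ from ⟨by simpa using ha, by
    have : c / 4 * (c - c / 4) ^ 3 = 27 / 256 * c ^ 4 := by ring
    simpa only [this] using ha'⟩)
  have : saddle c a = p := sInf_eq_of_unique ⟨hp, hpa⟩ fun q hq =>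
    (strictMonoOn_cubic c).injOn (Set.Ioo_subset_Icc_self hq.1) (Set.Ioo_subset_Icc_self hp)
      (hq.2.trans hpa.symm)
  rw [this]
  exact ⟨hp, hpa⟩

theorem center_spec (hc : 0 < c) (ha : 0 < a) (ha' : a < 27 / 256 * c ^ 4) :
    center c a ∈ Set.Ioo (c / 4) c ∧ center c a * (c - center c a) ^ 3 = a := by
  have hcont : ContinuousOn (fun p : ℝ => p * (c - p) ^ 3) (Set.Icc (c / 4) c) := by fun_prop
  have hivt := intermediate_value_Ioo' (by linarith : c / 4 ≤ c) hcont
  obtain ⟨p, hp, hpa⟩ := hivt (show a ∈ _ from ⟨by simpa using ha, by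
    have : c / 4 * (c - c / 4) ^ 3 = 27 / 256 * c ^ 4 := by ring
    simpa only [this] using ha'⟩)
  have : center c a = p := sInf_eq_of_unique ⟨hp, hpa⟩ fun q hq =>
    (strictAntiOn_cubic c).injOn (Set.Ioo_subset_Icc_self hq.1) (Set.Ioo_subset_Icc_self hp)
      (hq.2.trans hpa.symm)
  rw [this]
  exact ⟨hp, hpa⟩

theorem cubic_gt_iff (hc : 0 < c) (ha : 0 < a) (ha' : a < 27 / 256 * c ^ 4) {p : ℝ}
    (hp : p ∈ Set.Ioo 0 c) :
    a < p * (c - p) ^ 3 ↔ p ∈ Set.Ioo (saddle c a) (center c a) := by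
  obtain ⟨hs, hsa⟩ := saddle_spec hc ha ha'
  obtain ⟨hr, hra⟩ := center_spec hc ha ha'
  constructor
  · intro h
    constructor
    · by_contra! hle
      have := (strictMonoOn_cubic c).monotoneOn ⟨hp.1.le, hle.trans hs.2.le⟩ ⟨hs.1.le, hs.2.le⟩ hle
      simp only [hsa] at this
      linarith
    · by_contra! hle
      have := (strictAntiOn_cubic c).antitoneOn ⟨hr.1.le, hr.2.le⟩ ⟨hr.1.le.trans hle, hp.2.le⟩ hle
      simp only [hra] at this
      linarith
  · rintro ⟨h1, h2⟩
    rcases le_total p (c / 4) with h | h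
    · have := strictMonoOn_cubic c ⟨hs.1.le, hs.2.le⟩ ⟨hp.1.le, h⟩ h1
      simpa only [hsa] using this
    · have := strictAntiOn_cubic c ⟨h, hp.2.le⟩ ⟨hr.1.le, hr.2.le⟩ h2
      simpa only [hra] using this

theorem cubic_lt_iff (hc : 0 < c) (ha : 0 < a) (ha' : a < 27 / 256 * c ^ 4) {p : ℝ}
    (hp : p ∈ Set.Ioo (c / 4) c) : p * (c - p) ^ 3 < a ↔ p ∈ Set.Ioo (center c a) c := by
  obtain ⟨hr, hra⟩ := center_spec hc ha ha'
  have := (strictAntiOn_cubic c).lt_iff_gt ⟨hp.1.le, hp.2.le⟩ ⟨hr.1.le, hr.2.le⟩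
  simp only [hra] at this
  rw [this]
  exact ⟨fun h => ⟨h, hp.2⟩, fun h => h.1⟩

theorem hasDerivAt_potential {p : ℝ} (hp : p < c) :
    HasDerivAt (potential c a) (2 * (a - p * (c - p) ^ 3) / (c - p) ^ 3) p := by
  have hne : c - p ≠ 0 := by linarith
  have h1 : HasDerivAt (fun w : ℝ => -w ^ 2) (-(2 * p)) p := by
    simpa using (hasDerivAt_pow 2 p).fun_neg
  have h2 : HasDerivAt (fun w : ℝ => (c - w) ^ 2) (2 * (c - p) * (-1)) p := by
    simpa using ((hasDerivAt_id p).const_sub c).fun_pow 2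
  have h3 := h1.add ((hasDerivAt_const p a).div h2 (pow_ne_zero 2 hne))
  refine h3.congr_deriv ?_
  field_simp
  ring

theorem strictAntiOn_potential (hc : 0 < c) (ha : 0 < a) (ha' : a < 27 / 256 * c ^ 4) :
    StrictAntiOn (potential c a) (Set.Icc (saddle c a) (center c a)) := by
  obtain ⟨hs, -⟩ := saddle_spec hc ha ha'
  obtain ⟨hr, -⟩ := center_spec hc ha ha'
  refine strictAntiOn_of_deriv_neg (convex_Icc _ _)
    (fun p hp => (hasDerivAt_potential (hp.2.trans_lt hr.2)).continuousAt.continuousWithinAt)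
    fun p hp => ?_
  rw [interior_Icc] at hp
  have hp' : p ∈ Set.Ioo 0 c := ⟨hs.1.trans hp.1, hp.2.trans hr.2⟩
  have h1 := (cubic_gt_iff hc ha ha' hp').mpr hp
  rw [(hasDerivAt_potential hp'.2).deriv]
  have h2 : 0 < c - p := by linarith [hp'.2]
  exact div_neg_of_neg_of_pos (by linarith) (by positivity)

theorem strictMonoOn_potential (hc : 0 < c) (ha : 0 < a) (ha' : a < 27 / 256 * c ^ 4) :
    StrictMonoOn (potential c a) (Set.Ico (center c a) c) := by
  obtain ⟨hr, -⟩ := center_spec hc ha ha'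
  refine strictMonoOn_of_deriv_pos (convex_Ico _ _)
    (fun p hp => (hasDerivAt_potential hp.2).continuousAt.continuousWithinAt)
    fun p hp => ?_
  rw [interior_Ico] at hp
  have h1 := (cubic_lt_iff hc ha ha' ⟨hr.1.trans hp.1, hp.2⟩).mpr hp
  rw [(hasDerivAt_potential hp.2).deriv]
  have h2 : 0 < c - p := by linarith [hp.2]
  exact div_pos (by linarith) (by positivity)

theorem potential_eq_iff {w : ℝ} (hw : w ≠ 0) : potential c a (c - w) = b ↔ quartic c b w = a := by
  unfold potential quartic
  rw [sub_sub_cancel]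
  constructor
  · intro h
    rw [← h]
    field_simp
    ring
  · intro h
    rw [← h]
    field_simp
    ring

/-- On the level set the sign of `force` is the sign of `a - p(c - p)³` with `p = c - w`, hence of
`U'(p)` when `w > 0`; this tells the two turning points apart. -/
theorem force_mul_sq {w : ℝ} (h : quartic c b w = a) :
    w ^ 2 * force c b w = a - (c - w) * (c - (c - w)) ^ 3 := by
  rw [← h]; unfold force quartic; ring

theorem turnLower_eq (hc : 0 < c) (ha : 0 < a) (ha' : a < 27 / 256 * c ^ 4) {w : ℝ}
    (hw : w ∈ Set.Ioo 0 c) (hq : quartic c b w = a) (hf : force c b w < 0) :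
    turnLower c a b = c - w := by
  have h1 := force_mul_sq hq
  have h2 : w ^ 2 * force c b w < 0 := mul_neg_of_pos_of_neg (pow_pos hw.1 2) hf
  have h3 := (cubic_gt_iff hc ha ha' (p := c - w) ⟨by linarith [hw.2], by linarith [hw.1]⟩).mp
    (by linarith)
  have h4 := (potential_eq_iff hw.1.ne').mpr hq
  exact sInf_eq_of_unique ⟨h3, h4⟩ fun q hq => (strictAntiOn_potential hc ha ha').injOn
    (Set.Ioo_subset_Icc_self hq.1) (Set.Ioo_subset_Icc_self h3) (hq.2.trans h4.symm)

theorem turnUpper_eq (hc : 0 < c) (ha : 0 < a) (ha' : a < 27 / 256 * c ^ 4) {w : ℝ}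
    (hw : w ∈ Set.Ioo 0 (3 * c / 4)) (hq : quartic c b w = a) (hf : 0 < force c b w) :
    turnUpper c a b = c - w := by
  have h1 := force_mul_sq hq
  have h2 : 0 < w ^ 2 * force c b w := mul_pos (pow_pos hw.1 2) hf
  have h3 := (cubic_lt_iff hc ha ha' (p := c - w) ⟨by linarith [hw.2], by linarith [hw.1]⟩).mp
    (by linarith)
  have h4 := (potential_eq_iff hw.1.ne').mpr hq
  exact sInf_eq_of_unique ⟨h3, h4⟩ fun q hq => (strictMonoOn_potential hc ha ha').injOn
    (Set.Ioo_subset_Ico_self hq.1) (Set.Ioo_subset_Ico_self h3) (hq.2.trans h4.symm)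

/-- The turning points in the variable `w = c - φ`. -/
theorem exists_turning (hc : 0 < c) (hab : (a, b) ∈ existenceRegion c) :
    ∃ wm wp : ℝ, 0 < wm ∧ wm < 3 * c / 4 ∧ wm < wp ∧ wp < c ∧ quartic c b wm = a ∧
      quartic c b wp = a ∧ 0 < force c b wm ∧ force c b wp < 0 := by
  obtain ⟨ha, ha', hb1, hb2⟩ := hab
  simp only at ha ha' hb1 hb2
  obtain ⟨hs, -⟩ := saddle_spec hc ha ha'
  obtain ⟨hr, -⟩ := center_spec hc ha ha'
  obtain ⟨p, hp, hpb⟩ : ∃ p ∈ Set.Ioo (saddle c a) (center c a), potential c a p = b := by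
    have hcont : ContinuousOn (potential c a) (Set.Icc (saddle c a) (center c a)) := fun p hp =>
      (hasDerivAt_potential (hp.2.trans_lt hr.2)).continuousAt.continuousWithinAt
    exact intermediate_value_Ioo' (by linarith [hs.2, hr.1]) hcont ⟨hb1, hb2⟩
  obtain ⟨r, hr1, hr2⟩ : ∃ r ∈ Set.Ioo (center c a) c, b < potential c a r := by
    -- Chosen so that `a/e² ≥ |b| + c² + 1`: the pole of the potential at `c` then dominates `-p²`,
    -- and `U(c - e) > b`.
    set e := min ((c - center c a) / 2) (Real.sqrt (a / (|b| + c ^ 2 + 1)))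
    have he : 0 < e := lt_min (by linarith [hr.2]) (Real.sqrt_pos.mpr (by positivity))
    have he1 : e ≤ (c - center c a) / 2 := min_le_left _ _
    have he2 : e ^ 2 ≤ a / (|b| + c ^ 2 + 1) := by
      have := min_le_right ((c - center c a) / 2) (Real.sqrt (a / (|b| + c ^ 2 + 1)))
      calc e ^ 2 ≤ Real.sqrt (a / (|b| + c ^ 2 + 1)) ^ 2 := by gcongr
        _ = _ := Real.sq_sqrt (by positivity)
    have hec : e < c := by linarith [hr.1, hr.2]
    refine ⟨c - e, ⟨by linarith [hr.2], by linarith⟩, ?_⟩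
    unfold potential
    rw [sub_sub_cancel]
    have h1 : |b| + c ^ 2 + 1 ≤ a / e ^ 2 := by
      rw [le_div_iff₀ (by positivity)]
      rw [le_div_iff₀ (by positivity)] at he2
      linarith
    have h2 : (c - e) ^ 2 ≤ c ^ 2 := by nlinarith
    linarith [le_abs_self b]
  obtain ⟨q, hq, hqb⟩ : ∃ q ∈ Set.Ioo (center c a) r, potential c a q = b := by
    have hcont : ContinuousOn (potential c a) (Set.Icc (center c a) r) := fun p hp =>
      (hasDerivAt_potential (hp.2.trans_lt hr1.2)).continuousAt.continuousWithinAt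
    exact intermediate_value_Ioo hr1.1.le hcont ⟨hb1, hr2⟩
  have hqc : q < c := hq.2.trans hr1.2
  have hpc : p < c := hp.2.trans hr.2
  have e1 : quartic c b (c - q) = a := by
    rw [← potential_eq_iff (by linarith), sub_sub_cancel, hqb]
  have e2 : quartic c b (c - p) = a := by
    rw [← potential_eq_iff (by linarith), sub_sub_cancel, hpb]
  refine ⟨c - q, c - p, by linarith, by linarith [hq.1, hr.1], by linarith [hp.2, hq.1],
    by linarith [hs.1, hp.1], e1, e2, ?_, ?_⟩
  · have h1 := force_mul_sq e1
    rw [sub_sub_cancel] at h1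
    have h2 := (cubic_lt_iff hc ha ha' ⟨hr.1.trans hq.1, hqc⟩).mpr ⟨hq.1, hqc⟩
    have h3 : 0 < (c - q) ^ 2 * force c b (c - q) := by linarith
    exact pos_of_mul_pos_right h3 (sq_nonneg _)
  · have h1 := force_mul_sq e2
    rw [sub_sub_cancel] at h1
    have h2 := (cubic_gt_iff hc ha ha' ⟨hs.1.trans hp.1, hpc⟩).mpr hp
    have h3 : (c - p) ^ 2 * force c b (c - p) < 0 := by linarith
    exact neg_of_mul_neg_right h3 (sq_nonneg _)

/-! ### The cofactor of the two turning points -/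

/-- The quotient of `quartic c b w - a` by `(w - wm) (wp - w)`. -/
noncomputable def cofactor (c wm wp w : ℝ) : ℝ :=
  -w ^ 2 + (2 * c - (wm + wp)) * (w + wm * wp / (wm + wp))

theorem quartic_sub_eq {wm wp : ℝ} (hm : 0 < wm) (hlt : wm < wp) (h1 : quartic c b wm = a)
    (h2 : quartic c b wp = a) (w : ℝ) :
    quartic c b w - a = (w - wm) * (wp - w) * cofactor c wm wp w := by
  have hs : wm + wp ≠ 0 := by linarith
  have hd : wp - wm ≠ 0 := by linarith
  -- Equality of the quartic at its two distinct roots determines `b` from `wm` and `wp`, so the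
  -- factorization becomes an identity in `c`, `wm`, `wp`, `w`.
  have hb : c ^ 2 + b = (2 * c * ((wm + wp) ^ 2 - wm * wp) -
      (wm + wp) * ((wm + wp) ^ 2 - 2 * (wm * wp))) / (wm + wp) := by
    rw [eq_div_iff hs]
    have h3 : (wp - wm) * ((c ^ 2 + b) * (wm + wp) - (2 * c * ((wm + wp) ^ 2 - wm * wp) -
      (wm + wp) * ((wm + wp) ^ 2 - 2 * (wm * wp)))) = 0 := by
      have : quartic c b wp - quartic c b wm = 0 := by rw [h1, h2, sub_self]
      rw [← this]; unfold quartic; ring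
    have := (mul_eq_zero.mp h3).resolve_left hd
    linarith
  have hb' : b = (2 * c * ((wm + wp) ^ 2 - wm * wp) -
      (wm + wp) * ((wm + wp) ^ 2 - 2 * (wm * wp))) / (wm + wp) - c ^ 2 := by linarith
  rw [← h1]
  unfold quartic cofactor
  rw [hb']
  field_simp
  ring

/-- The cofactor is a concave quadratic, so positivity at `0` and at `wp` is enough. At `0` it
equals `a/(wm wp)`; at `wp` its sign is read off the derivative of the factorization, where `force`
is negative. -/
theorem cofactor_pos {wm wp : ℝ} (hm : 0 < wm) (hlt : wm < wp) (ha : 0 < a)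
    (h1 : quartic c b wm = a) (h2 : quartic c b wp = a) (hf : force c b wp < 0) {w : ℝ}
    (hw : w ∈ Set.Icc 0 wp) : 0 < cofactor c wm wp w := by
  have hp : 0 < wp := hm.trans hlt
  have h0 : 0 < cofactor c wm wp 0 := by
    have := quartic_sub_eq hm hlt h1 h2 0
    have e : quartic c b 0 = 0 := by unfold quartic; ring
    rw [e] at this
    by_contra! h
    nlinarith [mul_nonneg (mul_nonneg hm.le hp.le) (neg_nonneg.mpr h)]
  have h3 : 0 < cofactor c wm wp wp := by
    have hd1 := hasDerivAt_quartic c b wp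
    have hd2 : HasDerivAt (fun w => (w - wm) * (wp - w) * cofactor c wm wp w)
        (-(wp - wm) * cofactor c wm wp wp) wp := by
      have e1 : HasDerivAt (fun w : ℝ => (w - wm) * (wp - w)) (-(wp - wm)) wp := by
        have := ((hasDerivAt_id wp).sub_const wm).mul ((hasDerivAt_id wp).const_sub wp)
        refine this.congr_deriv ?_
        simp
      have e2 : DifferentiableAt ℝ (cofactor c wm wp) wp := by
        unfold cofactor; fun_prop
      refine (e1.mul e2.hasDerivAt).congr_deriv ?_
      ring
    have hd3 : HasDerivAt (fun w => (w - wm) * (wp - w) * cofactor c wm wp w)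
        (2 * wp * force c b wp) wp := by
      refine (hd1.sub_const a).congr_of_eventuallyEq (Filter.Eventually.of_forall fun w => ?_)
      exact (quartic_sub_eq hm hlt h1 h2 w).symm
    have := hd2.unique hd3
    have h4 : 2 * wp * force c b wp < 0 := mul_neg_of_pos_of_neg (by linarith) hf
    by_contra! h
    nlinarith [mul_nonneg (sub_pos.mpr hlt).le (neg_nonneg.mpr h)]
  have key : wp * cofactor c wm wp w = (wp - w) * cofactor c wm wp 0 + w * cofactor c wm wp wp +
      wp * (w * (wp - w)) := by
    unfold cofactor; ring
  have h5 : 0 < wp * cofactor c wm wp w := by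
    rw [key]
    have t1 : 0 ≤ wp * (w * (wp - w)) :=
      mul_nonneg hp.le (mul_nonneg hw.1 (sub_nonneg.mpr hw.2))
    rcases hw.1.eq_or_lt with h | h
    · rw [← h]; nlinarith [mul_pos hp h0]
    · have t2 : 0 < w * cofactor c wm wp wp := mul_pos h h3
      have t3 : 0 ≤ (wp - w) * cofactor c wm wp 0 := mul_nonneg (sub_nonneg.mpr hw.2) h0.le
      linarith
  exact pos_of_mul_pos_right h5 hp.le

end TurningPoints

/-! ### Differentiability of the period function in the angle variable. -/

section Period

open Filter Topology

/-- Differentiation under the integral sign for a jointly `C¹` integrand. -/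
theorem hasDerivAt_integral_of_contDiffAt {F : ℝ × ℝ → ℝ} {a t₀ t₁ : ℝ}
    (hF : ∀ θ, ContDiffAt ℝ 1 F (a, θ)) :
    HasDerivAt (fun a' => ∫ θ in t₀..t₁, F (a', θ))
      (∫ θ in t₀..t₁, fderiv ℝ F (a, θ) (1, 0)) a := by
  have hfd : ∀ θ, ContinuousAt (fderiv ℝ F) (a, θ) := fun θ =>
    ((hF θ).fderiv_right (m := 0) (by norm_num)).continuousAt
  have hK : IsCompact (Set.uIcc t₀ t₁) := isCompact_uIcc
  obtain ⟨M, hM⟩ : ∃ M, ∀ θ ∈ Set.uIcc t₀ t₁, ‖fderiv ℝ F (a, θ)‖ ≤ M := by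
    have hc : ContinuousOn (fun θ => fderiv ℝ F (a, θ)) (Set.uIcc t₀ t₁) := fun θ _ =>
      (ContinuousAt.comp (f := fun θ : ℝ => (a, θ)) (hfd θ)
        (by fun_prop)).continuousWithinAt
    exact hK.exists_bound_of_continuousOn hc
  -- Compactness of the `θ` interval turns local smoothness and local bounds into ones uniform in
  -- `θ`, which supplies the constant dominating function `M + 1`.
  have hev : ∀ᶠ a' in 𝓝 a, ∀ θ ∈ Set.uIcc t₀ t₁,
      ContDiffAt ℝ 1 F (a', θ) ∧ ‖fderiv ℝ F (a', θ)‖ < M + 1 := by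
    refine hK.eventually_forall_of_forall_eventually fun θ hθ => ?_
    have h1 := (hF θ).eventually (by simp)
    have h2 := (hfd θ).norm.eventually_lt_const (show ‖fderiv ℝ F (a, θ)‖ < M + 1 by
      linarith [hM θ hθ])
    filter_upwards [h1, h2] with y hy1 hy2
    exact ⟨hy1, hy2⟩
  have hd : ∀ a' θ, ContDiffAt ℝ 1 F (a', θ) →
      HasDerivAt (fun x => F (x, θ)) (fderiv ℝ F (a', θ) (1, 0)) a' := by
    intro a' θ h
    have h1 := (h.differentiableAt (by norm_num)).hasFDerivAt
    have h2 : HasDerivAt (fun x : ℝ => (x, θ)) (1, 0) a' :=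
      (hasDerivAt_id a').prodMk (hasDerivAt_const a' θ)
    exact h1.comp_hasDerivAt a' h2
  have hcont : ∀ a', (∀ θ ∈ Set.uIcc t₀ t₁, ContDiffAt ℝ 1 F (a', θ)) →
      ContinuousOn (fun θ => F (a', θ)) (Set.uIcc t₀ t₁) := fun a' h θ hθ =>
    (ContinuousAt.comp (f := fun θ : ℝ => (a', θ)) (h θ hθ).continuousAt
      (by fun_prop)).continuousWithinAt
  have hcontD : ContinuousOn (fun θ => fderiv ℝ F (a, θ) (1, 0)) (Set.uIcc t₀ t₁) := fun θ _ => by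
    have h1 : ContinuousAt (fun θ => fderiv ℝ F (a, θ)) θ :=
      ContinuousAt.comp (f := fun θ : ℝ => (a, θ)) (hfd θ) (by fun_prop)
    exact (h1.clm_apply continuousAt_const).continuousWithinAt
  have hsub : Set.uIoc t₀ t₁ ⊆ Set.uIcc t₀ t₁ := Set.uIoc_subset_uIcc
  refine (intervalIntegral.hasDerivAt_integral_of_dominated_loc_of_deriv_le
    (F := fun a' θ => F (a', θ)) (F' := fun a' θ => fderiv ℝ F (a', θ) (1, 0))
    (bound := fun _ => M + 1) hev ?_ ?_ ?_ ?_ ?_ ?_).2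
  · filter_upwards [hev] with a' ha'
    exact ((hcont a' fun θ hθ => (ha' θ hθ).1).mono hsub).aestronglyMeasurable
      measurableSet_uIoc
  · exact (hcont a fun θ _ => hF θ).intervalIntegrable
  · exact (hcontD.mono hsub).aestronglyMeasurable measurableSet_uIoc
  · refine Eventually.of_forall fun θ hθ a' ha' => ?_
    have h1 := (ha' θ (hsub hθ)).2
    calc ‖fderiv ℝ F (a', θ) (1, 0)‖ ≤ ‖fderiv ℝ F (a', θ)‖ * ‖((1 : ℝ), (0 : ℝ))‖ :=
          ContinuousLinearMap.le_opNorm _ _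
      _ ≤ M + 1 := by rw [Prod.norm_mk]; simpa using h1.le
  · exact intervalIntegrable_const
  · exact Eventually.of_forall fun θ hθ a' ha' => hd a' θ (ha' θ (hsub hθ)).1

/-- A simple root of `quartic c b = a` depends smoothly on `a`. -/
theorem exists_root_branch {c a b w₀ : ℝ} (hw₀ : w₀ ≠ 0) (hq : quartic c b w₀ = a)
    (hf : force c b w₀ ≠ 0) :
    ∃ r : ℝ → ℝ, r a = w₀ ∧ ContDiffAt ℝ 1 r a ∧ ∀ᶠ a' in 𝓝 a, quartic c b (r a') = a' := by
  have hcd : ContDiffAt ℝ 1 (quartic c b) w₀ := by unfold quartic; fun_prop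
  have hne : 2 * w₀ * force c b w₀ ≠ 0 := mul_ne_zero (mul_ne_zero two_ne_zero hw₀) hf
  have hd : HasFDerivAt (quartic c b)
      ((ContinuousLinearEquiv.unitsEquivAut ℝ (Units.mk0 _ hne) : ℝ ≃L[ℝ] ℝ) : ℝ →L[ℝ] ℝ) w₀ := by
    have h := (hasDerivAt_quartic c b w₀).hasFDerivAt
    refine h.congr_fderiv ?_
    ext
    simp
  subst hq
  refine ⟨hcd.localInverse hd one_ne_zero, hcd.localInverse_apply_image hd one_ne_zero,
    hcd.to_localInverse hd one_ne_zero, ?_⟩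
  exact (hcd.hasStrictFDerivAt' hd one_ne_zero).eventually_right_inverse

/-- The uniformization of the interval `[wm, wp]` by an angle. -/
noncomputable def angleW (wm wp θ : ℝ) : ℝ := (wm + wp) / 2 + (wp - wm) / 2 * Real.sin θ

/-- The density of the time `x` with respect to the angle. -/
noncomputable def timeDensity (c wm wp θ : ℝ) : ℝ :=
  angleW wm wp θ / √(cofactor c wm wp (angleW wm wp θ))

theorem angleW_mem {wm wp : ℝ} (h : wm < wp) (θ : ℝ) : angleW wm wp θ ∈ Set.Icc wm wp := by
  have h1 := Real.neg_one_le_sin θ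
  have h2 := Real.sin_le_one θ
  unfold angleW
  constructor <;> nlinarith

theorem angleW_mul (wm wp θ : ℝ) : (angleW wm wp θ - wm) * (wp - angleW wm wp θ) =
    ((wp - wm) / 2 * Real.cos θ) ^ 2 := by
  unfold angleW
  linear_combination (-((wp - wm) / 2) ^ 2) * Real.sin_sq_add_cos_sq θ

theorem hasDerivAt_angleW (wm wp θ : ℝ) :
    HasDerivAt (angleW wm wp) ((wp - wm) / 2 * Real.cos θ) θ :=
  ((Real.hasDerivAt_sin θ).const_mul _).const_add _

/-- The pair of turning points in the variable `w = c - φ`, with their nondegeneracy. -/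
structure Turning (c a b wm wp : ℝ) : Prop where
  pos : 0 < wm
  lt : wm < wp
  level_pos : 0 < a
  quartic_left : quartic c b wm = a
  quartic_right : quartic c b wp = a
  force_left : 0 < force c b wm
  force_right : force c b wp < 0

variable {c a b wm wp : ℝ}

theorem Turning.cofactor_angleW_pos (h : Turning c a b wm wp) (θ : ℝ) :
    0 < cofactor c wm wp (angleW wm wp θ) :=
  cofactor_pos h.pos h.lt h.level_pos h.quartic_left h.quartic_right h.force_right
    ⟨h.pos.le.trans (angleW_mem h.lt θ).1, (angleW_mem h.lt θ).2⟩

theorem Turning.angleW_pos (h : Turning c a b wm wp) (θ : ℝ) : 0 < angleW wm wp θ :=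
  h.pos.trans_le (angleW_mem h.lt θ).1

theorem Turning.timeDensity_pos (h : Turning c a b wm wp) (θ : ℝ) : 0 < timeDensity c wm wp θ :=
  div_pos (h.angleW_pos θ) (Real.sqrt_pos.mpr (h.cofactor_angleW_pos θ))

theorem Turning.quartic_angleW (h : Turning c a b wm wp) (θ : ℝ) :
    quartic c b (angleW wm wp θ) - a =
      ((wp - wm) / 2 * Real.cos θ) ^ 2 * cofactor c wm wp (angleW wm wp θ) := by
  rw [quartic_sub_eq h.pos h.lt h.quartic_left h.quartic_right, angleW_mul]

/-- The energy identity with `θ` in place of time: `ρ = dx/dθ` clears the denominator, so it holds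
at the turning points too and can be differentiated in `a` at fixed `θ`. -/
theorem Turning.sq_eq (h : Turning c a b wm wp) (θ : ℝ) :
    (angleW wm wp θ * ((wp - wm) / 2 * Real.cos θ)) ^ 2 =
      timeDensity c wm wp θ ^ 2 * (quartic c b (angleW wm wp θ) - a) := by
  rw [h.quartic_angleW, timeDensity, div_pow, Real.sq_sqrt (h.cofactor_angleW_pos θ).le]
  have := (h.cofactor_angleW_pos θ).ne'
  field_simp

theorem Turning.contDiffAt_timeDensity {a₀ θ : ℝ} {ωm ωp : ℝ → ℝ}
    (h : Turning c a b (ωm a₀) (ωp a₀)) (hm : ContDiffAt ℝ 1 ωm a₀) (hp : ContDiffAt ℝ 1 ωp a₀) :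
    ContDiffAt ℝ 1 (fun q : ℝ × ℝ => timeDensity c (ωm q.1) (ωp q.1) q.2) (a₀, θ) := by
  have h1 : ContDiffAt ℝ 1 (fun q : ℝ × ℝ => ωm q.1) (a₀, θ) :=
    ContDiffAt.comp (a₀, θ) (f := Prod.fst) hm contDiffAt_fst
  have h2 : ContDiffAt ℝ 1 (fun q : ℝ × ℝ => ωp q.1) (a₀, θ) :=
    ContDiffAt.comp (a₀, θ) (f := Prod.fst) hp contDiffAt_fst
  have h3 : ContDiffAt ℝ 1 (fun q : ℝ × ℝ => Real.sin q.2) (a₀, θ) :=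
    (Real.contDiff_sin.comp contDiff_snd).contDiffAt
  have h4 : ContDiffAt ℝ 1 (fun q : ℝ × ℝ => angleW (ωm q.1) (ωp q.1) q.2) (a₀, θ) :=
    ((h1.add h2).div_const 2).add (((h2.sub h1).div_const 2).mul h3)
  have hs : ωm a₀ + ωp a₀ ≠ 0 := by linarith [h.pos, h.lt]
  have h5 : ContDiffAt ℝ 1 (fun q : ℝ × ℝ =>
      cofactor c (ωm q.1) (ωp q.1) (angleW (ωm q.1) (ωp q.1) q.2)) (a₀, θ) :=
    (h4.pow 2).neg.add ((contDiffAt_const.sub (h1.add h2)).mul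
      (h4.add ((h1.mul h2).div (h1.add h2) hs)))
  exact h4.div (h5.sqrt (h.cofactor_angleW_pos θ).ne')
    (Real.sqrt_pos.mpr (h.cofactor_angleW_pos θ)).ne'

theorem Turning.continuous_timeDensity (h : Turning c a b wm wp) :
    Continuous (timeDensity c wm wp) := by
  have h4 : Continuous (angleW wm wp) := by unfold angleW; fun_prop
  have h5 : Continuous fun θ => cofactor c wm wp (angleW wm wp θ) := by
    unfold cofactor; fun_prop
  exact h4.div h5.sqrt fun θ => (Real.sqrt_pos.mpr (h.cofactor_angleW_pos θ)).ne'

theorem timeDensity_pi_sub (c wm wp θ : ℝ) :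
    timeDensity c wm wp (Real.pi - θ) = timeDensity c wm wp θ := by
  simp only [timeDensity, angleW, Real.sin_pi_sub]

theorem angleW_image (h : wm < wp) :
    (fun θ => c - angleW wm wp θ) '' Set.Ioo (-(Real.pi / 2)) (Real.pi / 2) =
      Set.Ioo (c - wp) (c - wm) := by
  ext p
  constructor
  · rintro ⟨θ, hθ, rfl⟩
    have h1 : -1 < Real.sin θ := by
      have : Real.sin (-(Real.pi / 2)) = -1 := by rw [Real.sin_neg, Real.sin_pi_div_two]
      rw [← this]
      exact Real.sin_lt_sin_of_lt_of_le_pi_div_two le_rfl hθ.2.le hθ.1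
    have h2 : Real.sin θ < 1 := by
      rw [← Real.sin_pi_div_two]
      exact Real.sin_lt_sin_of_lt_of_le_pi_div_two hθ.1.le le_rfl hθ.2
    simp only [angleW]
    constructor <;> nlinarith
  · rintro ⟨h1, h2⟩
    set y := (c - p - (wm + wp) / 2) / ((wp - wm) / 2)
    have hd : 0 < (wp - wm) / 2 := by linarith
    have hy1 : -1 < y := by rw [lt_div_iff₀ hd]; linarith
    have hy2 : y < 1 := by rw [div_lt_iff₀ hd]; linarith
    refine ⟨Real.arcsin y, ⟨Real.neg_pi_div_two_lt_arcsin.mpr hy1,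
      Real.arcsin_lt_pi_div_two.mpr hy2⟩, ?_⟩
    simp only [angleW]
    rw [Real.sin_arcsin hy1.le hy2.le, mul_div_cancel₀ _ hd.ne']
    ring

/-- The period function as an integral over a full turn of the angle. -/
theorem Turning.periodFn_eq (h : Turning c a b wm wp) (hl : turnLower c a b = c - wp)
    (hu : turnUpper c a b = c - wm) :
    periodFn c a b = ∫ θ in (-(Real.pi / 2))..(3 * Real.pi / 2), timeDensity c wm wp θ := by
  have hpi := Real.pi_pos
  have h1 : ∫ p in (c - wp)..(c - wm), 1 / √(b - potential c a p) =
      ∫ θ in (-(Real.pi / 2))..(Real.pi / 2), timeDensity c wm wp θ := by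
    rw [intervalIntegral.integral_of_le (by linarith [h.lt]), integral_Ioc_eq_integral_Ioo,
      intervalIntegral.integral_of_le (by linarith), integral_Ioc_eq_integral_Ioo,
      ← angleW_image h.lt, integral_image_eq_integral_abs_deriv_smul measurableSet_Ioo
        (fun θ _ => ((hasDerivAt_angleW wm wp θ).const_sub c).hasDerivWithinAt)]
    · refine setIntegral_congr_fun measurableSet_Ioo fun θ hθ => ?_
      have hcos : 0 < Real.cos θ := Real.cos_pos_of_mem_Ioo hθ
      have hd : 0 < (wp - wm) / 2 * Real.cos θ := mul_pos (by linarith [h.lt]) hcos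
      have hw := h.angleW_pos θ
      have hU : b - potential c a (c - angleW wm wp θ) =
          ((wp - wm) / 2 * Real.cos θ) ^ 2 * cofactor c wm wp (angleW wm wp θ) /
            angleW wm wp θ ^ 2 := by
        rw [← h.quartic_angleW]
        unfold potential quartic
        rw [sub_sub_cancel]
        field_simp
        ring
      rw [abs_neg, abs_of_pos hd, hU, Real.sqrt_div' _ (sq_nonneg _),
        Real.sqrt_mul (sq_nonneg _), Real.sqrt_sq hd.le, Real.sqrt_sq hw.le, smul_eq_mul,
        timeDensity]
      have := (Real.sqrt_pos.mpr (h.cofactor_angleW_pos θ)).ne'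
      have := hd.ne'
      have := (sub_pos.mpr h.lt).ne'
      field_simp
    · intro x hx y hy hxy
      simp only [angleW] at hxy
      have hd : (wp - wm) / 2 ≠ 0 := by linarith [h.lt]
      have : Real.sin x = Real.sin y := mul_left_cancel₀ hd (by linarith)
      exact Real.injOn_sin (Set.Ioo_subset_Icc_self hx) (Set.Ioo_subset_Icc_self hy) this
  -- The reflection `θ ↦ π - θ` exchanges the two half turns, which accounts for the factor `2` in
  -- the period.
  have h2 : ∫ θ in (Real.pi / 2)..(3 * Real.pi / 2), timeDensity c wm wp θ =
      ∫ θ in (-(Real.pi / 2))..(Real.pi / 2), timeDensity c wm wp θ := by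
    have := intervalIntegral.integral_comp_sub_left (a := -(Real.pi / 2)) (b := Real.pi / 2)
      (timeDensity c wm wp) Real.pi
    simp only [timeDensity_pi_sub] at this
    rw [this]
    congr 1 <;> ring
  have hii := fun x y => h.continuous_timeDensity.intervalIntegrable (μ := volume) x y
  rw [periodFn, hl, hu, h1, ← intervalIntegral.integral_add_adjacent_intervals
    (hii (-(Real.pi / 2)) (Real.pi / 2)) (hii (Real.pi / 2) (3 * Real.pi / 2)), h2]
  ring

/-- Differentiability of the period function, with the variations of the angle parametrization
and of the time density. -/
theorem exists_period_variation (hc : 0 < c) (hab : (a, b) ∈ existenceRegion c) :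
    ∃ wm wp α β : ℝ, ∃ ρ' : ℝ → ℝ, Turning c a b wm wp ∧ wp < c ∧ Continuous ρ' ∧
      HasDerivAt (fun a' => periodFn c a' b)
        (∫ θ in (-(Real.pi / 2))..(3 * Real.pi / 2), ρ' θ) a ∧
      ∀ θ, 2 * (angleW wm wp θ * ((wp - wm) / 2 * Real.cos θ)) *
          ((α + β * Real.sin θ) * ((wp - wm) / 2 * Real.cos θ) +
            angleW wm wp θ * (β * Real.cos θ)) =
        2 * timeDensity c wm wp θ * ρ' θ * (quartic c b (angleW wm wp θ) - a) +
          timeDensity c wm wp θ ^ 2 *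
            (2 * angleW wm wp θ * force c b (angleW wm wp θ) * (α + β * Real.sin θ) - 1) := by
  obtain ⟨wm, wp, h0, hm3, hlt, hpc, hqm, hqp, hfm, hfp⟩ := exists_turning hc hab
  have hT : Turning c a b wm wp := ⟨h0, hlt, hab.1, hqm, hqp, hfm, hfp⟩
  obtain ⟨ωm, rfl, hcm, hem⟩ := exists_root_branch h0.ne' hqm hfm.ne'
  obtain ⟨ωp, rfl, hcp, hep⟩ := exists_root_branch (h0.trans hlt).ne' hqp hfp.ne
  have hcontm := hcm.continuousAt
  have hcontp := hcp.continuousAt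
  have hforce : Continuous (force c b) := by unfold force; fun_prop
  -- All conditions identifying the turning points are open, so the root branches remain the turning
  -- points for nearby `a'`.
  have hev : ∀ᶠ a' in 𝓝 a, Turning c a' b (ωm a') (ωp a') ∧
      periodFn c a' b =
        ∫ θ in (-(Real.pi / 2))..(3 * Real.pi / 2), timeDensity c (ωm a') (ωp a') θ := by
    filter_upwards [hem, hep, hcontm.eventually_const_lt h0, hcontm.eventually_lt_const hm3,
      hcontm.eventually_lt hcontp hlt, hcontp.eventually_lt_const hpc,
      (ContinuousAt.comp hforce.continuousAt hcontm).eventually_const_lt hfm,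
      (ContinuousAt.comp hforce.continuousAt hcontp).eventually_lt_const hfp,
      eventually_gt_nhds hab.1, eventually_lt_nhds hab.2.1]
      with a' e1 e2 e3 e4 e5 e6 e7 e8 e9 e10
    have hT' : Turning c a' b (ωm a') (ωp a') := ⟨e3, e5, e9, e1, e2, e7, e8⟩
    exact ⟨hT', hT'.periodFn_eq (turnLower_eq hc e9 e10 ⟨e3.trans e5, e6⟩ e2 e8)
      (turnUpper_eq hc e9 e10 ⟨e3, e4⟩ e1 e7)⟩
  set F : ℝ × ℝ → ℝ := fun q => timeDensity c (ωm q.1) (ωp q.1) q.2 with hFdef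
  have hF : ∀ θ, ContDiffAt ℝ 1 F (a, θ) := fun θ => hT.contDiffAt_timeDensity hcm hcp
  have hdm : HasDerivAt ωm (deriv ωm a) a := (hcm.differentiableAt (by norm_num)).hasDerivAt
  have hdp : HasDerivAt ωp (deriv ωp a) a := (hcp.differentiableAt (by norm_num)).hasDerivAt
  set m' := deriv ωm a
  set p' := deriv ωp a
  -- `α + β sin θ` is the `a`-derivative of `angleW` at fixed `θ`, and `ρ'` that of the time
  -- density; the last identity is the `a`-derivative of `Turning.sq_eq`.
  refine ⟨ωm a, ωp a, (m' + p') / 2, (p' - m') / 2, fun θ => fderiv ℝ F (a, θ) (1, 0), hT, hpc,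
    ?_, ?_, fun θ => ?_⟩
  · rw [continuous_iff_continuousAt]
    intro θ
    have h1 : ContinuousAt (fun θ => fderiv ℝ F (a, θ)) θ :=
      ContinuousAt.comp (f := fun θ : ℝ => (a, θ))
        ((hF θ).fderiv_right (m := 0) (by norm_num)).continuousAt (by fun_prop)
    exact h1.clm_apply continuousAt_const
  · refine (hasDerivAt_integral_of_contDiffAt hF).congr_of_eventuallyEq ?_
    filter_upwards [hev] with a' ha'
    exact ha'.2
  · have hρ : HasDerivAt (fun a' => timeDensity c (ωm a') (ωp a') θ)
        (fderiv ℝ F (a, θ) (1, 0)) a := by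
      have h2 : HasDerivAt (fun x : ℝ => (x, θ)) (1, 0) a :=
        (hasDerivAt_id a).prodMk (hasDerivAt_const a θ)
      exact ((hF θ).differentiableAt (by norm_num)).hasFDerivAt.comp_hasDerivAt a h2
    have hw : HasDerivAt (fun a' => angleW (ωm a') (ωp a') θ)
        ((m' + p') / 2 + (p' - m') / 2 * Real.sin θ) a :=
      ((hdm.add hdp).div_const 2).add (((hdp.sub hdm).div_const 2).mul_const _)
    have hwθ : HasDerivAt (fun a' => (ωp a' - ωm a') / 2 * Real.cos θ)
        ((p' - m') / 2 * Real.cos θ) a := ((hdp.sub hdm).div_const 2).mul_const _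
    have hg : HasDerivAt (fun a' => quartic c b (angleW (ωm a') (ωp a') θ) - a')
        (2 * angleW (ωm a) (ωp a) θ * force c b (angleW (ωm a) (ωp a) θ) *
          ((m' + p') / 2 + (p' - m') / 2 * Real.sin θ) - 1) a :=
      (HasDerivAt.comp (h₂ := quartic c b) a (hasDerivAt_quartic c b _) hw).fun_sub
        (hasDerivAt_id a)
    have hL := (hw.mul hwθ).fun_pow 2
    have hR := (hρ.fun_pow 2).mul hg
    have hE : (fun a' => (angleW (ωm a') (ωp a') θ * ((ωp a' - ωm a') / 2 * Real.cos θ)) ^ 2)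
        =ᶠ[𝓝 a] fun a' => timeDensity c (ωm a') (ωp a') θ ^ 2 *
          (quartic c b (angleW (ωm a') (ωp a') θ) - a') := by
      filter_upwards [hev] with a' ha'
      exact ha'.1.sq_eq θ
    have hU := hL.unique (hR.congr_of_eventuallyEq hE)
    simp only [Pi.mul_apply] at hU
    linear_combination hU

end Period

/-! ### The wave as a motion between the turning points, parametrized by the angle. -/

section Wave

open Filter Topology

variable {c a b L wm wp : ℝ} {φ : ℝ → ℝ}

theorem exists_forall_le_of_periodic {f : ℝ → ℝ} (hf : Continuous f) (hL : 0 < L)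
    (hp : Function.Periodic f L) : ∃ x₀, ∀ x, f x₀ ≤ f x := by
  obtain ⟨x₀, -, hx₀⟩ := isCompact_Icc.exists_isMinOn (Set.nonempty_Icc.mpr hL.le) hf.continuousOn
  refine ⟨x₀, fun x => ?_⟩
  obtain ⟨y, hy, hxy⟩ := hp.exists_mem_Ico₀ hL x
  rw [hxy]
  exact hx₀ (Set.Ico_subset_Icc_self hy)

theorem IsSmoothPeriodicWave.not_const (h : IsSmoothPeriodicWave c a b L φ) :
    ¬ ∀ x y, φ x = φ y := by
  intro hconst
  have hL := h.period.1.1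
  have := h.period.2 (show L / 2 ∈ _ from ⟨by linarith, fun x => hconst _ _⟩)
  linarith

theorem hasDerivAt_cofactor (c wm wp w : ℝ) :
    HasDerivAt (cofactor c wm wp) (-(2 * w) + (2 * c - (wm + wp))) w := by
  have h1 : HasDerivAt (fun w : ℝ => -w ^ 2) (-(2 * w)) w := by
    simpa using (hasDerivAt_pow 2 w).fun_neg
  have h2 := ((hasDerivAt_id w).add_const (wm * wp / (wm + wp))).const_mul (2 * c - (wm + wp))
  refine (h1.add h2).congr_deriv ?_
  simp

theorem Turning.force_eq (h : Turning c a b wm wp) (w : ℝ) :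
    2 * w * force c b w = (wm + wp - 2 * w) * cofactor c wm wp w +
      (w - wm) * (wp - w) * (-(2 * w) + (2 * c - (wm + wp))) := by
  have hd1 := (hasDerivAt_quartic c b w).sub_const a
  have e1 : HasDerivAt (fun w : ℝ => (w - wm) * (wp - w)) (wm + wp - 2 * w) w := by
    have := ((hasDerivAt_id w).sub_const wm).mul ((hasDerivAt_id w).const_sub wp)
    refine this.congr_deriv ?_
    simp only [id]; ring
  have hd2 := e1.mul (hasDerivAt_cofactor c wm wp w)
  have := hd1.unique (hd2.congr_of_eventuallyEq (Eventually.of_forall fun w =>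
    quartic_sub_eq h.pos h.lt h.quartic_left h.quartic_right w))
  exact this

theorem cofactor_concave {w₀ w₁ : ℝ} : w₁ * cofactor c wm wp w₀ =
    (w₁ - w₀) * cofactor c wm wp 0 + w₀ * cofactor c wm wp w₁ + w₁ * (w₀ * (w₁ - w₀)) := by
  unfold cofactor; ring

theorem Turning.cofactor_pos' (h : Turning c a b wm wp) {w : ℝ} (hw : w ∈ Set.Icc 0 wp) :
    0 < cofactor c wm wp w :=
  cofactor_pos h.pos h.lt h.level_pos h.quartic_left h.quartic_right h.force_right hw

theorem IsSmoothPeriodicWave.sq_eq (h : IsSmoothPeriodicWave c a b L φ) (x : ℝ) :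
    ((c - φ x) * (-deriv φ x)) ^ 2 = quartic c b (c - φ x) - a := by
  have := h.invariant x
  unfold quartic
  linear_combination this

/-- A wave takes values between the turning points and attains the lower one. -/
theorem IsSmoothPeriodicWave.range (h : IsSmoothPeriodicWave c a b L φ)
    (hT : Turning c a b wm wp) :
    (∀ x, c - φ x ∈ Set.Icc wm wp) ∧ ∃ x₀, c - φ x₀ = wm := by
  have hL := h.period.1.1
  have hcont := h.smooth.continuous
  have hdiff : Differentiable ℝ φ := h.smooth.differentiable (by simp)
  obtain ⟨x₀, hx₀⟩ := exists_forall_le_of_periodic (f := fun x => c - φ x) (by fun_prop) hL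
    (fun x => by simp only [h.periodic x])
  obtain ⟨x₁, hx₁⟩ := exists_forall_le_of_periodic hcont hL h.periodic
  have hroot : ∀ x, deriv φ x = 0 → quartic c b (c - φ x) - a = 0 := fun x hx => by
    rw [← h.sq_eq, hx]; ring
  have hr₀ : quartic c b (c - φ x₀) - a = 0 := hroot x₀ <| by
    have : IsLocalMax φ x₀ := Eventually.of_forall fun x => by linarith [hx₀ x]
    exact this.deriv_eq_zero
  have hr₁ : quartic c b (c - φ x₁) - a = 0 := hroot x₁ <| by
    have : IsLocalMin φ x₁ := Eventually.of_forall fun x => hx₁ x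
    exact this.deriv_eq_zero
  have hfac := fun w => quartic_sub_eq hT.pos hT.lt hT.quartic_left hT.quartic_right w
  have hpos : ∀ x, 0 ≤ quartic c b (c - φ x) - a := fun x => by
    rw [← h.sq_eq]; positivity
  have hlt01 : c - φ x₀ < c - φ x₁ := by
    rcases (hx₀ x₁).lt_or_eq with h1 | h1
    · exact h1
    · exfalso
      apply h.not_const
      intro x y
      have := hx₀ x; have := hx₁ x; have := hx₀ y; have := hx₁ y
      linarith
  have hw₀ := h.lt_speed x₀
  have hwp : 0 < wp := hT.pos.trans hT.lt
  have hR0 : 0 < cofactor c wm wp 0 := hT.cofactor_pos' ⟨le_rfl, hwp.le⟩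
  -- If the wave stayed above `wp`, its minimum and maximum would be two distinct positive roots of
  -- the cofactor, impossible for a concave quadratic that is positive at `0`.
  have hle : c - φ x₀ ≤ wp := by
    by_contra! hgt
    rw [hfac] at hr₀ hr₁
    have z1 : ∀ w, wp < w → (w - wm) * (wp - w) * cofactor c wm wp w = 0 →
        cofactor c wm wp w = 0 := by
      intro w hw hz
      refine (mul_eq_zero.mp hz).resolve_left (mul_ne_zero ?_ ?_) <;> linarith [hT.lt]
    have h0 := z1 _ hgt hr₀
    have h1 := z1 _ (hgt.trans hlt01) hr₁
    have := cofactor_concave (c := c) (wm := wm) (wp := wp) (w₀ := c - φ x₀) (w₁ := c - φ x₁)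
    rw [h0, h1] at this
    have p1 : 0 < (c - φ x₁ - (c - φ x₀)) * cofactor c wm wp 0 :=
      mul_pos (by linarith) hR0
    have p2 : 0 < (c - φ x₁) * ((c - φ x₀) * (c - φ x₁ - (c - φ x₀))) :=
      mul_pos (by linarith) (mul_pos hw₀ (by linarith))
    linarith
  -- By continuity the wave would have to cross values just above `wp`, where `quartic c b - a` is
  -- negative although it equals a square along the wave.
  have hall : ∀ x, c - φ x ≤ wp := by
    intro y
    by_contra! hgt
    have hRp : 0 < cofactor c wm wp wp := hT.cofactor_pos' ⟨hwp.le, le_rfl⟩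
    have hev : ∀ᶠ t in 𝓝[>] wp, 0 < cofactor c wm wp t ∧ t < c - φ y ∧ wp < t := by
      have e1 : ∀ᶠ t in 𝓝 wp, 0 < cofactor c wm wp t :=
        (hasDerivAt_cofactor c wm wp wp).continuousAt.eventually_const_lt hRp
      filter_upwards [nhdsWithin_le_nhds e1, nhdsWithin_le_nhds (eventually_lt_nhds hgt),
        self_mem_nhdsWithin] with t h1 h2 h3
      exact ⟨h1, h2, h3⟩
    obtain ⟨t, ht1, ht2, ht3⟩ := hev.exists
    obtain ⟨z, hz⟩ : ∃ z, c - φ z = t := by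
      have := mem_range_of_exists_le_of_exists_ge (f := fun x => c - φ x) (by fun_prop)
        ⟨x₀, hle.trans ht3.le⟩ ⟨y, ht2.le⟩
      exact this
    have := hpos z
    rw [hz, hfac] at this
    have p1 : (t - wm) * (wp - t) * cofactor c wm wp t < 0 :=
      mul_neg_of_neg_of_pos (mul_neg_of_pos_of_neg (by linarith [hT.lt]) (by linarith)) ht1
    linarith
  have hRx : 0 < cofactor c wm wp (c - φ x₀) := hT.cofactor_pos' ⟨hw₀.le, hle⟩
  have heq : c - φ x₀ = wm := by
    rw [hfac] at hr₀
    rcases mul_eq_zero.mp hr₀ with h1 | h1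
    · rcases mul_eq_zero.mp h1 with h2 | h2
      · linarith
      · linarith [hall x₁]
    · exact absurd h1 hRx.ne'
  exact ⟨fun x => ⟨heq ▸ hx₀ x, hall x⟩, x₀, heq⟩

/-- The second order equation for `(c - φ)² / 2`. -/
theorem IsSmoothPeriodicWave.hasDerivAt_momentum (h : IsSmoothPeriodicWave c a b L φ)
    (hT : Turning c a b wm wp) (x : ℝ) :
    HasDerivAt (fun x => (c - φ x) * (-deriv φ x)) (force c b (c - φ x)) x := by
  have hφ1 : ContDiff ℝ 1 φ := h.smooth.of_le (by simp)
  have hφ' : ContDiff ℝ 1 (deriv φ) := (contDiff_infty_iff_deriv.mp h.smooth).2.of_le (by simp)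
  set ψ : ℝ → ℝ := fun x => (c - φ x) * (-deriv φ x) with hψ
  have hψc : ContDiff ℝ 1 ψ := (contDiff_const.sub hφ1).mul hφ'.neg
  have hψd : Differentiable ℝ ψ := hψc.differentiable (by norm_num)
  have hψ'c : Continuous (deriv ψ) := hψc.continuous_deriv (by norm_num)
  have hφd : Differentiable ℝ φ := hφ1.differentiable (by norm_num)
  have hNc : Continuous fun x => force c b (c - φ x) := by
    have := hφd.continuous
    unfold force; fun_prop
  obtain ⟨hrange, -⟩ := h.range hT
  -- Differentiating the first-order invariant gives the second-order equation only after
  -- multiplication by `ψ`.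
  have hkey : ∀ x, ψ x * (deriv ψ x - force c b (c - φ x)) = 0 := by
    intro x
    have h1 : HasDerivAt (fun x => ψ x ^ 2) (2 * ψ x * deriv ψ x) x := by
      simpa using (hψd x).hasDerivAt.fun_pow 2
    have hw : HasDerivAt (fun x => c - φ x) (-deriv φ x) x := (hφd x).hasDerivAt.const_sub c
    have h2 : HasDerivAt (fun x => quartic c b (c - φ x) - a) _ x :=
      (HasDerivAt.comp (h₂ := quartic c b) x (hasDerivAt_quartic c b _) hw).sub_const a
    have h3 := h1.unique (h2.congr_of_eventuallyEq (Eventually.of_forall fun y => h.sq_eq y))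
    simp only [hψ] at h3 ⊢
    linear_combination h3 / 2
  -- Connectedness removes the factor `ψ`. A zero of `ψ` in this set is at a turning point, where
  -- the force does not vanish, so it is isolated and the equation persists nearby; emptiness of the
  -- set would force `ψ = 0` everywhere and a constant wave.
  have hclopen : IsClopen {x | deriv ψ x = force c b (c - φ x)} := by
    refine ⟨isClosed_eq hψ'c hNc, isOpen_iff_mem_nhds.mpr fun x hx => ?_⟩
    have hmem : ∀ y, ψ y ≠ 0 → deriv ψ y = force c b (c - φ y) := fun y hy =>
      sub_eq_zero.mp ((mul_eq_zero.mp (hkey y)).resolve_left hy)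
    by_cases hψx : ψ x = 0
    · have hN : force c b (c - φ x) ≠ 0 := by
        have h1 := h.sq_eq x
        have h2 : ((c - φ x) * (-deriv φ x)) = 0 := hψx
        rw [h2, quartic_sub_eq hT.pos hT.lt hT.quartic_left hT.quartic_right] at h1
        have hR := hT.cofactor_pos' ⟨hT.pos.le.trans (hrange x).1, (hrange x).2⟩
        have h3 : (c - φ x - wm) * (wp - (c - φ x)) * cofactor c wm wp (c - φ x) = 0 := by
          linarith
        rcases mul_eq_zero.mp ((mul_eq_zero.mp h3).resolve_right hR.ne') with h4 | h4
        · rw [sub_eq_zero.mp h4]; exact hT.force_left.ne'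
        · rw [← sub_eq_zero.mp h4]; exact hT.force_right.ne
      have hd : HasDerivAt ψ (force c b (c - φ x)) x := by
        have := (hψd x).hasDerivAt
        rwa [hx] at this
      have hev := hd.eventually_ne (c := 0) hN
      rw [eventually_nhdsWithin_iff] at hev
      filter_upwards [hev] with y hy
      by_cases hyx : y = x
      · rw [hyx]; exact hx
      · exact hmem y (hy hyx)
    · filter_upwards [hψd.continuous.continuousAt.eventually_ne hψx] with y hy
      exact hmem y hy
  have hne : {x | deriv ψ x = force c b (c - φ x)}.Nonempty := by
    by_contra hempty
    rw [Set.not_nonempty_iff_eq_empty] at hempty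
    apply h.not_const
    have hz : ∀ x, deriv φ x = 0 := by
      intro x
      have h1 : x ∉ {x | deriv ψ x = force c b (c - φ x)} := by rw [hempty]; simp
      have h2 : ψ x = 0 := (mul_eq_zero.mp (hkey x)).resolve_right fun h3 =>
        h1 (sub_eq_zero.mp h3)
      have := (mul_eq_zero.mp h2).resolve_left (h.lt_speed x).ne'
      linarith
    exact is_const_of_deriv_eq_zero hφd hz
  have huniv := hclopen.eq_univ hne
  have hx : deriv ψ x = force c b (c - φ x) := by
    have : x ∈ {x | deriv ψ x = force c b (c - φ x)} := by rw [huniv]; trivial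
    exact this
  rw [← hx]
  exact (hψd x).hasDerivAt

/-- The angle variable along a wave. -/
theorem IsSmoothPeriodicWave.exists_angle (h : IsSmoothPeriodicWave c a b L φ)
    (hT : Turning c a b wm wp) :
    ∃ x₀ : ℝ, ∃ Θ : ℝ → ℝ, Θ x₀ = -(Real.pi / 2) ∧
      (∀ x, HasDerivAt Θ (1 / timeDensity c wm wp (Θ x)) x) ∧
      (∀ x, c - φ x = angleW wm wp (Θ x)) := by
  obtain ⟨hrange, x₀, hx₀⟩ := h.range hT
  have hφd : Differentiable ℝ φ := h.smooth.differentiable (by simp)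
  have hw : ∀ x, HasDerivAt (fun x => c - φ x) (-deriv φ x) x := fun x =>
    (hφd x).hasDerivAt.const_sub c
  have hψ := h.hasDerivAt_momentum hT
  have hR : ∀ x, 0 < cofactor c wm wp (c - φ x) := fun x =>
    hT.cofactor_pos' ⟨hT.pos.le.trans (hrange x).1, (hrange x).2⟩
  set d := (wp - wm) / 2 with hd
  set m := (wm + wp) / 2 with hm
  have hd0 : 0 < d := by rw [hd]; linarith [hT.lt]
  set κ : ℝ → ℝ := fun x => √(cofactor c wm wp (c - φ x)) / (c - φ x) with hκ
  have hκc : Continuous κ := by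
    have h1 := hφd.continuous
    have h2 : Continuous fun x => cofactor c wm wp (c - φ x) := by unfold cofactor; fun_prop
    exact h2.sqrt.div (by fun_prop) fun x => (h.lt_speed x).ne'
  set Θ : ℝ → ℝ := fun x => -(Real.pi / 2) + ∫ y in x₀..x, κ y with hΘ
  have hΘd : ∀ x, HasDerivAt Θ (κ x) x := fun x =>
    (intervalIntegral.integral_hasDerivAt_right (hκc.intervalIntegrable _ _)
      (hκc.stronglyMeasurableAtFilter _ _) hκc.continuousAt).const_add _
  have hΘ0 : Θ x₀ = -(Real.pi / 2) := by simp [hΘ]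
  -- `(S, C)` is meant to be `(sin Θ, cos Θ)`: it lies on the unit circle and rotates with angular
  -- speed `κ`, the derivative of `Θ`. This avoids inverting the sine at the turning points.
  set S : ℝ → ℝ := fun x => (c - φ x - m) / d with hS
  set C : ℝ → ℝ := fun x => (c - φ x) * (-deriv φ x) / (d * √(cofactor c wm wp (c - φ x))) with hC
  have hSd : ∀ x, HasDerivAt S (C x * κ x) x := by
    intro x
    refine (((hw x).sub_const m).div_const d).congr_deriv ?_
    have := (h.lt_speed x).ne'
    have := (Real.sqrt_pos.mpr (hR x)).ne'
    simp only [hC, hκ]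
    field_simp
  have hCd : ∀ x, HasDerivAt C (-(S x * κ x)) x := by
    intro x
    have h1 : HasDerivAt (fun x => cofactor c wm wp (c - φ x)) _ x :=
      HasDerivAt.comp (h₂ := cofactor c wm wp) x (hasDerivAt_cofactor c wm wp _) (hw x)
    have h2 := (h1.sqrt (hR x).ne').const_mul d
    have hs := Real.sqrt_pos.mpr (hR x)
    have h3 := (hψ x).div h2 (mul_pos hd0 hs).ne'
    refine h3.congr_deriv ?_
    have hsq := h.sq_eq x
    rw [quartic_sub_eq hT.pos hT.lt hT.quartic_left hT.quartic_right] at hsq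
    have hf := hT.force_eq (c - φ x)
    have hw0 := h.lt_speed x
    have hRs : cofactor c wm wp (c - φ x) = √(cofactor c wm wp (c - φ x)) ^ 2 :=
      (Real.sq_sqrt (hR x).le).symm
    simp only [hS, hκ, hm]
    set s := √(cofactor c wm wp (c - φ x))
    rw [hRs] at hsq hf
    set w := c - φ x
    set w' := -deriv φ x
    rw [div_eq_iff (by positivity)]
    field_simp
    linear_combination s ^ 2 * hf - (-(2 * w) + (2 * c - (wm + wp))) * hsq
  have hSC : ∀ x, S x ^ 2 + C x ^ 2 = 1 := by
    intro x
    have hsq := h.sq_eq x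
    rw [quartic_sub_eq hT.pos hT.lt hT.quartic_left hT.quartic_right] at hsq
    simp only [hS, hC]
    rw [div_pow _ d, div_pow _ (d * _), mul_pow d, Real.sq_sqrt (hR x).le, hsq]
    have := (hR x).ne'
    field_simp
    simp only [hm, hd]
    ring
  -- The scalar product of two unit vectors rotating at equal speed is constant; it is `1` at `x₀`,
  -- so the vectors coincide everywhere.
  have hE : ∀ x, S x * Real.sin (Θ x) + C x * Real.cos (Θ x) = 1 := by
    have hder : ∀ x, HasDerivAt (fun x => S x * Real.sin (Θ x) + C x * Real.cos (Θ x)) 0 x := by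
      intro x
      refine (((hSd x).mul (hΘd x).sin).add ((hCd x).mul (hΘd x).cos)).congr_deriv ?_
      ring
    intro x
    have h1 := is_const_of_deriv_eq_zero (fun x => (hder x).differentiableAt)
      (fun x => (hder x).deriv) x x₀
    rw [h1, hΘ0, Real.sin_neg, Real.cos_neg, Real.sin_pi_div_two, Real.cos_pi_div_two]
    simp only [hS, hx₀, hm, hd]
    have : wp - wm ≠ 0 := by linarith [hT.lt]
    field_simp
    ring
  have hsin : ∀ x, S x = Real.sin (Θ x) := by
    intro x
    have h1 := hE x
    have h2 := hSC x
    have h3 := Real.sin_sq_add_cos_sq (Θ x)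
    have h4 : (S x - Real.sin (Θ x)) ^ 2 + (C x - Real.cos (Θ x)) ^ 2 = 0 := by
      linear_combination h2 + h3 - 2 * h1
    have h5 : (S x - Real.sin (Θ x)) ^ 2 = 0 := by
      have := sq_nonneg (C x - Real.cos (Θ x))
      have := sq_nonneg (S x - Real.sin (Θ x))
      linarith
    exact sub_eq_zero.mp (pow_eq_zero_iff two_ne_zero |>.mp h5)
  have hangle : ∀ x, c - φ x = angleW wm wp (Θ x) := by
    intro x
    rw [angleW, ← hsin x]
    simp only [hS]
    rw [← hd, ← hm]
    field_simp
    ring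
  refine ⟨x₀, Θ, hΘ0, fun x => ?_, hangle⟩
  refine (hΘd x).congr_deriv ?_
  rw [timeDensity, ← hangle, one_div_div]

/-- Over one fundamental period the angle makes exactly one turn. -/
theorem IsSmoothPeriodicWave.angle_period (h : IsSmoothPeriodicWave c a b L φ)
    (hT : Turning c a b wm wp) {x₀ : ℝ} {Θ : ℝ → ℝ} (h0 : Θ x₀ = -(Real.pi / 2))
    (hd : ∀ x, HasDerivAt Θ (1 / timeDensity c wm wp (Θ x)) x)
    (hw : ∀ x, c - φ x = angleW wm wp (Θ x)) :
    Θ (x₀ + L) = 3 * Real.pi / 2 ∧ ∃ x₁ ∈ Set.Ioo x₀ (x₀ + L), Θ x₁ = Real.pi / 2 := by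
  have hpi := Real.pi_pos
  have hc := hT.continuous_timeDensity
  set X : ℝ → ℝ := fun θ => ∫ t in (-(Real.pi / 2))..θ, timeDensity c wm wp t with hX
  have hXd : ∀ θ, HasDerivAt X (timeDensity c wm wp θ) θ := fun θ =>
    intervalIntegral.integral_hasDerivAt_right (hc.intervalIntegrable _ _)
      (hc.stronglyMeasurableAtFilter _ _) hc.continuousAt
  have hXm : StrictMono X := strictMono_of_deriv_pos fun θ => by
    rw [(hXd θ).deriv]; exact hT.timeDensity_pos θ
  have hXΘ : ∀ x, X (Θ x) = x - x₀ := by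
    have hder : ∀ x, HasDerivAt (fun x => X (Θ x) - x) 0 x := by
      intro x
      refine (((hXd (Θ x)).comp x (hd x)).sub (hasDerivAt_id x)).congr_deriv ?_
      have := (hT.timeDensity_pos (Θ x)).ne'
      field_simp
      ring
    intro x
    have h1 := is_const_of_deriv_eq_zero (fun x => (hder x).differentiableAt)
      (fun x => (hder x).deriv) x x₀
    have h2 : X (Θ x₀) = 0 := by rw [h0]; simp [hX]
    simp only [h2] at h1
    linarith
  have hΘX : ∀ θ, Θ (x₀ + X θ) = θ := fun θ => hXm.injective (by rw [hXΘ]; ring)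
  have hXper : ∀ θ, X (θ + 2 * Real.pi) = X θ + X (3 * Real.pi / 2) := by
    intro θ
    have hper : Function.Periodic (timeDensity c wm wp) (2 * Real.pi) := fun θ => by
      simp only [timeDensity, angleW, Real.sin_add_two_pi]
    have h1 := hper.intervalIntegral_add_eq (-(Real.pi / 2)) θ
    have h2 : -(Real.pi / 2) + 2 * Real.pi = 3 * Real.pi / 2 := by ring
    rw [h2] at h1
    simp only [hX]
    rw [h1, intervalIntegral.integral_add_adjacent_intervals (hc.intervalIntegrable _ _)
      (hc.intervalIntegrable _ _)]
  set T := X (3 * Real.pi / 2) with hTdef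
  have hX0 : X (-(Real.pi / 2)) = 0 := by simp [hX]
  have hTpos : 0 < T := by rw [← hX0]; exact hXm (by linarith)
  have hTper : Function.Periodic φ T := by
    intro x
    have h1 : Θ (x + T) = Θ x + 2 * Real.pi := hXm.injective (by
      rw [hXΘ, hXper, hXΘ]; ring)
    have h2 := hw (x + T)
    rw [h1] at h2
    have h3 : angleW wm wp (Θ x + 2 * Real.pi) = angleW wm wp (Θ x) := by
      simp only [angleW, Real.sin_add_two_pi]
    rw [h3, ← hw x] at h2
    linarith
  -- Minimality of `L` excludes more than one turn. For the converse, `w` is back at `wm` after time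
  -- `L`, so `sin Θ = -1`, and the only such angle in `(-π/2, 3π/2]` is the right end.
  have hLT : L ≤ T := h.period.2 ⟨hTpos, hTper⟩
  have hL := h.period.1.1
  have hΘL1 : -(Real.pi / 2) < Θ (x₀ + L) := hXm.lt_iff_lt.mp (by rw [hX0, hXΘ]; linarith)
  have hΘL2 : Θ (x₀ + L) ≤ 3 * Real.pi / 2 := hXm.le_iff_le.mp (by rw [hXΘ, ← hTdef]; linarith)
  have hsin : Real.sin (Θ (x₀ + L)) = -1 := by
    have h1 := hw (x₀ + L)
    rw [h.periodic x₀, hw x₀, h0] at h1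
    simp only [angleW, Real.sin_neg, Real.sin_pi_div_two] at h1
    have hd : (wp - wm) / 2 ≠ 0 := by linarith [hT.lt]
    exact mul_left_cancel₀ hd (by linarith)
  have hΘL : Θ (x₀ + L) = 3 * Real.pi / 2 := by
    by_contra hne
    have hlt := lt_of_le_of_ne hΘL2 hne
    have h1 : Real.cos (|Θ (x₀ + L) - Real.pi / 2|) = -1 := by
      rw [Real.cos_abs, Real.cos_sub_pi_div_two, hsin]
    have h2 : |Θ (x₀ + L) - Real.pi / 2| < Real.pi := by
      rw [abs_lt]; constructor <;> linarith
    have h3 := Real.cos_lt_cos_of_nonneg_of_le_pi (abs_nonneg _) le_rfl h2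
    rw [Real.cos_pi] at h3
    linarith
  refine ⟨hΘL, x₀ + X (Real.pi / 2), ⟨?_, ?_⟩, hΘX _⟩
  · have : X (-(Real.pi / 2)) < X (Real.pi / 2) := hXm (by linarith)
    linarith
  · have h1 : X (Real.pi / 2) < X (Θ (x₀ + L)) := hXm (by linarith)
    rw [hXΘ] at h1
    linarith

end Wave

/-! ### Two solutions of the Hill equation and the form on a period interval. -/

section Profile

open Filter Topology

/-- The two solutions `ψ` and `y` of the Hill equation `u'' = q u` attached to a wave: `ψ` is
periodic with three zeros on the closed period interval, and the derivative of `y` has the jump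
`-(N x₀) τ` over a period. -/
structure Profile (L x₀ x₁ τ : ℝ) (q ψ N y Z : ℝ → ℝ) : Prop where
  lt_left : x₀ < x₁
  lt_right : x₁ < x₀ + L
  cont_q : Continuous q
  deriv_ψ : ∀ x, HasDerivAt ψ (N x) x
  deriv_N : ∀ x, HasDerivAt N (q x * ψ x) x
  ψ_left : ψ x₀ = 0
  ψ_mid : ψ x₁ = 0
  ψ_right : ψ (x₀ + L) = 0
  ψ_ne_left : ∀ x ∈ Set.Ioo x₀ x₁, ψ x ≠ 0
  ψ_ne_right : ∀ x ∈ Set.Ioo x₁ (x₀ + L), ψ x ≠ 0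
  N_left : 0 < N x₀
  N_mid : N x₁ < 0
  N_right : N (x₀ + L) = N x₀
  deriv_y : ∀ x, HasDerivAt y (Z x) x
  deriv_Z : ∀ x ∈ Set.Ioo x₀ (x₀ + L), HasDerivAt Z (q x * y x) x
  cont_Z : Continuous Z
  wronskian : ∀ x, ψ x * Z x = N x * y x - 1 / 2
  Z_left : Z x₀ = 0
  Z_right : Z (x₀ + L) = -(N x₀ * τ)

theorem exists_profile {c a b L : ℝ} {φ : ℝ → ℝ} (hc : 0 < c) (hab : (a, b) ∈ existenceRegion c)
    (h : IsSmoothPeriodicWave c a b L φ) :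
    ∃ τ x₀ x₁ : ℝ, ∃ ψ N y Z : ℝ → ℝ, HasDerivAt (fun a' => periodFn c a' b) τ a ∧
      Profile L x₀ x₁ τ (fun x => 4 - 3 * c / (c - φ x)) ψ N y Z := by
  obtain ⟨wm, wp, α, β, ρ', hT, -, hρ', hper, hid⟩ := exists_period_variation hc hab
  obtain ⟨x₀, Θ, hΘ0, hΘd, hw⟩ := h.exists_angle hT
  obtain ⟨hΘL, x₁, hx₁, hΘ1⟩ := h.angle_period hT hΘ0 hΘd hw
  have hpi := Real.pi_pos
  have hφd : Differentiable ℝ φ := h.smooth.differentiable (by simp)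
  set X : ℝ → ℝ := fun θ => ∫ t in (-(Real.pi / 2))..θ, ρ' t with hX
  have hXd : ∀ θ, HasDerivAt X (ρ' θ) θ := fun θ =>
    intervalIntegral.integral_hasDerivAt_right (hρ'.intervalIntegrable _ _)
      (hρ'.stronglyMeasurableAtFilter _ _) hρ'.continuousAt
  set ψ : ℝ → ℝ := fun x => (c - φ x) * (-deriv φ x) with hψ
  set N : ℝ → ℝ := fun x => force c b (c - φ x) with hN
  set r : ℝ → ℝ := fun x => 1 / timeDensity c wm wp (Θ x) with hr
  set A : ℝ → ℝ := fun x => α + β * Real.sin (Θ x) with hA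
  -- This is the `a`-derivative of `w²/2` at fixed `x`: `A` and `X ∘ Θ` are those of `w` and of the
  -- time at fixed angle, and the chain rule subtracts `ψ` times the latter. `Z` is its
  -- `x`-derivative, written out.
  set y : ℝ → ℝ := fun x => (c - φ x) * A x - ψ x * X (Θ x) with hy
  set Z : ℝ → ℝ := fun x => -deriv φ x * A x + (c - φ x) * (β * (Real.cos (Θ x) * r x)) -
    (N x * X (Θ x) + ψ x * (ρ' (Θ x) * r x)) with hZ
  have hwd : ∀ x, HasDerivAt (fun x => c - φ x) (-deriv φ x) x := fun x =>
    (hφd x).hasDerivAt.const_sub c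
  have hψd : ∀ x, HasDerivAt ψ (N x) x := h.hasDerivAt_momentum hT
  have hw' : ∀ x, -deriv φ x = (wp - wm) / 2 * Real.cos (Θ x) * r x := by
    intro x
    have h1 := (hasDerivAt_angleW wm wp (Θ x)).comp x (hΘd x)
    exact (hwd x).unique (h1.congr_of_eventuallyEq (Eventually.of_forall hw))
  have hNd : ∀ x, HasDerivAt N ((4 - 3 * c / (c - φ x)) * ψ x) x := by
    intro x
    have h1 : HasDerivAt N (-(3 * c * (-deriv φ x)) + 2 * (2 * (c - φ x) * (-deriv φ x))) x := by
      have h2 : HasDerivAt (fun x => 2 * (c - φ x) ^ 2) (2 * (2 * (c - φ x) * (-deriv φ x))) x := by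
        have := ((hwd x).fun_pow 2).const_mul 2
        refine this.congr_deriv ?_
        simp
      have h3 := (((hwd x).const_mul (3 * c)).const_sub (c ^ 2 + b)).add h2
      exact h3
    refine h1.congr_deriv ?_
    have := (h.lt_speed x).ne'
    simp only [hψ]
    field_simp
    ring
  have hAd : ∀ x, HasDerivAt A (β * (Real.cos (Θ x) * r x)) x := fun x =>
    ((hΘd x).sin.const_mul β).const_add α
  have hyd : ∀ x, HasDerivAt y (Z x) x := fun x =>
    ((hwd x).mul (hAd x)).sub ((hψd x).mul ((hXd (Θ x)).comp x (hΘd x)))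
  have hΘc : Continuous Θ := continuous_iff_continuousAt.mpr fun x => (hΘd x).continuousAt
  have hrc : Continuous r := continuous_const.div (hT.continuous_timeDensity.comp hΘc)
    fun x => (hT.timeDensity_pos _).ne'
  have hφ'c : Continuous (deriv φ) := h.smooth.continuous_deriv (by simp)
  have hNc : Continuous N := continuous_iff_continuousAt.mpr fun x => (hNd x).continuousAt
  have hψc : Continuous ψ := continuous_iff_continuousAt.mpr fun x => (hψd x).continuousAt
  have hXc : Continuous X := continuous_iff_continuousAt.mpr fun x => (hXd x).continuousAt
  have hyc : Continuous y := continuous_iff_continuousAt.mpr fun x => (hyd x).continuousAt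
  have hZc : Continuous Z := by
    have h1 := h.smooth.continuous
    have h2 : Continuous fun x => ρ' (Θ x) := hρ'.comp hΘc
    have h3 : Continuous fun x => X (Θ x) := hXc.comp hΘc
    simp only [hZ, hA]
    fun_prop
  -- The energy identity differentiated in `a`; the `1/2` is the contribution of the explicit `a` in
  -- `quartic c b w - a`.
  have hwr : ∀ x, ψ x * Z x = N x * y x - 1 / 2 := by
    intro x
    have h1 := hid (Θ x)
    have h2 := h.sq_eq x
    have h3 := hw' x
    rw [← hw x] at h1
    have hρ := (hT.timeDensity_pos (Θ x)).ne'
    have hrρ : r x * timeDensity c wm wp (Θ x) = 1 := by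
      simp only [hr]; field_simp
    have hwΘ : (wp - wm) / 2 * Real.cos (Θ x) = -deriv φ x * timeDensity c wm wp (Θ x) := by
      rw [h3]; linear_combination (-((wp - wm) / 2 * Real.cos (Θ x))) * hrρ
    rw [hwΘ, ← h2] at h1
    simp only [hy, hZ, hψ, hN, hA]
    set w := c - φ x
    set w' := -deriv φ x
    set ρ := timeDensity c wm wp (Θ x)
    have hρ2 : ρ ^ 2 * (2 * (w * w') * (w' * (α + β * Real.sin (Θ x)) +
        w * (β * (Real.cos (Θ x) * r x)) - w * w' * (ρ' (Θ x) * r x)) -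
          (2 * w * force c b w * (α + β * Real.sin (Θ x)) - 1)) = 0 := by
      linear_combination h1 + 2 * w ^ 2 * w' * ρ * β * Real.cos (Θ x) * hrρ
        - 2 * (w * w') ^ 2 * ρ * ρ' (Θ x) * hrρ
    have h4 := (mul_eq_zero.mp hρ2).resolve_left (pow_ne_zero 2 hρ)
    linear_combination h4 / 2
  have hmono : StrictMono Θ := strictMono_of_deriv_pos fun x => by
    rw [(hΘd x).deriv]; exact one_div_pos.mpr (hT.timeDensity_pos _)
  have hrpos : ∀ x, 0 < r x := fun x => one_div_pos.mpr (hT.timeDensity_pos _)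
  have hψ_eq : ∀ x, ψ x = (c - φ x) * ((wp - wm) / 2 * Real.cos (Θ x) * r x) := fun x => by
    rw [← hw' x]
  have hψ_ne : ∀ x, Real.cos (Θ x) ≠ 0 → ψ x ≠ 0 := by
    intro x hx
    rw [hψ_eq]
    have := (h.lt_speed x).ne'
    have := (hrpos x).ne'
    have : (wp - wm) / 2 ≠ 0 := by linarith [hT.lt]
    positivity
  have hψ_z : ∀ x, Real.cos (Θ x) = 0 → ψ x = 0 := fun x hx => by rw [hψ_eq, hx]; ring
  have hcos3 : Real.cos (3 * Real.pi / 2) = 0 := by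
    rw [show 3 * Real.pi / 2 = Real.pi / 2 + Real.pi by ring, Real.cos_add_pi,
      Real.cos_pi_div_two, neg_zero]
  have c0 : Real.cos (Θ x₀) = 0 := by rw [hΘ0, Real.cos_neg, Real.cos_pi_div_two]
  have c1 : Real.cos (Θ x₁) = 0 := by rw [hΘ1, Real.cos_pi_div_two]
  have cL : Real.cos (Θ (x₀ + L)) = 0 := by rw [hΘL, hcos3]
  have w0 : c - φ x₀ = wm := by
    rw [hw, hΘ0]; simp only [angleW, Real.sin_neg, Real.sin_pi_div_two]; ring
  have w1 : c - φ x₁ = wp := by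
    rw [hw, hΘ1]; simp only [angleW, Real.sin_pi_div_two]; ring
  have hneL : ∀ x ∈ Set.Ioo x₀ x₁, ψ x ≠ 0 := by
    intro x hx
    apply hψ_ne
    have t1 := hmono hx.1
    have t2 := hmono hx.2
    rw [hΘ0] at t1
    rw [hΘ1] at t2
    exact (Real.cos_pos_of_mem_Ioo ⟨t1, t2⟩).ne'
  have hneR : ∀ x ∈ Set.Ioo x₁ (x₀ + L), ψ x ≠ 0 := by
    intro x hx
    apply hψ_ne
    have t1 := hmono hx.1
    have t2 := hmono hx.2
    rw [hΘ1] at t1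
    rw [hΘL] at t2
    exact (Real.cos_neg_of_pi_div_two_lt_of_lt t1 (by linarith)).ne
  -- Where `ψ ≠ 0` the Wronskian relation can be solved for `Z` and differentiated, which avoids
  -- second derivatives of the density. At `x₁`, the only interior zero of `ψ`, the derivative is
  -- recovered as a limit from both sides.
  have hZd : ∀ x, ψ x ≠ 0 → HasDerivAt Z ((4 - 3 * c / (c - φ x)) * y x) x := by
    intro x hx
    have h1 := (((hNd x).mul (hyd x)).sub_const (1 / 2)).div (hψd x) hx
    have h2 : Z =ᶠ[𝓝 x] fun x => (N x * y x - 1 / 2) / ψ x := by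
      filter_upwards [hψc.continuousAt.eventually_ne hx] with t ht
      rw [eq_div_iff ht, ← hwr t, mul_comm]
    refine (h1.congr_of_eventuallyEq h2).congr_deriv ?_
    have h3 : ∀ p n y z q : ℝ, p ≠ 0 → p * z = n * y - 1 / 2 →
        ((q * p * y + n * z) * p - (n * y - 1 / 2) * n) / p ^ 2 = q * y := by
      intro p n y z q hp hz
      rw [div_eq_iff (pow_ne_zero 2 hp)]
      linear_combination n * hz
    exact h3 _ _ _ _ _ hx (hwr x)
  have hqc : Continuous fun x => 4 - 3 * c / (c - φ x) := by
    have h1 := h.smooth.continuous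
    exact continuous_const.sub (continuous_const.div (by fun_prop) fun x => (h.lt_speed x).ne')
  refine ⟨_, x₀, x₁, ψ, N, y, Z, hper, ?_⟩
  refine ⟨hx₁.1, hx₁.2, hqc, hψd, hNd, hψ_z _ c0, hψ_z _ c1, hψ_z _ cL, hneL, hneR, ?_, ?_, ?_,
    hyd, ?_, hZc, hwr, ?_, ?_⟩
  · simp only [hN, w0]; exact hT.force_left
  · simp only [hN, w1]; exact hT.force_right
  · simp only [hN, h.periodic x₀]
  · intro x hx
    rcases lt_trichotomy x x₁ with hlt | heq | hgt
    · exact hZd x (hneL x ⟨hx.1, hlt⟩)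
    · have hqy : Continuous fun x => (4 - 3 * c / (c - φ x)) * y x := hqc.mul hyc
      have hev : ∀ᶠ t in 𝓝[≠] x, HasDerivAt Z ((4 - 3 * c / (c - φ t)) * y t) t := by
        have : ∀ᶠ t in 𝓝 x, t ∈ Set.Ioo x₀ (x₀ + L) := Ioo_mem_nhds hx.1 hx.2
        filter_upwards [nhdsWithin_le_nhds this, self_mem_nhdsWithin] with t ht htx
        rcases lt_or_gt_of_ne htx with h1 | h1
        · exact hZd t (hneL t ⟨ht.1, heq ▸ h1⟩)
        · exact hZd t (hneR t ⟨heq ▸ h1, ht.2⟩)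
      have hfin : ∀ᶠ t in 𝓝 x, t ≠ x → HasDerivAt Z ((4 - 3 * c / (c - φ t)) * y t) t :=
        eventually_nhdsWithin_iff.mp hev
      obtain ⟨U, hU1, hU2, hU3⟩ := mem_nhds_iff.mp hfin
      have hdU : ∀ t ∈ U, t ≠ x → HasDerivAt Z ((4 - 3 * c / (c - φ t)) * y t) t :=
        fun t ht => hU1 ht
      have hR : HasDerivWithinAt Z ((4 - 3 * c / (c - φ x)) * y x) (Set.Ici x) x := by
        refine hasDerivWithinAt_Ici_of_tendsto_deriv (s := U ∩ Set.Ioi x) ?_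
          hZc.continuousAt.continuousWithinAt ?_ ?_
        · exact fun t ht => (hdU t ht.1 (ne_of_gt ht.2)).differentiableAt.differentiableWithinAt
        · exact inter_mem (nhdsWithin_le_nhds (hU2.mem_nhds hU3)) self_mem_nhdsWithin
        · refine (hqy.continuousAt.tendsto.mono_left nhdsWithin_le_nhds).congr' ?_
          filter_upwards [nhdsWithin_le_nhds (hU2.mem_nhds hU3), self_mem_nhdsWithin] with t h1 h2
          exact (hdU t h1 (ne_of_gt h2)).deriv.symm
      have hL : HasDerivWithinAt Z ((4 - 3 * c / (c - φ x)) * y x) (Set.Iic x) x := by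
        refine hasDerivWithinAt_Iic_of_tendsto_deriv (s := U ∩ Set.Iio x) ?_
          hZc.continuousAt.continuousWithinAt ?_ ?_
        · exact fun t ht => (hdU t ht.1 (ne_of_lt ht.2)).differentiableAt.differentiableWithinAt
        · exact inter_mem (nhdsWithin_le_nhds (hU2.mem_nhds hU3)) self_mem_nhdsWithin
        · refine (hqy.continuousAt.tendsto.mono_left nhdsWithin_le_nhds).congr' ?_
          filter_upwards [nhdsWithin_le_nhds (hU2.mem_nhds hU3), self_mem_nhdsWithin] with t h1 h2
          exact (hdU t h1 (ne_of_lt h2)).deriv.symm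
      have := hL.union hR
      rwa [Set.Iic_union_Ici, hasDerivWithinAt_univ] at this
    · exact hZd x (hneR x ⟨hgt, hx.2⟩)
  · have d0 : -deriv φ x₀ = 0 := by rw [hw', c0]; ring
    have X0 : X (Θ x₀) = 0 := by rw [hΘ0]; simp [hX]
    simp only [hZ, X0, d0, c0, hψ_z _ c0]; ring
  · have dL : -deriv φ (x₀ + L) = 0 := by rw [hw', cL]; ring
    have hNL : N (x₀ + L) = N x₀ := by simp only [hN, h.periodic x₀]
    simp only [hZ, dL, cL, hψ_z _ cL, hNL]
    rw [hΘL]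
    simp only [hX]
    ring

/-! ### Jacobi's inequality -/

/-- Near the common zero `z²/ψ` is `z` times a quotient of difference quotients, and the denominator
has the nonzero limit `n`. This handles the boundary terms in Jacobi's inequality. -/
theorem tendsto_sq_div {z ψ : ℝ → ℝ} {s z' n : ℝ} (hz : HasDerivAt z z' s) (hψ : HasDerivAt ψ n s)
    (hz0 : z s = 0) (hψ0 : ψ s = 0) (hn : n ≠ 0) :
    Tendsto (fun x => z x ^ 2 / ψ x) (𝓝[≠] s) (𝓝 0) := by
  have h1 := hasDerivAt_iff_tendsto_slope.mp hz
  have h2 := hasDerivAt_iff_tendsto_slope.mp hψ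
  have h3 : Tendsto z (𝓝[≠] s) (𝓝 0) := by
    have := hz.continuousAt.tendsto
    rw [hz0] at this
    exact this.mono_left nhdsWithin_le_nhds
  have h4 := (h1.mul h3).div h2 hn
  rw [mul_zero, zero_div] at h4
  refine h4.congr' ?_
  filter_upwards [self_mem_nhdsWithin] with x hx
  have hx' : x - s ≠ 0 := sub_ne_zero.mpr hx
  simp only [slope_def_field, hz0, hψ0, sub_zero, Pi.div_apply]
  by_cases hψx : ψ x = 0
  · simp [hψx]
  · field_simp

/-- Jacobi's inequality between consecutive zeros of a solution of `u'' = q u`, with the case of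
equality. -/
theorem jacobi_inequality {q ψ N z z' : ℝ → ℝ} {s t : ℝ} (hst : s < t) (hq : Continuous q)
    (hψ : ∀ x, HasDerivAt ψ (N x) x) (hN : ∀ x, HasDerivAt N (q x * ψ x) x)
    (hψs : ψ s = 0) (hψt : ψ t = 0) (hne : ∀ x ∈ Set.Ioo s t, ψ x ≠ 0)
    (hNs : N s ≠ 0) (hNt : N t ≠ 0) (hz : ∀ x, HasDerivAt z (z' x) x) (hz' : Continuous z')
    (hzs : z s = 0) (hzt : z t = 0) :
    0 ≤ ∫ x in s..t, (z' x ^ 2 + q x * z x ^ 2) ∧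
      (∫ x in s..t, (z' x ^ 2 + q x * z x ^ 2) = 0 → ∃ k, ∀ x ∈ Set.Icc s t, z x = k * ψ x) := by
  have hzc : Continuous z := continuous_iff_continuousAt.mpr fun x => (hz x).continuousAt
  have hNc : Continuous N := continuous_iff_continuousAt.mpr fun x => (hN x).continuousAt
  have hfc : Continuous fun x => z' x ^ 2 + q x * z x ^ 2 := by fun_prop
  set F : ℝ → ℝ := fun x => ∫ r in s..x, (z' r ^ 2 + q r * z r ^ 2) with hF
  have hFd : ∀ x, HasDerivAt F (z' x ^ 2 + q x * z x ^ 2) x := fun x =>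
    intervalIntegral.integral_hasDerivAt_right (hfc.intervalIntegrable _ _)
      (hfc.stronglyMeasurableAtFilter _ _) hfc.continuousAt
  have hFc : Continuous F := continuous_iff_continuousAt.mpr fun x => (hFd x).continuousAt
  -- The Riccati substitution: subtracting `(ψ'/ψ) z²` makes the derivative the perfect square `(z'
  -- - (ψ'/ψ) z)²`. `G` runs from `0` to the full integral, and is constant only if `z/ψ` is.
  set G : ℝ → ℝ := fun x => F x - N x * (z x ^ 2 / ψ x) with hG
  have hGd : ∀ x ∈ Set.Ioo s t, HasDerivAt G ((z' x - N x / ψ x * z x) ^ 2) x := by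
    intro x hx
    have h0 := hne x hx
    have h1 := (hFd x).sub ((hN x).mul (((hz x).fun_pow 2).div (hψ x) h0))
    refine h1.congr_deriv ?_
    simp only [Pi.div_apply]
    field_simp
    push_cast
    ring
  have hGm : MonotoneOn G (Set.Ioo s t) := by
    refine monotoneOn_of_deriv_nonneg (convex_Ioo s t)
      (fun x hx => (hGd x hx).continuousAt.continuousWithinAt) ?_ ?_
    · rw [interior_Ioo]
      exact fun x hx => (hGd x hx).differentiableAt.differentiableWithinAt
    · rw [interior_Ioo]
      intro x hx
      rw [(hGd x hx).deriv]
      positivity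
  have hlim : ∀ p, z p = 0 → ψ p = 0 → N p ≠ 0 → Tendsto G (𝓝[≠] p) (𝓝 (F p)) := by
    intro p h1 h2 h3
    have h4 := tendsto_sq_div (hz p) (hψ p) h1 h2 h3
    have h5 := (hFc.continuousAt (x := p)).tendsto.mono_left (nhdsWithin_le_nhds (s := {p}ᶜ))
    have h6 := (hNc.continuousAt (x := p)).tendsto.mono_left (nhdsWithin_le_nhds (s := {p}ᶜ))
    have h7 := h5.sub (h6.mul h4)
    rwa [mul_zero, sub_zero] at h7
  have hls : Tendsto G (𝓝[>] s) (𝓝 0) := by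
    have := hlim s hzs hψs hNs
    have h0 : F s = 0 := by simp [hF]
    rw [h0] at this
    exact this.mono_left (nhdsWithin_mono s fun x hx => ne_of_gt hx)
  have hlt : Tendsto G (𝓝[<] t) (𝓝 (F t)) :=
    (hlim t hzt hψt hNt).mono_left (nhdsWithin_mono t fun x hx => ne_of_lt hx)
  have hbound : ∀ x ∈ Set.Ioo s t, 0 ≤ G x ∧ G x ≤ F t := by
    intro x hx
    constructor
    · refine le_of_tendsto hls ?_
      filter_upwards [Ioo_mem_nhdsGT hx.1] with r hr
      exact hGm ⟨hr.1, hr.2.trans hx.2⟩ hx hr.2.le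
    · refine ge_of_tendsto hlt ?_
      filter_upwards [Ioo_mem_nhdsLT hx.2] with r hr
      exact hGm hx ⟨hx.1.trans hr.1, hr.2⟩ hr.1.le
  have hmid : (s + t) / 2 ∈ Set.Ioo s t := ⟨by linarith, by linarith⟩
  refine ⟨(hbound _ hmid).1.trans (hbound _ hmid).2, fun hzero => ?_⟩
  have hG0 : ∀ x ∈ Set.Ioo s t, G x = 0 := fun x hx =>
    le_antisymm ((hbound x hx).2.trans_eq hzero) (hbound x hx).1
  have hode : ∀ x ∈ Set.Ioo s t, z' x = N x / ψ x * z x := by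
    intro x hx
    have h1 : HasDerivAt G 0 x := by
      refine (hasDerivAt_const x (0 : ℝ)).congr_of_eventuallyEq ?_
      filter_upwards [Ioo_mem_nhds hx.1 hx.2] with r hr
      exact hG0 r hr
    have h2 := (hGd x hx).unique h1
    have := pow_eq_zero_iff two_ne_zero |>.mp h2
    linarith
  have hquot : ∀ x ∈ Set.Ioo s t, HasDerivAt (fun x => z x / ψ x) 0 x := by
    intro x hx
    have h0 := hne x hx
    refine ((hz x).div (hψ x) h0).congr_deriv ?_
    rw [hode x hx]
    field_simp
    ring
  refine ⟨z ((s + t) / 2) / ψ ((s + t) / 2), fun x hx => ?_⟩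
  rcases hx.1.eq_or_lt with h1 | h1
  · rw [← h1, hzs, hψs, mul_zero]
  rcases hx.2.eq_or_lt with h2 | h2
  · rw [h2, hzt, hψt, mul_zero]
  have hconst : z x / ψ x = z ((s + t) / 2) / ψ ((s + t) / 2) := by
    refine (isOpen_Ioo (a := s) (b := t)).is_const_of_deriv_eq_zero isPreconnected_Ioo
      (fun r hr => (hquot r hr).differentiableAt.differentiableWithinAt)
      (fun r hr => (hquot r hr).deriv) ⟨h1, h2⟩ hmid
  rw [← hconst, div_mul_cancel₀ _ (hne x ⟨h1, h2⟩)]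

namespace Profile

variable {L x₀ x₁ τ : ℝ} {q ψ N y Z : ℝ → ℝ}

theorem y_left (P : Profile L x₀ x₁ τ q ψ N y Z) : N x₀ * y x₀ = 1 / 2 := by
  have := P.wronskian x₀; rw [P.ψ_left] at this; linarith

theorem y_mid (P : Profile L x₀ x₁ τ q ψ N y Z) : N x₁ * y x₁ = 1 / 2 := by
  have := P.wronskian x₁; rw [P.ψ_mid] at this; linarith

theorem y_right (P : Profile L x₀ x₁ τ q ψ N y Z) : y (x₀ + L) = y x₀ := by
  have h1 := P.wronskian (x₀ + L)
  rw [P.ψ_right, P.N_right] at h1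
  have h2 := P.y_left
  exact mul_left_cancel₀ P.N_left.ne' (by linarith)

theorem cont_y (P : Profile L x₀ x₁ τ q ψ N y Z) : Continuous y :=
  continuous_iff_continuousAt.mpr fun x => (P.deriv_y x).continuousAt

theorem cont_ψ (P : Profile L x₀ x₁ τ q ψ N y Z) : Continuous ψ :=
  continuous_iff_continuousAt.mpr fun x => (P.deriv_ψ x).continuousAt

theorem cont_N (P : Profile L x₀ x₁ τ q ψ N y Z) : Continuous N :=
  continuous_iff_continuousAt.mpr fun x => (P.deriv_N x).continuousAt

/-- The quadratic form of the Hill operator on the functions satisfying one linear condition. -/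
theorem form_ge (P : Profile L x₀ x₁ τ q ψ N y Z) {u u' : ℝ → ℝ}
    (hu : ∀ x, HasDerivAt u (u' x) x) (hu' : Continuous u') (hper : u (x₀ + L) = u x₀)
    (hcond : N x₁ * u x₁ = N x₀ * u x₀) :
    -(τ / 2) * (2 * N x₀ * u x₀) ^ 2 ≤ ∫ x in x₀..x₀ + L, (u' x ^ 2 + q x * u x ^ 2) ∧
      (∫ x in x₀..x₀ + L, (u' x ^ 2 + q x * u x ^ 2) = -(τ / 2) * (2 * N x₀ * u x₀) ^ 2 →
        ∃ k, ∀ x ∈ Set.Icc x₀ (x₀ + L), u x = 2 * N x₀ * u x₀ * y x + k * ψ x) := by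
  set α := 2 * N x₀ * u x₀ with hα
  have hlt : x₀ < x₀ + L := P.lt_left.trans P.lt_right
  have hcy := P.cont_y
  have hcZ := P.cont_Z
  have hcq := P.cont_q
  have hcu : Continuous u := continuous_iff_continuousAt.mpr fun x => (hu x).continuousAt
  set z : ℝ → ℝ := fun x => u x - α * y x with hz
  set z' : ℝ → ℝ := fun x => u' x - α * Z x with hz'
  have hzd : ∀ x, HasDerivAt z (z' x) x := fun x => (hu x).sub ((P.deriv_y x).const_mul α)
  have hz'c : Continuous z' := by fun_prop
  have hcz : Continuous z := by fun_prop
  have z0 : z x₀ = 0 := by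
    simp only [hz, hα]; linear_combination (-2 * u x₀) * P.y_left
  have z1 : z x₁ = 0 := by
    have h1 := P.y_mid
    have : N x₁ * z x₁ = 0 := by
      simp only [hz, hα]; linear_combination hcond - 2 * N x₀ * u x₀ * h1
    exact (mul_eq_zero.mp this).resolve_left P.N_mid.ne
  have zL : z (x₀ + L) = 0 := by
    have : z (x₀ + L) = z x₀ := by simp only [hz, hper, P.y_right]
    rw [this, z0]
  have J1 := jacobi_inequality P.lt_left P.cont_q P.deriv_ψ P.deriv_N P.ψ_left P.ψ_mid P.ψ_ne_left
    P.N_left.ne' P.N_mid.ne hzd hz'c z0 z1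
  have J2 := jacobi_inequality P.lt_right P.cont_q P.deriv_ψ P.deriv_N P.ψ_mid P.ψ_right
    P.ψ_ne_right P.N_mid.ne (by rw [P.N_right]; exact P.N_left.ne') hzd hz'c z1 zL
  have hfc : Continuous fun x => z' x ^ 2 + q x * z x ^ 2 := by fun_prop
  have hsplit : ∫ x in x₀..x₀ + L, (z' x ^ 2 + q x * z x ^ 2) =
      (∫ x in x₀..x₁, (z' x ^ 2 + q x * z x ^ 2)) +
        ∫ x in x₁..x₀ + L, (z' x ^ 2 + q x * z x ^ 2) :=
    (intervalIntegral.integral_add_adjacent_intervals (hfc.intervalIntegrable _ _)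
      (hfc.intervalIntegrable _ _)).symm
  -- Since `y'' = qy`, the terms involving `y` form an exact derivative. As `z` vanishes at the
  -- right end and `Z` at the left one, only the jump of `Z` over the period contributes.
  have hcross : ∫ x in x₀..x₀ + L, (2 * α * (Z x * z' x + q x * y x * z x) +
      α ^ 2 * (Z x * Z x + q x * y x * y x)) = -(τ / 2) * α ^ 2 := by
    have hd : ∀ x ∈ Set.Ioo x₀ (x₀ + L), HasDerivAt
        (fun x => 2 * α * (Z x * z x) + α ^ 2 * (Z x * y x))
        (2 * α * (Z x * z' x + q x * y x * z x) + α ^ 2 * (Z x * Z x + q x * y x * y x)) x := by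
      intro x hx
      have h1 := (((P.deriv_Z x hx).mul (hzd x)).const_mul (2 * α)).add
        (((P.deriv_Z x hx).mul (P.deriv_y x)).const_mul (α ^ 2))
      refine h1.congr_deriv ?_
      ring
    rw [intervalIntegral.integral_eq_sub_of_hasDerivAt_of_le hlt.le
      (by fun_prop) hd (Continuous.intervalIntegrable (by fun_prop) _ _), P.Z_left, zL, P.Z_right,
      P.y_right]
    linear_combination (-α ^ 2 * τ) * P.y_left
  have hexp : ∫ x in x₀..x₀ + L, (u' x ^ 2 + q x * u x ^ 2) =
      (∫ x in x₀..x₀ + L, (z' x ^ 2 + q x * z x ^ 2)) + -(τ / 2) * α ^ 2 := by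
    rw [← hcross, ← intervalIntegral.integral_add (hfc.intervalIntegrable _ _)
      (Continuous.intervalIntegrable (by fun_prop) _ _)]
    congr 1
    ext x
    simp only [hz, hz']
    ring
  refine ⟨by rw [hexp, hsplit]; linarith [J1.1, J2.1], fun heq => ?_⟩
  rw [hexp, hsplit] at heq
  obtain ⟨k, hk⟩ := J1.2 (by linarith [J1.1, J2.1])
  obtain ⟨k', hk'⟩ := J2.2 (by linarith [J1.1, J2.1])
  have hd : ∀ k : ℝ, HasDerivAt (fun x => k * ψ x) (k * N x₁) x₁ := fun k =>
    (P.deriv_ψ x₁).const_mul k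
  -- The two half intervals give separate multiples of `ψ`; differentiability of `z` at `x₁`, where
  -- `ψ' ≠ 0`, makes them equal.
  have hkk : k = k' := by
    have e1 : z' x₁ = k * N x₁ := by
      have h1 : HasDerivWithinAt z (k * N x₁) (Set.Icc x₀ x₁) x₁ :=
        (hd k).hasDerivWithinAt.congr hk (hk x₁ ⟨P.lt_left.le, le_rfl⟩)
      exact (uniqueDiffOn_Icc P.lt_left x₁ ⟨P.lt_left.le, le_rfl⟩).eq_deriv _
        (hzd x₁).hasDerivWithinAt h1
    have e2 : z' x₁ = k' * N x₁ := by
      have h1 : HasDerivWithinAt z (k' * N x₁) (Set.Icc x₁ (x₀ + L)) x₁ :=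
        (hd k').hasDerivWithinAt.congr hk' (hk' x₁ ⟨le_rfl, P.lt_right.le⟩)
      exact (uniqueDiffOn_Icc P.lt_right x₁ ⟨le_rfl, P.lt_right.le⟩).eq_deriv _
        (hzd x₁).hasDerivWithinAt h1
    exact mul_right_cancel₀ P.N_mid.ne (e1.symm.trans e2)
  refine ⟨k, fun x hx => ?_⟩
  have : z x = k * ψ x := by
    rcases le_total x x₁ with h1 | h1
    · exact hk x ⟨hx.1, h1⟩
    · rw [hkk]; exact hk' x ⟨h1, hx.2⟩
  simp only [hz] at this
  linarith

end Profile

end Profile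

/-! ### Periodic elements with one-sided square integrable derivatives, and integration by parts. -/

section Lift

theorem memLp_of_continuousOn {L x₀ : ℝ} {g : ℝ → ℂ} (hg : ContinuousOn g (Set.Icc x₀ (x₀ + L))) :
    MemLp g 2 (volume.restrict (Set.Ioc x₀ (x₀ + L))) := by
  obtain ⟨C, hC⟩ := isCompact_Icc.exists_bound_of_continuousOn hg
  refine MemLp.of_bound ((hg.mono Set.Ioc_subset_Icc_self).aestronglyMeasurable measurableSet_Ioc)
    C ?_
  filter_upwards [ae_restrict_mem measurableSet_Ioc] with x hx
  exact hC x (Set.Ioc_subset_Icc_self hx)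

variable {L : ℝ} [hLf : Fact (0 < L)] {x₀ x₁ τ : ℝ}

/-- The pair `(η, η')` in `L²_per` is represented on `(x₀, x₀ + L]` by a continuous periodic
function `g` and its square integrable right derivative `g'`. -/
structure IsLift (x₀ : ℝ) (η η' : L2per L) (g g' : ℝ → ℂ) : Prop where
  rep : Represents x₀ η g
  rep' : Represents x₀ η' g'
  cont : ContinuousOn g (Set.Icc x₀ (x₀ + L))
  per : g (x₀ + L) = g x₀
  deriv : ∀ x ∈ Set.Ioo x₀ (x₀ + L), HasDerivWithinAt g (g' x) (Set.Ioi x) x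
  memLp : MemLp g' 2 (volume.restrict (Set.Ioc x₀ (x₀ + L)))

theorem le_add_period (x₀ : ℝ) : x₀ ≤ x₀ + L := by
  have hL : (0 : ℝ) < L := Fact.out
  linarith

namespace IsLift

theorem intervalIntegrable {η η' : L2per L} {g g' : ℝ → ℂ} (h : IsLift x₀ η η' g g') :
    IntervalIntegrable g' volume x₀ (x₀ + L) := by
  rw [intervalIntegrable_iff_integrableOn_Ioc_of_le (le_add_period (L := L) x₀)]
  exact h.memLp.integrable one_le_two

theorem isWeakDeriv {η η' : L2per L} {g g' : ℝ → ℂ} (h : IsLift x₀ η η' g g') :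
    IsWeakDeriv η η' :=
  isWeakDeriv_of_represents h.rep h.rep' h.cont h.per h.deriv h.intervalIntegrable

theorem add {η η' ζ ζ' : L2per L} {g g' f f' : ℝ → ℂ} (h : IsLift x₀ η η' g g')
    (k : IsLift x₀ ζ ζ' f f') :
    IsLift x₀ (η + ζ) (η' + ζ') (fun x => g x + f x) (fun x => g' x + f' x) :=
  ⟨h.rep.add k.rep, h.rep'.add k.rep', h.cont.add k.cont, by simp only [h.per, k.per],
    fun x hx => (h.deriv x hx).add (k.deriv x hx), h.memLp.add k.memLp⟩

theorem smul {η η' : L2per L} {g g' : ℝ → ℂ} (h : IsLift x₀ η η' g g') (r : ℂ) :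
    IsLift x₀ (r • η) (r • η') (fun x => r * g x) (fun x => r * g' x) :=
  ⟨h.rep.smul r, h.rep'.smul r, continuousOn_const.mul h.cont, by simp only [h.per],
    fun x hx => (h.deriv x hx).const_mul r, h.memLp.const_mul r⟩

theorem exists_of_memLp {g g' : ℝ → ℂ} (cont : ContinuousOn g (Set.Icc x₀ (x₀ + L)))
    (per : g (x₀ + L) = g x₀)
    (deriv : ∀ x ∈ Set.Ioo x₀ (x₀ + L), HasDerivWithinAt g (g' x) (Set.Ioi x) x)
    (memLp : MemLp g' 2 (volume.restrict (Set.Ioc x₀ (x₀ + L)))) :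
    ∃ η η' : L2per L, IsLift x₀ η η' g g' := by
  obtain ⟨η, hη⟩ := exists_represents x₀ (memLp_of_continuousOn cont)
  obtain ⟨η', hη'⟩ := exists_represents x₀ memLp
  exact ⟨η, η', hη, hη', cont, per, deriv, memLp⟩

theorem of_hasDerivAt {η η' : L2per L} {g g' : ℝ → ℂ} (h : Represents x₀ η g)
    (h' : Represents x₀ η' g') (hd : ∀ x, HasDerivAt g (g' x) x) (hc : Continuous g')
    (per : g (x₀ + L) = g x₀) : IsLift x₀ η η' g g' :=
  ⟨h, h', fun x _ => (hd x).continuousAt.continuousWithinAt, per,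
    fun x _ => (hd x).hasDerivWithinAt, memLp_of_continuousOn hc.continuousOn⟩

theorem exists_of_real {g g' : ℝ → ℝ} (hd : ∀ x, HasDerivAt g (g' x) x) (hc : Continuous g')
    (per : g (x₀ + L) = g x₀) :
    ∃ η η' : L2per L, IsLift x₀ η η' (fun x => (g x : ℂ)) (fun x => (g' x : ℂ)) :=
  exists_of_memLp (fun x _ => (hd x).ofReal_comp.continuousAt.continuousWithinAt)
    (by simp only [per]) (fun x _ => (hd x).ofReal_comp.hasDerivWithinAt)
    (memLp_of_continuousOn (Complex.continuous_ofReal.comp hc).continuousOn)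

end IsLift

theorem isLift_fourier (x₀ : ℝ) (n : ℤ) : IsLift x₀ (fourierBasis (T := L) n)
    ((Complex.I * (waveNumber L n : ℂ)) • fourierBasis (T := L) n)
    (fun x => fourier n (x : AddCircle L))
    (fun x => (Complex.I * (waveNumber L n : ℂ)) * fourier n (x : AddCircle L)) := by
  refine IsLift.of_hasDerivAt (represents_fourierBasis x₀ n) ((represents_fourierBasis x₀ n).smul _)
    (fun x => ?_) ?_ (by simp)
  · refine (hasDerivAt_fourier L n x).congr_deriv ?_
    simp only [waveNumber]; push_cast; ring
  · exact continuous_const.mul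
      ((map_continuous (fourier n)).comp (AddCircle.continuous_mk' _))

theorem exists_isLift_resolventFour (x₀ : ℝ) (v : L2per L) :
    ∃ (u' : L2per L) (U U' : ℝ → ℂ), IsLift x₀ (resolventFour L v) u' U U' ∧
      (∀ x, HasDerivAt U (U' x) x) ∧ Continuous U' := by
  obtain ⟨U, U', hU, -, hd⟩ := exists_hasDerivAt_resolventFour v
  have hc : Continuous fun x : ℝ => U' (x : AddCircle L) :=
    U'.continuous.comp (AddCircle.continuous_mk' _)
  refine ⟨ContinuousMap.toLp 2 haarAddCircle ℂ U', _, _,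
    IsLift.of_hasDerivAt (hU ▸ represents_toLp x₀ U) (represents_toLp x₀ U') hd hc (by simp),
    hd, hc⟩

theorem Represents.eq_zero {g : ℝ → ℂ} (h : Represents x₀ (0 : L2per L) g)
    (hg : ContinuousOn g (Set.Icc x₀ (x₀ + L))) : ∀ x ∈ Set.Ioc x₀ (x₀ + L), g x = 0 := by
  have h1 : ∀ᵐ x : ℝ ∂(volume.restrict (Set.Ioc x₀ (x₀ + L))), g x = 0 := by
    filter_upwards [h, ae_restrict_of_ae_haar (Lp.coeFn_zero ℂ 2 haarAddCircle)] with x h2 h3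
    rw [← h2, h3, Pi.zero_apply]
  exact Measure.eqOn_Ioc_of_ae_eq volume h1 (hg.mono Set.Ioc_subset_Icc_self) continuousOn_const

theorem Represents.unique {v w : L2per L} {g : ℝ → ℂ} (hv : Represents x₀ v g)
    (hw : Represents x₀ w g) : v = w := by
  have h : Represents x₀ (v - w) (fun _ => 0) := by
    have := hv.add (hw.smul (-1))
    rw [neg_one_smul, ← sub_eq_add_neg] at this
    refine this.congr fun x _ => by ring
  have h2 : Inner.inner ℂ (v - w) (v - w) = 0 := by rw [Represents.inner h h]; simp
  exact sub_eq_zero.mp (inner_self_eq_zero.mp h2)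

/-- Integration by parts against a solution of `F'' = q F`. -/
theorem integral_mul_solution {s t : ℝ} (hst : s ≤ t) {g g' : ℝ → ℂ}
    (hg : ContinuousOn g (Set.Icc s t))
    (hd : ∀ x ∈ Set.Ioo s t, HasDerivWithinAt g (g' x) (Set.Ioi x) x)
    (hi : IntervalIntegrable g' volume s t) {F Z q : ℝ → ℝ} (hF : Continuous F)
    (hq : Continuous q) (hZ : Continuous Z)
    (hZd : ∀ x ∈ Set.Ioo s t, HasDerivAt Z (q x * F x) x) :
    ∫ x in s..t, ((starRingEnd ℂ) (g' x) * (Z x : ℂ) +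
      (q x : ℂ) * ((starRingEnd ℂ) (g x) * (F x : ℂ))) =
      (starRingEnd ℂ) (g t) * (Z t : ℂ) - (starRingEnd ℂ) (g s) * (Z s : ℂ) := by
  have hgc : ContinuousOn (fun x => (starRingEnd ℂ) (g x)) (Set.Icc s t) :=
    Complex.continuous_conj.comp_continuousOn hg
  have hZc : Continuous fun x => (Z x : ℂ) := Complex.continuous_ofReal.comp hZ
  have hi' : IntervalIntegrable (fun x => (starRingEnd ℂ) (g' x)) volume s t :=
    ⟨Complex.conjCLE.toContinuousLinearMap.integrable_comp hi.1,
      Complex.conjCLE.toContinuousLinearMap.integrable_comp hi.2⟩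
  refine intervalIntegral.integral_eq_sub_of_hasDeriv_right_of_le hst
    (hgc.mul hZc.continuousOn) (fun x hx => ?_) ?_
  · have h1 : HasDerivWithinAt (fun x => (starRingEnd ℂ) (g x)) ((starRingEnd ℂ) (g' x))
        (Set.Ioi x) x :=
      Complex.conjCLE.toContinuousLinearMap.hasFDerivAt.comp_hasDerivWithinAt x (hd x hx)
    refine (h1.mul (hZd x hx).ofReal_comp.hasDerivWithinAt).congr_deriv ?_
    push_cast
    ring
  · refine (hi'.mul_continuousOn hZc.continuousOn).add (ContinuousOn.intervalIntegrable ?_)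
    rw [Set.uIcc_of_le hst]
    exact (Complex.continuous_ofReal.comp hq).continuousOn.mul
      (hgc.mul (Complex.continuous_ofReal.comp hF).continuousOn)

theorem energyForm_add_right {c : ℝ} {B : L2per L →L[ℂ] L2per L} (η η' ζ ζ' ξ ξ' : L2per L) :
    energyForm c B η η' (ζ + ξ) (ζ' + ξ') =
      energyForm c B η η' ζ ζ' + energyForm c B η η' ξ ξ' := by
  simp only [energyForm, map_add, inner_add_right]; ring

theorem energyForm_smul_right {c : ℝ} {B : L2per L →L[ℂ] L2per L} (η η' ζ ζ' : L2per L) (r : ℂ) :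
    energyForm c B η η' (r • ζ) (r • ζ') = r * energyForm c B η η' ζ ζ' := by
  simp only [energyForm, map_smul, inner_smul_right]; ring

theorem energyForm_conj {c : ℝ} {B : L2per L →L[ℂ] L2per L} (hB : IsSelfAdjoint B)
    (η η' ζ ζ' : L2per L) :
    (starRingEnd ℂ) (energyForm c B η η' ζ ζ') = energyForm c B ζ ζ' η η' := by
  have hsym : inner ℂ (B ζ) η = inner ℂ ζ (B η) := hB.isSymmetric ζ η
  simp only [energyForm, map_add, map_sub, map_mul, inner_conj_symm, hsym, map_ofNat,
    Complex.conj_ofReal]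

namespace IsLift

variable {c : ℝ} {W : C(AddCircle L, ℂ)} {w q : ℝ → ℝ}

theorem energyForm_eq (hW : ∀ x : ℝ, W (x : AddCircle L) = ((w x)⁻¹ : ℝ))
    (hq : ∀ x, q x = 4 - 3 * c / w x) {η η' ζ ζ' : L2per L} {g g' f f' : ℝ → ℂ}
    (hη : IsLift x₀ η η' g g') (hζ : IsLift x₀ ζ ζ' f f') :
    energyForm c (mulOp W) η η' ζ ζ' = (L : ℂ)⁻¹ * ∫ x in x₀..x₀ + L,
      ((starRingEnd ℂ) (g' x) * f' x + (q x : ℂ) * ((starRingEnd ℂ) (g x) * f x)) := by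
  simp_rw [hq]
  refine energyForm_eq_integral hW hη.rep hη.rep' hζ.rep hζ.rep' hη.cont hζ.cont ?_
  rw [intervalIntegrable_iff_integrableOn_Ioc_of_le (le_add_period (L := L) x₀)]
  have h1 : MemLp (fun x => (starRingEnd ℂ) (g' x)) 2 (volume.restrict (Set.Ioc x₀ (x₀ + L))) :=
    hη.memLp.star
  exact h1.integrable_mul hζ.memLp

theorem energyForm_solution (hW : ∀ x : ℝ, W (x : AddCircle L) = ((w x)⁻¹ : ℝ))
    (hq : ∀ x, q x = 4 - 3 * c / w x) (hqc : Continuous q)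
    {η η' ζ ζ' : L2per L} {g g' : ℝ → ℂ} {F Z : ℝ → ℝ}
    (hη : IsLift x₀ η η' g g') (hζ : IsLift x₀ ζ ζ' (fun x => (F x : ℂ)) (fun x => (Z x : ℂ)))
    (hF : Continuous F) (hZ : Continuous Z)
    (hZd : ∀ x ∈ Set.Ioo x₀ (x₀ + L), HasDerivAt Z (q x * F x) x) :
    energyForm c (mulOp W) η η' ζ ζ' =
      (L : ℂ)⁻¹ * ((starRingEnd ℂ) (g x₀) * ((Z (x₀ + L) : ℂ) - (Z x₀ : ℂ))) := by
  rw [hη.energyForm_eq hW hq hζ, integral_mul_solution (le_add_period (L := L) x₀) hη.cont hη.deriv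
    hη.intervalIntegrable hF hqc hZ hZd, hη.per]
  ring

end IsLift

end Lift

/-! ### Energy products with the half wave, the Jacobi field and the periodic solution. -/

section ProfileForm

variable {L : ℝ} [hLf : Fact (0 < L)] {x₀ x₁ τ c : ℝ} {W : C(AddCircle L, ℂ)}
  {w q ψ N y Z : ℝ → ℝ}

/-- The restriction of `ψ` to `[x₀, x₁]`, extended by zero. -/
theorem Profile.exists_isLift_half (P : Profile L x₀ x₁ τ q ψ N y Z) :
    ∃ (χ χ' : L2per L) (f f' : ℝ → ℂ), IsLift x₀ χ χ' f f' ∧ f x₀ = 0 ∧ f x₁ = 0 ∧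
      (∀ x ∈ Set.Ioo x₀ x₁, f x = ψ x ∧ f' x = N x) ∧
      (∀ x ∈ Set.Ioc x₁ (x₀ + L), f x = 0 ∧ f' x = 0) := by
  have h01 := P.lt_left
  have h1L := P.lt_right
  have hcψ : Continuous fun x => (ψ x : ℂ) := Complex.continuous_ofReal.comp P.cont_ψ
  have hcN : Continuous fun x => (N x : ℂ) := Complex.continuous_ofReal.comp P.cont_N
  set f : ℝ → ℂ := fun x => if x ≤ x₁ then (ψ x : ℂ) else 0 with hf
  -- The strict inequality makes this the right derivative also at the corner `x₁`.
  set f' : ℝ → ℂ := fun x => if x < x₁ then (N x : ℂ) else 0 with hf'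
  have hfR : ∀ x, x₁ ≤ x → f x = 0 := by
    intro x hx
    simp only [hf]
    split_ifs with h
    · rw [le_antisymm h hx, P.ψ_mid, Complex.ofReal_zero]
    · rfl
  have hcf : Continuous f := by
    refine Continuous.if_le hcψ continuous_const continuous_id continuous_const fun x hx => ?_
    rw [hx, P.ψ_mid, Complex.ofReal_zero]
  have hd : ∀ x ∈ Set.Ioo x₀ (x₀ + L), HasDerivWithinAt f (f' x) (Set.Ioi x) x := by
    intro x hx
    by_cases h : x < x₁
    · have e : f' x = N x := if_pos h
      rw [e]
      refine HasDerivAt.hasDerivWithinAt ?_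
      refine (P.deriv_ψ x).ofReal_comp.congr_of_eventuallyEq ?_
      filter_upwards [Iio_mem_nhds h] with t ht
      exact if_pos ht.le
    · have e : f' x = 0 := if_neg h
      rw [e]
      push Not at h
      exact (hasDerivWithinAt_const x _ (0 : ℂ)).congr (fun t ht => hfR t (h.trans (le_of_lt ht)))
        (hfR x h)
  have hmem : MemLp f' 2 (volume.restrict (Set.Ioc x₀ (x₀ + L))) :=
    MemLp.indicator (s := Set.Iio x₁) measurableSet_Iio (memLp_of_continuousOn hcN.continuousOn)
  have f0 : f x₀ = 0 := by
    simp only [hf, if_pos h01.le, P.ψ_left, Complex.ofReal_zero]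
  obtain ⟨χ, χ', hχ⟩ := IsLift.exists_of_memLp hcf.continuousOn
    ((hfR _ h1L.le).trans f0.symm) hd hmem
  refine ⟨χ, χ', f, f', hχ, f0, hfR _ le_rfl, fun x hx => ⟨if_pos hx.2.le, if_pos hx.2⟩,
    fun x hx => ⟨hfR _ hx.1.le, if_neg (not_lt.mpr hx.1.le)⟩⟩

/-- Energy products with the restriction of `ψ` to `[x₀, x₁]`. -/
theorem Profile.energyForm_half (P : Profile L x₀ x₁ τ q ψ N y Z)
    (hW : ∀ x : ℝ, W (x : AddCircle L) = ((w x)⁻¹ : ℝ)) (hq : ∀ x, q x = 4 - 3 * c / w x)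
    {χ χ' η η' : L2per L} {f f' g g' : ℝ → ℂ} (hχ : IsLift x₀ χ χ' f f')
    (hleft : ∀ x ∈ Set.Ioo x₀ x₁, f x = ψ x ∧ f' x = N x)
    (hright : ∀ x ∈ Set.Ioc x₁ (x₀ + L), f x = 0 ∧ f' x = 0) (hη : IsLift x₀ η η' g g') :
    energyForm c (mulOp W) η η' χ χ' =
      (L : ℂ)⁻¹ * ((starRingEnd ℂ) (g x₁) * (N x₁ : ℂ) - (starRingEnd ℂ) (g x₀) * (N x₀ : ℂ)) := by
  have h01 := P.lt_left
  have h1L := P.lt_right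
  rw [hη.energyForm_eq hW hq hχ]
  congr 1
  set F : ℝ → ℂ := fun x => (starRingEnd ℂ) (g' x) * f' x +
    (q x : ℂ) * ((starRingEnd ℂ) (g x) * f x) with hF
  have hsub : Set.Icc x₀ x₁ ⊆ Set.Icc x₀ (x₀ + L) := Set.Icc_subset_Icc_right h1L.le
  have hi : IntervalIntegrable g' volume x₀ x₁ :=
    hη.intervalIntegrable.mono_set (by
      rw [Set.uIcc_of_le h01.le, Set.uIcc_of_le (h01.trans h1L).le]; exact hsub)
  have hi' : IntervalIntegrable (fun x => (starRingEnd ℂ) (g' x)) volume x₀ x₁ :=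
    ⟨Complex.conjCLE.toContinuousLinearMap.integrable_comp hi.1,
      Complex.conjCLE.toContinuousLinearMap.integrable_comp hi.2⟩
  have hsol := integral_mul_solution h01.le (hη.cont.mono hsub)
    (fun x hx => hη.deriv x ⟨hx.1, hx.2.trans h1L⟩) hi P.cont_ψ P.cont_q P.cont_N
    (fun x _ => P.deriv_N x)
  set G : ℝ → ℂ := fun x => (starRingEnd ℂ) (g' x) * (N x : ℂ) +
      (q x : ℂ) * ((starRingEnd ℂ) (g x) * (ψ x : ℂ)) with hG
  have hGi : IntervalIntegrable G volume x₀ x₁ := by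
    refine (hi'.mul_continuousOn
      (Complex.continuous_ofReal.comp P.cont_N).continuousOn).add
      (ContinuousOn.intervalIntegrable ?_)
    rw [Set.uIcc_of_le h01.le]
    exact (Complex.continuous_ofReal.comp P.cont_q).continuousOn.mul
      ((Complex.continuous_conj.comp_continuousOn (hη.cont.mono hsub)).mul
        (Complex.continuous_ofReal.comp P.cont_ψ).continuousOn)
  have e1 : Set.EqOn F G (Set.Ioo x₀ x₁) := fun x hx => by
    simp only [hF, hG, (hleft x hx).1, (hleft x hx).2]
  have e2 : Set.EqOn F (fun _ => 0) (Set.Ioc x₁ (x₀ + L)) := fun x hx => by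
    simp only [hF, (hright x hx).1, (hright x hx).2]; ring
  have i1 : IntervalIntegrable F volume x₀ x₁ := by
    refine (intervalIntegrable_iff_integrableOn_Ioo_of_le h01.le).mpr ?_
    exact ((intervalIntegrable_iff_integrableOn_Ioo_of_le h01.le).mp hGi).congr_fun e1.symm
      measurableSet_Ioo
  have i2 : IntervalIntegrable F volume x₁ (x₀ + L) := by
    refine (intervalIntegrable_iff_integrableOn_Ioc_of_le h1L.le).mpr ?_
    exact integrableOn_zero.congr_fun e2.symm measurableSet_Ioc
  rw [← intervalIntegral.integral_add_adjacent_intervals i1 i2,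
    intervalIntegral.integral_of_le h1L.le, setIntegral_congr_fun measurableSet_Ioc e2,
    integral_zero, add_zero, intervalIntegral.integral_of_le h01.le, integral_Ioc_eq_integral_Ioo,
    setIntegral_congr_fun measurableSet_Ioo e1, ← integral_Ioc_eq_integral_Ioo,
    ← intervalIntegral.integral_of_le h01.le, hsol]

/-- Integration by parts leaves only the jump of `y'`, so the product sees `g` through its value at
`x₀` alone and vanishes identically when `τ = 0`. -/
theorem Profile.energyForm_jacobi (P : Profile L x₀ x₁ τ q ψ N y Z)
    (hW : ∀ x : ℝ, W (x : AddCircle L) = ((w x)⁻¹ : ℝ)) (hq : ∀ x, q x = 4 - 3 * c / w x)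
    {ζ ζ' η η' : L2per L} {g g' : ℝ → ℂ}
    (hζ : IsLift x₀ ζ ζ' (fun x => (y x : ℂ)) (fun x => (Z x : ℂ))) (hη : IsLift x₀ η η' g g') :
    energyForm c (mulOp W) η η' ζ ζ' =
      -((L : ℂ)⁻¹ * (N x₀ : ℂ) * (τ : ℂ)) * (starRingEnd ℂ) (g x₀) := by
  rw [hη.energyForm_solution hW hq P.cont_q hζ P.cont_y P.cont_Z P.deriv_Z, P.Z_left, P.Z_right]
  push_cast
  ring

theorem Profile.energyForm_periodic (P : Profile L x₀ x₁ τ q ψ N y Z)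
    (hW : ∀ x : ℝ, W (x : AddCircle L) = ((w x)⁻¹ : ℝ)) (hq : ∀ x, q x = 4 - 3 * c / w x)
    {ζ ζ' η η' : L2per L} {g g' : ℝ → ℂ}
    (hζ : IsLift x₀ ζ ζ' (fun x => (ψ x : ℂ)) (fun x => (N x : ℂ))) (hη : IsLift x₀ η η' g g') :
    energyForm c (mulOp W) η η' ζ ζ' = 0 := by
  rw [hη.energyForm_solution hW hq P.cont_q hζ P.cont_ψ P.cont_N (fun x _ => P.deriv_N x),
    P.N_right, sub_self, mul_zero, mul_zero]

/-- The energy on functions orthogonal to the half of `ψ`, with the case of equality. -/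
theorem Profile.energyForm_ge (P : Profile L x₀ x₁ τ q ψ N y Z)
    (hW : ∀ x : ℝ, W (x : AddCircle L) = ((w x)⁻¹ : ℝ)) (hq : ∀ x, q x = 4 - 3 * c / w x)
    {u u' : L2per L} {U U' : ℝ → ℂ} (hu : IsLift x₀ u u' U U')
    (hd : ∀ x, HasDerivAt U (U' x) x) (hc : Continuous U')
    (hcond : (N x₁ : ℂ) * U x₁ = (N x₀ : ℂ) * U x₀) :
    -(τ / 2) * (2 * N x₀) ^ 2 * ‖U x₀‖ ^ 2 ≤ L * (energyForm c (mulOp W) u u' u u').re ∧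
      (L * (energyForm c (mulOp W) u u' u u').re = -(τ / 2) * (2 * N x₀) ^ 2 * ‖U x₀‖ ^ 2 →
        ∃ k : ℂ, ∀ x ∈ Set.Icc x₀ (x₀ + L),
          U x = 2 * (N x₀ : ℂ) * U x₀ * (y x : ℂ) + k * (ψ x : ℂ)) := by
  have hL : (0 : ℝ) < L := Fact.out
  have hre : ∀ x, HasDerivAt (fun x => (U x).re) (U' x).re x := fun x =>
    Complex.reCLM.hasFDerivAt.comp_hasDerivAt x (hd x)
  have him : ∀ x, HasDerivAt (fun x => (U x).im) (U' x).im x := fun x =>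
    Complex.imCLM.hasFDerivAt.comp_hasDerivAt x (hd x)
  have cre' : Continuous fun x => (U' x).re := Complex.continuous_re.comp hc
  have cim' : Continuous fun x => (U' x).im := Complex.continuous_im.comp hc
  have cre : Continuous fun x => (U x).re :=
    continuous_iff_continuousAt.mpr fun x => (hre x).continuousAt
  have cim : Continuous fun x => (U x).im :=
    continuous_iff_continuousAt.mpr fun x => (him x).continuousAt
  have hqc := P.cont_q
  have c1 := congrArg Complex.re hcond
  have c2 := congrArg Complex.im hcond
  rw [Complex.re_ofReal_mul, Complex.re_ofReal_mul] at c1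
  rw [Complex.im_ofReal_mul, Complex.im_ofReal_mul] at c2
  obtain ⟨g1, k1⟩ := P.form_ge hre cre' (congrArg Complex.re hu.per) c1
  obtain ⟨g2, k2⟩ := P.form_ge him cim' (congrArg Complex.im hu.per) c2
  have hE : L * (energyForm c (mulOp W) u u' u u').re =
      (∫ x in x₀..x₀ + L, ((U' x).re ^ 2 + q x * (U x).re ^ 2)) +
        ∫ x in x₀..x₀ + L, ((U' x).im ^ 2 + q x * (U x).im ^ 2) := by
    rw [← intervalIntegral.integral_add (Continuous.intervalIntegrable (by fun_prop) _ _)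
      (Continuous.intervalIntegrable (by fun_prop) _ _), hu.energyForm_eq hW hq hu]
    have e : ∀ x, (starRingEnd ℂ) (U' x) * U' x + (q x : ℂ) * ((starRingEnd ℂ) (U x) * U x) =
        (((U' x).re ^ 2 + q x * (U x).re ^ 2 + ((U' x).im ^ 2 + q x * (U x).im ^ 2) : ℝ) : ℂ) := by
      intro x
      rw [← Complex.normSq_eq_conj_mul_self, ← Complex.normSq_eq_conj_mul_self,
        Complex.normSq_apply, Complex.normSq_apply]
      push_cast
      ring
    simp_rw [e]
    rw [intervalIntegral.integral_ofReal, ← Complex.ofReal_inv, ← Complex.ofReal_mul,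
      Complex.ofReal_re, mul_inv_cancel_left₀ hL.ne']
  have hn : ‖U x₀‖ ^ 2 = (U x₀).re ^ 2 + (U x₀).im ^ 2 := by
    rw [← Complex.normSq_eq_norm_sq, Complex.normSq_apply]; ring
  rw [hE, hn]
  refine ⟨by linarith, fun heq => ?_⟩
  obtain ⟨k, hk⟩ := k1 (by linarith)
  obtain ⟨k', hk'⟩ := k2 (by linarith)
  refine ⟨⟨k, k'⟩, fun x hx => ?_⟩
  apply Complex.ext
  · rw [hk x hx]; simp
  · rw [hk' x hx]; simp

end ProfileForm

/-- Negativity off `0` already makes `F` injective, so its range is an `n`-dimensional negative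
subspace. -/
theorem le_rank_negSpace {H : Type*} [NormedAddCommGroup H] [InnerProductSpace ℂ H]
    [CompleteSpace H] {A K : H →L[ℂ] H} (hT : IsSelfAdjoint (A - K)) (hK : IsCompactOperator K)
    (hA : ∀ r : ℝ, r < 0 → IsUnit (A - algebraMap ℂ (H →L[ℂ] H) (r : ℂ))) {n : ℕ}
    (F : (Fin n → ℂ) →ₗ[ℂ] H) (hF : ∀ x, x ≠ 0 → (inner ℂ (F x) ((A - K) (F x))).re < 0) :
    (n : Cardinal) ≤ Module.rank ℂ (negSpace (A - K)) := by
  have hinj : Function.Injective F := by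
    refine (injective_iff_map_eq_zero F).mpr fun x hx => ?_
    by_contra h0
    have := hF x h0
    rw [hx] at this
    simp at this
  have h1 := rank_le_rank_negSpace hT hK hA (LinearMap.range F) (by
    rintro _ ⟨x, rfl⟩ h0
    exact hF x fun h => h0 (by rw [h, map_zero]))
  rwa [← Module.finrank_eq_rank, LinearMap.finrank_range_of_inj hinj, Module.finrank_fin_fun] at h1

/-! ### Eigenvalue counts and the kernel from the energy form. -/

section Count

variable {L : ℝ} [hLf : Fact (0 < L)] {x₀ x₁ τ c : ℝ} {A : L2per L →L[ℂ] L2per L}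
  {W : C(AddCircle L, ℂ)} {w q ψ N y Z : ℝ → ℝ}

/-- The functional `v ↦ ⟨η, v - 3 c B K v⟩`. -/
noncomputable def energyFunctional (c : ℝ) (B : L2per L →L[ℂ] L2per L) (η : L2per L) :
    L2per L →ₗ[ℂ] ℂ :=
  ((innerSL ℂ η).comp (1 - ((3 * c : ℝ) : ℂ) • (B * resolventFour L))).toLinearMap

theorem energyFunctional_apply {B : L2per L →L[ℂ] L2per L} {η η' v u' : L2per L}
    (hη : IsWeakDeriv η η') (hu : IsWeakDeriv (resolventFour L v) u') :
    energyFunctional c B η v = energyForm c B η η' (resolventFour L v) u' := by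
  rw [energyForm_resolventFour hη hu]
  change inner ℂ η (v - ((3 * c : ℝ) : ℂ) • B (resolventFour L v)) = _
  rw [inner_sub_right, inner_smul_right]
  push_cast
  ring

/-- The span of two functions orthogonal for the energy form, with negative energy on the first. -/
theorem re_inner_combination_neg {B : L2per L →L[ℂ] L2per L} (hB : IsSelfAdjoint B)
    (hAB : A * B = 1) (hc : 0 < c)
    {η η' ζ ζ' : L2per L} (hη : IsWeakDeriv η η') (hζ : IsWeakDeriv ζ ζ')
    (h12 : energyForm c B η η' ζ ζ' = 0) (r s : ℂ)
    (hneg : ‖r‖ ^ 2 * (energyForm c B η η' η η').re + ‖s‖ ^ 2 * (energyForm c B ζ ζ' ζ ζ').re < 0) :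
    (inner ℂ (r • (((3 * c : ℝ) : ℂ) • B η) + s • (((3 * c : ℝ) : ℂ) • B ζ))
      ((A - ((3 * c : ℝ) : ℂ) • resolventFour L)
        (r • (((3 * c : ℝ) : ℂ) • B η) + s • (((3 * c : ℝ) : ℂ) • B ζ)))).re < 0 := by
  have e1 : r • (((3 * c : ℝ) : ℂ) • B η) + s • (((3 * c : ℝ) : ℂ) • B ζ) =
      ((3 * c : ℝ) : ℂ) • B (r • η + s • ζ) := by
    rw [map_add, map_smul, map_smul, smul_add, smul_comm r, smul_comm s]
  rw [e1]
  refine (re_inner_le_energyForm hAB hc ((hη.smul r).add (hζ.smul s))).trans_lt ?_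
  have h21 : energyForm c B ζ ζ' η η' = 0 := by rw [← energyForm_conj hB, h12, map_zero]
  have e2 : energyForm c B (r • η + s • ζ) (r • η' + s • ζ') (r • η + s • ζ) (r • η' + s • ζ') =
      ((‖r‖ ^ 2 : ℝ) : ℂ) * energyForm c B η η' η η' +
        ((‖s‖ ^ 2 : ℝ) : ℂ) * energyForm c B ζ ζ' ζ ζ' := by
    have f1 : energyForm c B (r • η + s • ζ) (r • η' + s • ζ') η η' =
        (starRingEnd ℂ) r * energyForm c B η η' η η' := by
      rw [← energyForm_conj hB, energyForm_add_right, energyForm_smul_right,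
        energyForm_smul_right, h12, mul_zero, add_zero, map_mul, energyForm_conj hB]
    have f2 : energyForm c B (r • η + s • ζ) (r • η' + s • ζ') ζ ζ' =
        (starRingEnd ℂ) s * energyForm c B ζ ζ' ζ ζ' := by
      rw [← energyForm_conj hB, energyForm_add_right, energyForm_smul_right,
        energyForm_smul_right, h21, mul_zero, zero_add, map_mul, energyForm_conj hB]
    rw [energyForm_add_right, energyForm_smul_right, energyForm_smul_right, f1, f2, ← mul_assoc,
      ← mul_assoc, Complex.mul_conj, Complex.mul_conj, Complex.normSq_eq_norm_sq,
      Complex.normSq_eq_norm_sq]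
  rw [e2, Complex.add_re, Complex.re_ofReal_mul, Complex.re_ofReal_mul]
  exact mul_neg_of_pos_of_neg (by linarith) hneg

/-- A direction of negative energy, orthogonal to the Jacobi field `y`. -/
theorem Profile.exists_neg_direction (P : Profile L x₀ x₁ τ q ψ N y Z)
    (hW : ∀ x : ℝ, W (x : AddCircle L) = ((w x)⁻¹ : ℝ)) (hq : ∀ x, q x = 4 - 3 * c / w x)
    (hB : IsSelfAdjoint (mulOp W)) {ζ ζ' : L2per L}
    (hζ : IsLift x₀ ζ ζ' (fun x => (y x : ℂ)) (fun x => (Z x : ℂ))) :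
    ∃ η η' : L2per L, IsWeakDeriv η η' ∧ (energyForm c (mulOp W) η η' η η').re < 0 ∧
      energyForm c (mulOp W) η η' ζ ζ' = 0 := by
  have hL : (0 : ℝ) < L := Fact.out
  obtain ⟨χ, χ', f, f', hχ, f0, f1, hleft, hright⟩ := P.exists_isLift_half
  -- Subtracting `2 N(x₀) y` from the constant `1` gives a function vanishing at `x₀`, hence
  -- energy-orthogonal to `y`, whose product with the half wave is still nonzero: `e < 0`.
  obtain ⟨p, p', hp⟩ := IsLift.exists_of_real (L := L) (x₀ := x₀)
    (g := fun x => 1 - 2 * N x₀ * y x) (g' := fun x => -(2 * N x₀ * Z x))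
    (fun x => ((P.deriv_y x).const_mul _).const_sub 1) (by have := P.cont_Z; fun_prop)
    (by simp only [P.y_right])
  have p0 : 1 - 2 * N x₀ * y x₀ = 0 := by linear_combination (-2) * P.y_left
  have p1 : (1 - 2 * N x₀ * y x₁) * N x₁ = N x₁ - N x₀ := by
    linear_combination (-2 * N x₀) * P.y_mid
  set e : ℝ := L⁻¹ * (N x₁ - N x₀) with he
  have he0 : e < 0 := mul_neg_of_pos_of_neg (inv_pos.mpr hL) (by linarith [P.N_left, P.N_mid])
  have hpχ : energyForm c (mulOp W) p p' χ χ' = (e : ℂ) := by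
    rw [P.energyForm_half hW hq hχ hleft hright hp, p0, Complex.conj_ofReal, ← Complex.ofReal_mul,
      p1, he]
    push_cast
    simp
  have hχχ : energyForm c (mulOp W) χ χ' χ χ' = 0 := by
    rw [P.energyForm_half hW hq hχ hleft hright hχ, f0, f1]
    simp
  have hχp : energyForm c (mulOp W) χ χ' p p' = (e : ℂ) := by
    rw [← energyForm_conj hB, hpχ, Complex.conj_ofReal]
  set M := (energyForm c (mulOp W) p p' p p').re with hM
  -- As the half wave has zero energy, the perturbed energy is `2εe + ε²M`; this `ε` makes the
  -- quadratic term smaller than half of the linear one.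
  set ε : ℝ := -e / (|M| + 1) with hε
  have hM1 : 0 < |M| + 1 := by positivity
  have hε0 : 0 < ε := div_pos (by linarith) hM1
  have hη := hχ.add (hp.smul (ε : ℂ))
  refine ⟨_, _, hη.isWeakDeriv, ?_, ?_⟩
  · have g1 : energyForm c (mulOp W) (χ + (ε : ℂ) • p) (χ' + (ε : ℂ) • p') χ χ' = (ε * e : ℝ) := by
      rw [← energyForm_conj hB, energyForm_add_right, energyForm_smul_right, hχχ, hχp]
      simp
    have g2 : energyForm c (mulOp W) (χ + (ε : ℂ) • p) (χ' + (ε : ℂ) • p') p p' =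
        (e : ℂ) + ε * energyForm c (mulOp W) p p' p p' := by
      rw [← energyForm_conj hB, energyForm_add_right, energyForm_smul_right, hpχ, map_add, map_mul,
        Complex.conj_ofReal, Complex.conj_ofReal, energyForm_conj hB]
    rw [energyForm_add_right, energyForm_smul_right, g1, g2, Complex.add_re, Complex.re_ofReal_mul,
      Complex.add_re, Complex.re_ofReal_mul, Complex.ofReal_re, Complex.ofReal_re, ← hM]
    have h1 : ε * (|M| + 1) = -e := div_mul_cancel₀ _ hM1.ne'
    nlinarith [le_abs_self M, mul_le_mul_of_nonneg_left (le_abs_self M) hε0.le]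
  · rw [P.energyForm_jacobi hW hq hζ hη, f0, p0]
    simp

/-- The operator `A - 3 c (4 - ∂²)⁻¹` in which `A` is a nonnegative invertible multiplication
operator, and the potential `q = 4 - 3 c / w` of the associated Hill equation. -/
structure IsWaveOperator (c : ℝ) (A : L2per L →L[ℂ] L2per L) (W : C(AddCircle L, ℂ))
    (w q : ℝ → ℝ) : Prop where
  pos : 0 < c
  inv_eq : ∀ x : ℝ, W (x : AddCircle L) = ((w x)⁻¹ : ℝ)
  potential_eq : ∀ x, q x = 4 - 3 * c / w x
  selfAdjoint : IsSelfAdjoint A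
  selfAdjoint_inv : IsSelfAdjoint (mulOp W)
  mul_inv : A * mulOp W = 1
  inv_mul : mulOp W * A = 1
  nonneg : ∀ v, 0 ≤ (inner ℂ v (A v)).re

/-- A linear condition making the energy of the resolvent at least that of its Jacobi component. -/
theorem Profile.exists_condition (P : Profile L x₀ x₁ τ q ψ N y Z)
    (S : IsWaveOperator c A W w q) :
    ∃ χ χ' : L2per L, IsWeakDeriv χ χ' ∧ ∀ {u u' : L2per L} {U U' : ℝ → ℂ},
      IsLift x₀ u u' U U' → energyForm c (mulOp W) χ χ' u u' = 0 →
        (N x₁ : ℂ) * U x₁ = (N x₀ : ℂ) * U x₀ := by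
  have hL : (0 : ℝ) < L := Fact.out
  obtain ⟨χ, χ', f, f', hχ, -, -, hleft, hright⟩ := P.exists_isLift_half
  refine ⟨χ, χ', hχ.isWeakDeriv, fun {u u' U U'} hu h => ?_⟩
  have h1 := P.energyForm_half S.inv_eq S.potential_eq hχ hleft hright hu
  rw [← energyForm_conj S.selfAdjoint_inv, h, map_zero, eq_comm, mul_eq_zero] at h1
  have h2 := congrArg (starRingEnd ℂ)
    (h1.resolve_left (inv_ne_zero (Complex.ofReal_ne_zero.mpr hL.ne')))
  simp only [map_sub, map_mul, Complex.conj_conj, Complex.conj_ofReal, map_zero] at h2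
  linear_combination h2

/-- Orthogonality to `y` means `τ = 0` or `U x₀ = 0`; in either case the negative term in the lower
bound for the energy disappears. -/
theorem Profile.mul_eq_zero_of_energyForm (P : Profile L x₀ x₁ τ q ψ N y Z)
    (S : IsWaveOperator c A W w q) {ζ ζ' u u' : L2per L} {U U' : ℝ → ℂ}
    (hζ : IsLift x₀ ζ ζ' (fun x => (y x : ℂ)) (fun x => (Z x : ℂ))) (hu : IsLift x₀ u u' U U')
    (h : energyForm c (mulOp W) ζ ζ' u u' = 0) : (τ : ℂ) * U x₀ = 0 := by
  have hL : (0 : ℝ) < L := Fact.out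
  have h1 := P.energyForm_jacobi S.inv_eq S.potential_eq hζ hu
  rw [← energyForm_conj S.selfAdjoint_inv, h, map_zero] at h1
  have hL' : (L : ℂ) ≠ 0 := Complex.ofReal_ne_zero.mpr hL.ne'
  have hN : (N x₀ : ℂ) ≠ 0 := Complex.ofReal_ne_zero.mpr P.N_left.ne'
  have h2 := congrArg (starRingEnd ℂ) h1
  simp only [map_neg, map_mul, map_inv₀, Complex.conj_conj, Complex.conj_ofReal, map_zero] at h2
  have h3 : ((L : ℂ)⁻¹ * N x₀) * (τ * U x₀) = 0 := by linear_combination h2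
  exact (mul_eq_zero.mp h3).resolve_left (mul_ne_zero (inv_ne_zero hL') hN)

theorem Profile.re_inner_nonneg (P : Profile L x₀ x₁ τ q ψ N y Z)
    (S : IsWaveOperator c A W w q) {v u' : L2per L} {U U' : ℝ → ℂ}
    (hu : IsLift x₀ (resolventFour L v) u' U U') (hd : ∀ x, HasDerivAt U (U' x) x)
    (hc : Continuous U') (hcond : (N x₁ : ℂ) * U x₁ = (N x₀ : ℂ) * U x₀)
    (hτ : τ * ‖U x₀‖ ^ 2 ≤ 0) :
    0 ≤ (inner ℂ v ((A - ((3 * c : ℝ) : ℂ) • resolventFour L) v)).re := by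
  have hL : (0 : ℝ) < L := Fact.out
  have h1 := (P.energyForm_ge S.inv_eq S.potential_eq hu hd hc hcond).1
  rw [inner_sub_resolventFour S.selfAdjoint S.mul_inv hu.isWeakDeriv, Complex.add_re,
    show ∀ z : ℂ, 3 * (c : ℂ) * z = ((3 * c : ℝ) : ℂ) * z from fun z => by push_cast; ring,
    Complex.re_ofReal_mul]
  refine add_nonneg (S.nonneg _) (mul_nonneg (by linarith [S.pos]) ?_)
  refine nonneg_of_mul_nonneg_right (le_trans ?_ h1) hL
  nlinarith [mul_nonneg (sq_nonneg (2 * N x₀)) (neg_nonneg.mpr hτ)]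

theorem Profile.rank_negSpace_le_one (P : Profile L x₀ x₁ τ q ψ N y Z)
    (S : IsWaveOperator c A W w q) (hT : IsSelfAdjoint (A - ((3 * c : ℝ) : ℂ) • resolventFour L))
    (hτ : τ ≤ 0) :
    Module.rank ℂ (negSpace (A - ((3 * c : ℝ) : ℂ) • resolventFour L)) ≤ 1 := by
  obtain ⟨χ, χ', hχ, hcond⟩ := P.exists_condition S
  have := rank_negSpace_le_of_functional (n := 1) hT
    (LinearMap.pi fun _ => energyFunctional c (mulOp W) χ) fun v hv => by
      obtain ⟨u', U, U', hu, hd, hc⟩ := exists_isLift_resolventFour x₀ v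
      have h1 : energyFunctional c (mulOp W) χ v = 0 := congrFun hv 0
      rw [energyFunctional_apply hχ hu.isWeakDeriv] at h1
      exact P.re_inner_nonneg S hu hd hc (hcond hu h1)
        (mul_nonpos_of_nonpos_of_nonneg hτ (sq_nonneg _))
  simpa using this

/-- No sign of `τ` is needed here: the second functional, pairing with `y`, kills the term that
could be negative. -/
theorem Profile.rank_negSpace_le_two (P : Profile L x₀ x₁ τ q ψ N y Z)
    (S : IsWaveOperator c A W w q) (hT : IsSelfAdjoint (A - ((3 * c : ℝ) : ℂ) • resolventFour L))
    {ζ ζ' : L2per L} (hζ : IsLift x₀ ζ ζ' (fun x => (y x : ℂ)) (fun x => (Z x : ℂ))) :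
    Module.rank ℂ (negSpace (A - ((3 * c : ℝ) : ℂ) • resolventFour L)) ≤ 2 := by
  obtain ⟨χ, χ', hχ, hcond⟩ := P.exists_condition S
  have := rank_negSpace_le_of_functional (n := 2) hT
    (LinearMap.pi ![energyFunctional c (mulOp W) χ, energyFunctional c (mulOp W) ζ])
    fun v hv => by
      obtain ⟨u', U, U', hu, hd, hc⟩ := exists_isLift_resolventFour x₀ v
      have h1 : energyFunctional c (mulOp W) χ v = 0 := congrFun hv 0
      have h2 : energyFunctional c (mulOp W) ζ v = 0 := congrFun hv 1
      rw [energyFunctional_apply hχ hu.isWeakDeriv] at h1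
      rw [energyFunctional_apply hζ.isWeakDeriv hu.isWeakDeriv] at h2
      have h3 := P.mul_eq_zero_of_energyForm S hζ hu h2
      refine P.re_inner_nonneg S hu hd hc (hcond hu h1) (le_of_eq ?_)
      rcases mul_eq_zero.mp h3 with h | h
      · rw [Complex.ofReal_eq_zero.mp h, zero_mul]
      · rw [h, norm_zero]; ring
  simpa using this

theorem Profile.one_le_rank_negSpace (P : Profile L x₀ x₁ τ q ψ N y Z)
    (S : IsWaveOperator c A W w q) (hT : IsSelfAdjoint (A - ((3 * c : ℝ) : ℂ) • resolventFour L))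
    (hK : IsCompactOperator (((3 * c : ℝ) : ℂ) • resolventFour L))
    (hA : ∀ r : ℝ, r < 0 → IsUnit (A - algebraMap ℂ (L2per L →L[ℂ] L2per L) (r : ℂ)))
    {ζ ζ' : L2per L} (hζ : IsLift x₀ ζ ζ' (fun x => (y x : ℂ)) (fun x => (Z x : ℂ))) :
    1 ≤ Module.rank ℂ (negSpace (A - ((3 * c : ℝ) : ℂ) • resolventFour L)) := by
  obtain ⟨η, η', hη, hneg, horth⟩ :=
    P.exists_neg_direction S.inv_eq S.potential_eq S.selfAdjoint_inv hζ
  have := le_rank_negSpace hT hK hA (n := 1)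
    ((LinearMap.proj 0).smulRight (((3 * c : ℝ) : ℂ) • mulOp W η)) fun x hx => by
      have hx0 : x 0 ≠ 0 := fun h => hx (by ext i; rw [Subsingleton.elim i 0, h]; rfl)
      have h1 := re_inner_combination_neg S.selfAdjoint_inv S.mul_inv S.pos hη hζ.isWeakDeriv
        horth (x 0) 0 (by
          rw [norm_zero, zero_pow two_ne_zero, zero_mul, add_zero]
          exact mul_neg_of_pos_of_neg (by positivity) hneg)
      rw [zero_smul, add_zero] at h1
      exact h1
  simpa using this

theorem Profile.two_le_rank_negSpace (P : Profile L x₀ x₁ τ q ψ N y Z)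
    (S : IsWaveOperator c A W w q) (hT : IsSelfAdjoint (A - ((3 * c : ℝ) : ℂ) • resolventFour L))
    (hK : IsCompactOperator (((3 * c : ℝ) : ℂ) • resolventFour L))
    (hA : ∀ r : ℝ, r < 0 → IsUnit (A - algebraMap ℂ (L2per L →L[ℂ] L2per L) (r : ℂ)))
    {ζ ζ' : L2per L} (hζ : IsLift x₀ ζ ζ' (fun x => (y x : ℂ)) (fun x => (Z x : ℂ)))
    (hτ : 0 < τ) :
    2 ≤ Module.rank ℂ (negSpace (A - ((3 * c : ℝ) : ℂ) • resolventFour L)) := by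
  have hL : (0 : ℝ) < L := Fact.out
  obtain ⟨η, η', hη, hneg, horth⟩ :=
    P.exists_neg_direction S.inv_eq S.potential_eq S.selfAdjoint_inv hζ
  -- `E(y,y) = -τ/(2L)`, from `N(x₀) y(x₀) = 1/2`; for `τ > 0` this adds a second negative direction
  -- orthogonal to the first.
  have hζζ : (energyForm c (mulOp W) ζ ζ' ζ ζ').re < 0 := by
    rw [P.energyForm_jacobi S.inv_eq S.potential_eq hζ hζ, Complex.conj_ofReal,
      ← Complex.ofReal_inv, ← Complex.ofReal_mul, ← Complex.ofReal_mul, ← Complex.ofReal_neg,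
      ← Complex.ofReal_mul, Complex.ofReal_re]
    have h1 : -(L⁻¹ * N x₀ * τ) * y x₀ = -(L⁻¹ * τ * (1 / 2)) := by
      linear_combination (-L⁻¹ * τ) * P.y_left
    rw [h1]
    have := inv_pos.mpr hL
    exact neg_neg_of_pos (by positivity)
  have := le_rank_negSpace hT hK hA (n := 2)
    ((LinearMap.proj 0).smulRight (((3 * c : ℝ) : ℂ) • mulOp W η) +
      (LinearMap.proj 1).smulRight (((3 * c : ℝ) : ℂ) • mulOp W ζ)) fun x hx => by
      refine re_inner_combination_neg S.selfAdjoint_inv S.mul_inv S.pos hη hζ.isWeakDeriv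
        horth (x 0) (x 1) ?_
      by_cases h0 : x 0 = 0
      · have h1 : x 1 ≠ 0 := fun h1 => hx (by ext i; fin_cases i; exacts [h0, h1])
        rw [h0, norm_zero, zero_pow two_ne_zero, zero_mul, zero_add]
        exact mul_neg_of_pos_of_neg (by positivity) hζζ
      · exact add_neg_of_neg_of_nonpos (mul_neg_of_pos_of_neg (by positivity) hneg)
          (mul_nonpos_of_nonneg_of_nonpos (sq_nonneg _) hζζ.le)
  simpa using this

/-- Null vectors are combinations of the periodic solution and, if it is periodic as well, the
Jacobi field. -/
theorem Profile.exists_eq_of_apply_eq_zero (P : Profile L x₀ x₁ τ q ψ N y Z)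
    (S : IsWaveOperator c A W w q) {ζ ζ' ξ ξ' : L2per L}
    (hζ : IsLift x₀ ζ ζ' (fun x => (y x : ℂ)) (fun x => (Z x : ℂ)))
    (hξ : IsLift x₀ ξ ξ' (fun x => (ψ x : ℂ)) (fun x => (N x : ℂ))) {v : L2per L}
    (hv : (A - ((3 * c : ℝ) : ℂ) • resolventFour L) v = 0) :
    ∃ r s : ℂ, (τ : ℂ) * r = 0 ∧
      v = r • (((3 * c : ℝ) : ℂ) • mulOp W ζ) + s • (((3 * c : ℝ) : ℂ) • mulOp W ξ) := by
  obtain ⟨χ, χ', hχ, hcond⟩ := P.exists_condition S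
  obtain ⟨u', U, U', hu, hd, hc⟩ := exists_isLift_resolventFour x₀ v
  have hE : ∀ {η η' : L2per L}, IsWeakDeriv η η' →
      energyForm c (mulOp W) η η' (resolventFour L v) u' = 0 := fun hη =>
    energyForm_eq_zero_of_apply_eq_zero S.inv_mul hη hu.isWeakDeriv hv
  have h1 := P.mul_eq_zero_of_energyForm S hζ hu (hE hζ.isWeakDeriv)
  -- For a null vector all energy products with `u = Kv` vanish, so the constraints hold
  -- automatically and `u` attains equality in the lower bound.
  obtain ⟨s, hs⟩ := (P.energyForm_ge S.inv_eq S.potential_eq hu hd hc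
    (hcond hu (hE hχ))).2 (by
      rw [hE hu.isWeakDeriv]
      rcases mul_eq_zero.mp h1 with h | h
      · rw [Complex.ofReal_eq_zero.mp h]; simp
      · rw [h]; simp)
  refine ⟨2 * (N x₀ : ℂ) * U x₀, s, by linear_combination 2 * (N x₀ : ℂ) * h1, ?_⟩
  have h2 : resolventFour L v = (2 * (N x₀ : ℂ) * U x₀) • ζ + s • ξ :=
    hu.rep.unique (((hζ.smul _).add (hξ.smul s)).rep.congr fun x hx =>
      (hs x (Set.Ioc_subset_Icc_self hx)).symm)
  rw [eq_of_apply_eq_zero S.inv_mul hv, h2, map_add, map_smul, map_smul, smul_add,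
    smul_comm ((3 * c : ℝ) : ℂ), smul_comm ((3 * c : ℝ) : ℂ)]

/-- At the end of the period `ψ` vanishes and `y` does not, which removes the first coefficient;
inside `(x₀, x₁)` the function `ψ` is nonzero, which removes the second. -/
theorem Profile.linearIndependent (P : Profile L x₀ x₁ τ q ψ N y Z)
    (S : IsWaveOperator c A W w q) {ζ ζ' ξ ξ' : L2per L}
    (hζ : IsLift x₀ ζ ζ' (fun x => (y x : ℂ)) (fun x => (Z x : ℂ)))
    (hξ : IsLift x₀ ξ ξ' (fun x => (ψ x : ℂ)) (fun x => (N x : ℂ))) :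
    LinearIndependent ℂ ![((3 * c : ℝ) : ℂ) • mulOp W ζ, ((3 * c : ℝ) : ℂ) • mulOp W ξ] := by
  have hL : (0 : ℝ) < L := Fact.out
  have hc : ((3 * c : ℝ) : ℂ) ≠ 0 := Complex.ofReal_ne_zero.mpr (by linarith [S.pos])
  have hinv : ∀ v, A (mulOp W v) = v := fun v => by
    rw [← mul_apply_eq_comp A, S.mul_inv, one_apply_eq_self]
  rw [LinearIndependent.pair_iff]
  intro r s h
  have h1 : r • ζ + s • ξ = 0 := by
    have := congrArg A h
    rw [map_add, map_smul, map_smul, map_smul, map_smul, hinv, hinv, map_zero, smul_comm r,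
      smul_comm s, ← smul_add, smul_eq_zero] at this
    exact this.resolve_left hc
  have h2 := (hζ.smul r).add (hξ.smul s)
  rw [h1] at h2
  have h3 := h2.rep.eq_zero h2.cont
  have hr : r = 0 := by
    have h4 := h3 (x₀ + L) ⟨by linarith, le_rfl⟩
    simp only [P.y_right, P.ψ_right, Complex.ofReal_zero, mul_zero, add_zero] at h4
    refine (mul_eq_zero.mp h4).resolve_right (Complex.ofReal_ne_zero.mpr fun h => ?_)
    have := P.y_left
    rw [h] at this
    norm_num at this
  refine ⟨hr, ?_⟩
  have hm : (x₀ + x₁) / 2 ∈ Set.Ioo x₀ x₁ := by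
    constructor <;> linarith [P.lt_left]
  have h5 := h3 ((x₀ + x₁) / 2) ⟨hm.1, hm.2.le.trans P.lt_right.le⟩
  simp only [hr, zero_mul, zero_add] at h5
  exact (mul_eq_zero.mp h5).resolve_right (Complex.ofReal_ne_zero.mpr (P.ψ_ne_left _ hm))

theorem Profile.apply_periodic_eq_zero (P : Profile L x₀ x₁ τ q ψ N y Z)
    (S : IsWaveOperator c A W w q) {ξ ξ' : L2per L}
    (hξ : IsLift x₀ ξ ξ' (fun x => (ψ x : ℂ)) (fun x => (N x : ℂ))) :
    (A - ((3 * c : ℝ) : ℂ) • resolventFour L) (((3 * c : ℝ) : ℂ) • mulOp W ξ) = 0 :=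
  (apply_eq_zero_of_energyForm S.mul_inv hξ.isWeakDeriv fun n =>
    P.energyForm_periodic S.inv_eq S.potential_eq hξ (isLift_fourier x₀ n)).2

theorem Profile.apply_jacobi_eq_zero (P : Profile L x₀ x₁ τ q ψ N y Z)
    (S : IsWaveOperator c A W w q) {ζ ζ' : L2per L}
    (hζ : IsLift x₀ ζ ζ' (fun x => (y x : ℂ)) (fun x => (Z x : ℂ))) (hτ : τ = 0) :
    (A - ((3 * c : ℝ) : ℂ) • resolventFour L) (((3 * c : ℝ) : ℂ) • mulOp W ζ) = 0 :=
  (apply_eq_zero_of_energyForm S.mul_inv hζ.isWeakDeriv fun n => by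
    rw [P.energyForm_jacobi S.inv_eq S.potential_eq hζ (isLift_fourier x₀ n), hτ]; simp).2

theorem Profile.eigenspace_le_span (P : Profile L x₀ x₁ τ q ψ N y Z)
    (S : IsWaveOperator c A W w q) {ζ ζ' ξ ξ' : L2per L}
    (hζ : IsLift x₀ ζ ζ' (fun x => (y x : ℂ)) (fun x => (Z x : ℂ)))
    (hξ : IsLift x₀ ξ ξ' (fun x => (ψ x : ℂ)) (fun x => (N x : ℂ))) :
    Module.End.eigenspace
        ((A - ((3 * c : ℝ) : ℂ) • resolventFour L : L2per L →L[ℂ] L2per L) :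
          L2per L →ₗ[ℂ] L2per L) 0 ≤
      Submodule.span ℂ
        (Set.range ![((3 * c : ℝ) : ℂ) • mulOp W ζ, ((3 * c : ℝ) : ℂ) • mulOp W ξ]) := by
  intro v hv
  rw [Module.End.mem_eigenspace_iff, zero_smul] at hv
  obtain ⟨r, s, -, h⟩ := P.exists_eq_of_apply_eq_zero S hζ hξ hv
  rw [h, Matrix.range_cons_cons_empty]
  exact Submodule.mem_span_pair.mpr ⟨r, s, rfl⟩

theorem Profile.eigMult_zero_eq_one (P : Profile L x₀ x₁ τ q ψ N y Z)
    (S : IsWaveOperator c A W w q) {ζ ζ' ξ ξ' : L2per L}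
    (hζ : IsLift x₀ ζ ζ' (fun x => (y x : ℂ)) (fun x => (Z x : ℂ)))
    (hξ : IsLift x₀ ξ ξ' (fun x => (ψ x : ℂ)) (fun x => (N x : ℂ))) (hτ : τ ≠ 0) :
    eigMult (A - ((3 * c : ℝ) : ℂ) • resolventFour L) 0 = 1 := by
  have hne : ((3 * c : ℝ) : ℂ) • mulOp W ξ ≠ 0 := (P.linearIndependent S hζ hξ).ne_zero 1
  have h : Module.End.eigenspace
        ((A - ((3 * c : ℝ) : ℂ) • resolventFour L : L2per L →L[ℂ] L2per L) :
          L2per L →ₗ[ℂ] L2per L) 0 =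
      Submodule.span ℂ {((3 * c : ℝ) : ℂ) • mulOp W ξ} := by
    refine le_antisymm (fun v hv => ?_) ((Submodule.span_singleton_le_iff_mem _ _).mpr ?_)
    · rw [Module.End.mem_eigenspace_iff, zero_smul] at hv
      obtain ⟨r, s, hr, h⟩ := P.exists_eq_of_apply_eq_zero S hζ hξ hv
      rw [(mul_eq_zero.mp hr).resolve_left (Complex.ofReal_ne_zero.mpr hτ), zero_smul,
        zero_add] at h
      exact Submodule.mem_span_singleton.mpr ⟨s, h.symm⟩
    · rw [Module.End.mem_eigenspace_iff, zero_smul]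
      exact P.apply_periodic_eq_zero S hξ
  rw [eigMult, h, ← Module.finrank_eq_rank, finrank_span_singleton hne, Nat.cast_one]

theorem Profile.eigMult_zero_eq_two (P : Profile L x₀ x₁ τ q ψ N y Z)
    (S : IsWaveOperator c A W w q) {ζ ζ' ξ ξ' : L2per L}
    (hζ : IsLift x₀ ζ ζ' (fun x => (y x : ℂ)) (fun x => (Z x : ℂ)))
    (hξ : IsLift x₀ ξ ξ' (fun x => (ψ x : ℂ)) (fun x => (N x : ℂ))) (hτ : τ = 0) :
    eigMult (A - ((3 * c : ℝ) : ℂ) • resolventFour L) 0 = 2 := by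
  have h := le_antisymm (P.eigenspace_le_span S hζ hξ) (by
    rw [Submodule.span_le, Matrix.range_cons_cons_empty]
    rintro v (rfl | rfl)
    · exact (Module.End.mem_eigenspace_iff.trans (by rw [zero_smul]; rfl)).mpr
        (P.apply_jacobi_eq_zero S hζ hτ)
    · exact (Module.End.mem_eigenspace_iff.trans (by rw [zero_smul]; rfl)).mpr
        (P.apply_periodic_eq_zero S hξ))
  rw [eigMult, h, rank_span (P.linearIndependent S hζ hξ),
    Cardinal.mk_range_eq _ (P.linearIndependent S hζ hξ).injective, Cardinal.mk_fin]
  exact Nat.cast_ofNat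

end Count

/-! ### Application to the Hessian of the wave. -/

theorem isWaveOperator_hessian {c a b L : ℝ} [Fact (0 < L)] {φ : ℝ → ℝ} (hc : 0 < c)
    (h : IsSmoothPeriodicWave c a b L φ) :
    ∃ W : C(AddCircle L, ℂ),
      IsWaveOperator c (mulOp (speedMinus c h.smooth.continuous h.periodic)) W
        (fun x => c - φ x) (fun x => 4 - 3 * c / (c - φ x)) := by
  set V := speedMinus c h.smooth.continuous h.periodic with hV
  have hpos : ∀ t, 0 < c - h.periodic.lift t := fun t => by
    induction t using QuotientAddGroup.induction_on with
    | H x => exact h.lt_speed x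
  have hVt : ∀ t, V t = ((c - h.periodic.lift t : ℝ) : ℂ) := fun t => rfl
  have hV0 : ∀ t, V t ≠ 0 := fun t => by
    rw [hVt]; exact Complex.ofReal_ne_zero.mpr (hpos t).ne'
  have hVc : ∀ t, (starRingEnd ℂ) (V t) = V t := fun t => by rw [hVt, Complex.conj_ofReal]
  set W : C(AddCircle L, ℂ) := ⟨fun t => (V t)⁻¹, V.continuous.inv₀ hV0⟩
  refine ⟨W, hc, fun x => ?_, fun x => rfl, isSelfAdjoint_mulOp hVc,
    isSelfAdjoint_mulOp fun t => ?_, ?_, ?_, re_inner_mulOp_nonneg hVt fun t => (hpos t).le⟩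
  · rw [Complex.ofReal_inv]; rfl
  · change (starRingEnd ℂ) (V t)⁻¹ = (V t)⁻¹
    rw [map_inv₀, hVc]
  · rw [← mulOp_mul, show V * W = ContinuousMap.const _ 1 from
      ContinuousMap.ext fun t => mul_inv_cancel₀ (hV0 t), mulOp_const, map_one]
  · rw [← mulOp_mul, show W * V = ContinuousMap.const _ 1 from
      ContinuousMap.ext fun t => inv_mul_cancel₀ (hV0 t), mulOp_const, map_one]

/-- The multiplication part of the Hessian has spectrum bounded below by a positive number. -/
theorem exists_pos_isUnit_speedMinus {c a b L : ℝ} [Fact (0 < L)] {φ : ℝ → ℝ}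
    (h : IsSmoothPeriodicWave c a b L φ) :
    ∃ w₀ : ℝ, 0 < w₀ ∧ ∀ r : ℝ, r < w₀ →
      IsUnit (mulOp (speedMinus c h.smooth.continuous h.periodic) -
        algebraMap ℂ (L2per L →L[ℂ] L2per L) (r : ℂ)) := by
  have hcont : Continuous fun t : AddCircle L => c - h.periodic.lift t :=
    continuous_const.sub (h.smooth.continuous.quotient_liftOn' _)
  obtain ⟨t₀, -, ht₀⟩ := isCompact_univ.exists_isMinOn ⟨(0 : AddCircle L), trivial⟩
    hcont.continuousOn
  refine ⟨c - h.periodic.lift t₀, ?_, fun r hr => isUnit_mulOp_sub fun t ht => ?_⟩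
  · induction t₀ using QuotientAddGroup.induction_on with
    | H x => exact h.lt_speed x
  · have h1 : c - h.periodic.lift t = r := Complex.ofReal_injective ht
    have h2 : c - h.periodic.lift t₀ ≤ c - h.periodic.lift t := ht₀ (Set.mem_univ t)
    linarith

end DPWave

theorem lemma4p2 (c a b L : ℝ) [Fact (0 < L)] (φ : ℝ → ℝ) (hc : 0 < c)
    (hab : (a, b) ∈ DPWave.existenceRegion c)
    (hφ : DPWave.IsSmoothPeriodicWave c a b L φ) :
    DifferentiableAt ℝ (fun a' => DPWave.periodFn c a' b) a ∧
    (0 < deriv (fun a' => DPWave.periodFn c a' b) a →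
      DPWave.negEigCount (DPWave.hessian c hφ.smooth.continuous hφ.periodic) = 2 ∧
      DPWave.eigMult (DPWave.hessian c hφ.smooth.continuous hφ.periodic) 0 = 1) ∧
    (deriv (fun a' => DPWave.periodFn c a' b) a = 0 →
      DPWave.negEigCount (DPWave.hessian c hφ.smooth.continuous hφ.periodic) = 1 ∧
      DPWave.eigMult (DPWave.hessian c hφ.smooth.continuous hφ.periodic) 0 = 2) ∧
    (deriv (fun a' => DPWave.periodFn c a' b) a < 0 →
      DPWave.negEigCount (DPWave.hessian c hφ.smooth.continuous hφ.periodic) = 1 ∧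
      DPWave.eigMult (DPWave.hessian c hφ.smooth.continuous hφ.periodic) 0 = 1) ∧
    ∃ δ : ℝ, 0 < δ ∧
      ∀ z ∈ spectrum ℂ (DPWave.hessian c hφ.smooth.continuous hφ.periodic),
        z = 0 ∨
        (∃ r : ℝ, r < 0 ∧ z = (r : ℂ) ∧
          Module.End.HasEigenvalue
            (DPWave.hessian c hφ.smooth.continuous hφ.periodic :
              DPWave.L2per L →ₗ[ℂ] DPWave.L2per L) z) ∨
        ∃ r : ℝ, δ ≤ r ∧ z = (r : ℂ) := by
  obtain ⟨τ, x₀, x₁, ψ, N, y, Z, hder, P⟩ := DPWave.exists_profile hc hab hφ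
  obtain ⟨W, S⟩ := DPWave.isWaveOperator_hessian hc hφ
  obtain ⟨w₀, hw₀, hunit⟩ := DPWave.exists_pos_isUnit_speedMinus hφ
  obtain ⟨ζ, ζ', hζ⟩ := DPWave.IsLift.exists_of_real (L := L) P.deriv_y P.cont_Z P.y_right
  obtain ⟨ξ, ξ', hξ⟩ := DPWave.IsLift.exists_of_real (L := L) P.deriv_ψ P.cont_N
    (P.ψ_right.trans P.ψ_left.symm)
  have hK : IsCompactOperator (((3 * c : ℝ) : ℂ) • DPWave.resolventFour L) :=
    (DPWave.isCompactOperator_resolventFour (L := L)).smul ((3 * c : ℝ) : ℂ)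
  have hT : IsSelfAdjoint (DPWave.mulOp (DPWave.speedMinus c hφ.smooth.continuous hφ.periodic) -
      ((3 * c : ℝ) : ℂ) • DPWave.resolventFour L) :=
    S.selfAdjoint.sub (IsSelfAdjoint.smul (Complex.conj_ofReal _)
      DPWave.isSelfAdjoint_resolventFour)
  have hneg : ∀ r : ℝ, r < 0 → IsUnit (DPWave.mulOp (DPWave.speedMinus c hφ.smooth.continuous
      hφ.periodic) - algebraMap ℂ (DPWave.L2per L →L[ℂ] DPWave.L2per L) (r : ℂ)) :=
    fun r hr => hunit r (hr.trans hw₀)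
  -- The gap argument projects onto the kernel; in all three cases the kernel lies in the span of
  -- the two vectors coming from `y` and `ψ`.
  have hfin : FiniteDimensional ℂ (Module.End.eigenspace
      ((DPWave.mulOp (DPWave.speedMinus c hφ.smooth.continuous hφ.periodic) -
        ((3 * c : ℝ) : ℂ) • DPWave.resolventFour L : DPWave.L2per L →L[ℂ] DPWave.L2per L) :
          DPWave.L2per L →ₗ[ℂ] DPWave.L2per L) 0) := by
    have := FiniteDimensional.span_of_finite ℂ (Set.finite_range
      ![((3 * c : ℝ) : ℂ) • DPWave.mulOp W ζ, ((3 * c : ℝ) : ℂ) • DPWave.mulOp W ξ])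
    exact Submodule.finiteDimensional_of_le (P.eigenspace_le_span S hζ hξ)
  rw [hder.deriv]
  refine ⟨hder.differentiableAt, fun hτ => ⟨?_, P.eigMult_zero_eq_one S hζ hξ hτ.ne'⟩,
    fun hτ => ⟨?_, P.eigMult_zero_eq_two S hζ hξ hτ⟩,
    fun hτ => ⟨?_, P.eigMult_zero_eq_one S hζ hξ hτ.ne⟩, DPWave.spectrum_gap hT hK hw₀ hunit⟩
  · exact le_antisymm (P.rank_negSpace_le_two S hT hζ) (P.two_le_rank_negSpace S hT hK hneg hζ hτ)
  · exact le_antisymm (P.rank_negSpace_le_one S hT hτ.le) (P.one_le_rank_negSpace S hT hK hneg hζ)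
  · exact le_antisymm (P.rank_negSpace_le_one S hT hτ.le) (P.one_le_rank_negSpace S hT hK hneg hζ)
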